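/- Let $F$ be an ultrafilter on a set $I$, and for a set $X$ let ${}^*X=X^I/F$ be the resulting nonstandard extension; internal sets, internal functions, hyperfinite sums and the extensions of standard functions are those of this ultrapower. Let ${}^*K\subset{}^*\mathbb C$ be a hyper number field, that is, an internal subfield of ${}^*\mathbb C$ that has an internal basis over ${}^*\mathbb Q$ with hyperfinitely many elements, and let $n\in{}^*\mathbb N$ be its degree, the number of elements of such a basis. Denote by $r_1$ the (hyperfinite) number of hyperreal embeddings of ${}^*K$ into ${}^*\mathbb C$, by $r_2$ the number of conjugate pairs of the other embeddings, by $d$ the discriminant, by $h$ the class number (the internal cardinality of the group of classes of internal fractional ideals), by ${}^*R$ the regulator and by $w$ the number of roots of unity of ${}^*K$, all in the internal sense. The hyper Dedekind zeta function is $$\zeta_{{}^*K}(s)=\sum_{\mathfrak a}\frac1{N(\mathfrak a)^{s}},\qquad {}^*\mathrm{Re}(s)>1,$$ where $\mathfrak a$ runs over the nonzero internal ideals of the ring of hyperintegers of ${}^*K$ and $N(\mathfrak a)$ is the internal index of $\mathfrak a$; the sum is the limit, in the Q-topology (the topology of ${}^*\mathbb C$ with radii $\varepsilon\in{}^*\mathbb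 R_{>0}$), of the hyperfinite sums over the $\mathfrak a$ with $N(\mathfrak a)\le M$ as $M\to\infty$ in ${}^*\mathbb N$. An internal function is Q-analytic on a set if it has Q-derivatives of all orders (derivatives in the $\varepsilon$-$\delta$ sense with $\varepsilon,\delta\in{}^*\mathbb R_{>0}$) at all points of the set. Then the sum defining $\zeta_{{}^*K}(s)$ Q-converges for all $s$ with ${}^*\mathrm{Re}(s)>1$, and $\zeta_{{}^*K}$ has a Q-analytic continuation to ${}^*\mathbb C\setminus\{1\}$. The continuation, again denoted by $\zeta_{{}^*K}$, has a simple pole at $s=1$ with residue $$\frac{2^{r_1}(2\pi)^{r_2}}{w\,|d|^{1/2}}\,h\,{}^*R .$$ For all $s\in{}^*\mathbb C$ other than $1$ and the hyperintegers $\le 0$ it satisfies $$\zeta_{{}^*K}(1-s)={}^*A(s)\,\zeta_{{}^*K}(s),$$ $${}^*A(s)=2^{n}(2\pi)^{-ns}\,|d|^{\,s-1/2}\,\bigl({}^*\cos(\pi s/2)\bigr)^{r_1+r_2}\bigl({}^*\sin(\pi s/2)\bigr)^{r_2}\,{}^*\Gamma(s)^{n}.$$ -/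

import Mathlib

open Filter

noncomputable section

/-! ### Nonstandard extensions

The nonstandard universe is the ultrapower along an arbitrary ultrafilter `F` on an arbitrary index
set `I`. An element of `Hyper F X` is an element of the nonstandard extension `*X`. In particular an
element of `Hyper F (Set X)` is an internal subset of `*X`, and an element of `Hyper F (X → Y)` is
an internal function from `*X` to `*Y`. -/

/-- The nonstandard extension `*X` of `X`. -/
abbrev Hyper {I : Type*} (F : Ultrafilter I) (X : Type*) : Type _ :=
  Filter.Germ (F : Filter I) X

section Internal

variable {I : Type*} {F : Ultrafilter I} {X Y : Type*}

/-- The value of an internal function at a point. -/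
def happ (f : Hyper F (X → Y)) (x : Hyper F X) : Hyper F Y :=
  Germ.map₂ (fun g y => g y) f x

/-- Membership in an internal set. -/
def hmem (x : Hyper F X) (A : Hyper F (Set X)) : Prop :=
  Germ.LiftRel (fun y B => y ∈ B) x A

/-- A subset of `*X` is internal if it consists of the elements of some `A : *(Set X)`. -/
def IsInternalSet (S : Set (Hyper F X)) : Prop :=
  ∃ A : Hyper F (Set X), ∀ x, x ∈ S ↔ hmem x A

end Internal

section Numbers

variable {I : Type*} {F : Ultrafilter I}

/-- The inclusion of the hypernaturals in the hypercomplex numbers. -/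
def hnat (m : Hyper F ℕ) : Hyper F ℂ := Germ.map (fun k : ℕ => (k : ℂ)) m

/-- The inclusion of the hyperreals in the hypercomplex numbers. -/
def hreal (x : Hyper F ℝ) : Hyper F ℂ := Germ.map (fun r : ℝ => (r : ℂ)) x

/-- A standard complex number, as a hypercomplex number. -/
def hconst (F : Ultrafilter I) (z : ℂ) : Hyper F ℂ := ((z : ℂ) : Germ (F : Filter I) ℂ)

/-- The hyperreal part. -/
def hre (z : Hyper F ℂ) : Hyper F ℝ := Germ.map Complex.re z

/-- The hyperreal absolute value of a hypercomplex number; the hypermetric is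
`*d(z, w) = hnorm (z - w)`. -/
def hnorm (z : Hyper F ℂ) : Hyper F ℝ := Germ.map (fun w : ℂ => ‖w‖) z

/-- The hyper cosine. -/
def hcos (z : Hyper F ℂ) : Hyper F ℂ := Germ.map Complex.cos z

/-- The hyper sine. -/
def hsin (z : Hyper F ℂ) : Hyper F ℂ := Germ.map Complex.sin z

/-- The hyper gamma function. -/
def hGamma (z : Hyper F ℂ) : Hyper F ℂ := Germ.map Complex.Gamma z

/-- Powers with a hypernatural exponent. -/
def hpow (z : Hyper F ℂ) (m : Hyper F ℕ) : Hyper F ℂ := Germ.map₂ (fun w k => w ^ k) z m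

/-- Powers with a hypercomplex exponent, `z ^ s = *exp (s *log z)` with the principal branch. -/
def hcpow (z s : Hyper F ℂ) : Hyper F ℂ := Germ.map₂ (fun w t => w ^ t) z s

/-- The hyperfinite sum `∑_{j < N} a_j ω_j` for internal sequences `a` in `*ℚ` and `ω` in `*ℂ`. -/
def hcomb (N : Hyper F ℕ) (a : Hyper F (ℕ → ℚ)) (ω : Hyper F (ℕ → ℂ)) : Hyper F ℂ :=
  Germ.map₂ (fun m f => ∑ j ∈ Finset.range m, f j) N
    (Germ.map₂ (fun (b : ℕ → ℚ) (v : ℕ → ℂ) (j : ℕ) => (b j : ℂ) * v j) a ω)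

end Numbers

section QAnalysis

variable {I : Type*} {F : Ultrafilter I}

/-- The hypersequence `u` Q-converges to `S`. -/
def HasQLimit (u : Hyper F ℕ → Hyper F ℂ) (S : Hyper F ℂ) : Prop :=
  ∀ ε : Hyper F ℝ, 0 < ε → ∃ N : Hyper F ℕ, ∀ m : Hyper F ℕ, N ≤ m → hnorm (u m - S) < ε

/-- `c` is the Q-derivative of the internal function `f` at `z₀`. -/
def HasQDeriv (f : Hyper F (ℂ → ℂ)) (c z₀ : Hyper F ℂ) : Prop :=
  ∀ ε : Hyper F ℝ, 0 < ε → ∃ δ : Hyper F ℝ, 0 < δ ∧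
    ∀ h : Hyper F ℂ, h ≠ 0 → hnorm h < δ → hnorm ((happ f (z₀ + h) - happ f z₀) / h - c) < ε

/-- The internal function `f` is Q-analytic on `B`: it is infinitely Q-differentiable at all points
of `B`. The internal sequence `D` is that of the successive Q-derivatives, of all hypernatural
orders. -/
def QAnalyticOn (f : Hyper F (ℂ → ℂ)) (B : Set (Hyper F ℂ)) : Prop :=
  ∃ D : Hyper F (ℕ → ℂ → ℂ), happ D 0 = f ∧
    ∀ k : Hyper F ℕ, ∀ z ∈ B, HasQDeriv (happ D k) (happ (happ D (k + 1)) z) z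

/-- The internal function `f` has a simple pole at `a`, with residue `ρ`: near `a` it is the sum of
`ρ / (z - a)`, with `ρ ≠ 0`, and a Q-analytic function. -/
def HasSimpleQPole (f : Hyper F (ℂ → ℂ)) (a ρ : Hyper F ℂ) : Prop :=
  ρ ≠ 0 ∧ ∃ r : Hyper F ℝ, 0 < r ∧ ∃ g : Hyper F (ℂ → ℂ),
    QAnalyticOn g {z | hnorm (z - a) < r} ∧
    ∀ z : Hyper F ℂ, hnorm (z - a) < r → z ≠ a → happ f z = ρ / (z - a) + happ g z

end QAnalysis

/-! ### Hyper number fields -/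

/-- The set `𝒦` of the algebraic number fields contained in `ℂ`. -/
abbrev NumberSubfield : Type :=
  {k : IntermediateField ℚ ℂ // FiniteDimensional ℚ k}

instance (k : NumberSubfield) : NumberField k.1 :=
  have := k.2
  { to_charZero := inferInstance, to_finiteDimensional := inferInstance }

section HyperFields

variable {I : Type*} {F : Ultrafilter I}

/-- `K` has dimension `n ∈ *ℕ` over `*ℚ`: there is an internal basis `(ω_j)_{j < n}` of `K` over
`*ℚ`, linear combinations being hyperfinite sums with an internal sequence of coefficients. -/
def HasHyperDegree (K : Subfield (Hyper F ℂ)) (n : Hyper F ℕ) : Prop :=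
  ∃ ω : Hyper F (ℕ → ℂ),
    (∀ x : Hyper F ℂ, x ∈ K ↔ ∃ a : Hyper F (ℕ → ℚ), x = hcomb n a ω) ∧
    ∀ a : Hyper F (ℕ → ℚ), hcomb n a ω = 0 → ∀ j : Hyper F ℕ, j < n → happ a j = 0

/-- A hyper (algebraic) number field is an internal subfield of `*ℂ` whose dimension over `*ℚ` is
hyperfinite. -/
def IsHyperNumberField (K : Subfield (Hyper F ℂ)) : Prop :=
  IsInternalSet (K : Set (Hyper F ℂ)) ∧ ∃ n : Hyper F ℕ, HasHyperDegree K n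

theorem eventually_forall_of_choice {P : I → ℂ → ℂ → Prop} (h0 : ∀ i, P i 0 0)
    {Q : I → ℂ → ℂ → Prop}
    (h : ∀ x y : I → ℂ, (∀ i, P i (x i) (y i)) → ∀ᶠ i in (F : Filter I), Q i (x i) (y i)) :
    ∀ᶠ i in (F : Filter I), ∀ x y : ℂ, P i x y → Q i x y := by
  classical
  have hex : ∀ i, ∃ p : ℂ × ℂ, P i p.1 p.2 ∧
      (Q i p.1 p.2 → ∀ x y : ℂ, P i x y → Q i x y) := by
    intro i
    by_cases hall : ∀ x y : ℂ, P i x y → Q i x y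
    · exact ⟨(0, 0), h0 i, fun _ => hall⟩
    · push Not at hall
      obtain ⟨x, y, hP, hQ⟩ := hall
      exact ⟨(x, y), hP, fun hq => absurd hq hQ⟩
  choose p hp hq using hex
  filter_upwards [h (fun i => (p i).1) (fun i => (p i).2) hp] with i hi
  exact hq i hi

/-- The hyper number fields are the internal sets that belong to the extension `*𝒦` of the set of
number fields. -/
theorem IsHyperNumberField.exists_germ {K : Subfield (Hyper F ℂ)} (hK : IsHyperNumberField K) :
    ∃ κ : Hyper F NumberSubfield, ∀ x : Hyper F ℂ,
      x ∈ K ↔ Germ.LiftRel (fun (z : ℂ) (k : NumberSubfield) => z ∈ k.1) x κ := by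
  classical
  obtain ⟨-, n, ω, hω, -⟩ := hK
  induction n using Germ.inductionOn with | _ N =>
  induction ω using Germ.inductionOn with | _ w =>
  let V : I → Submodule ℚ ℂ := fun i =>
    Submodule.span ℚ (w i '' (Finset.range (N i) : Set ℕ))
  have hV : ∀ i z, z ∈ V i ↔ ∃ a : ℕ → ℚ, z = ∑ j ∈ Finset.range (N i), (a j : ℂ) * w i j := by
    intro i z
    rw [Submodule.mem_span_image_finset_iff_exists_fun]
    constructor
    · rintro ⟨a, rfl⟩
      refine ⟨fun j => if hj : j ∈ Finset.range (N i) then a ⟨j, hj⟩ else 0, ?_⟩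
      rw [← Finset.sum_attach (Finset.range (N i))]
      refine Finset.sum_congr rfl fun j _ => ?_
      simp only [j.2, dif_pos, Algebra.smul_def]
      rfl
    · rintro ⟨a, rfl⟩
      refine ⟨fun j => a j, ?_⟩
      rw [← Finset.sum_attach (Finset.range (N i))]
      refine Finset.sum_congr rfl fun j _ => ?_
      rw [Algebra.smul_def]
      rfl
  have hmemK : ∀ x : I → ℂ, ((x : Germ (F : Filter I) ℂ) ∈ K) ↔
      ∀ᶠ i in (F : Filter I), x i ∈ V i := by
    intro x
    rw [hω]
    constructor
    · rintro ⟨a, ha⟩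
      induction a using Germ.inductionOn with | _ a =>
      have ha' : ∀ᶠ i in (F : Filter I),
          x i = ∑ j ∈ Finset.range (N i), (a i j : ℂ) * w i j := Germ.coe_eq.1 ha
      filter_upwards [ha'] with i hi
      exact (hV i _).2 ⟨a i, hi⟩
    · intro h
      have : ∀ i, ∃ a : ℕ → ℚ, x i ∈ V i →
          x i = ∑ j ∈ Finset.range (N i), (a j : ℂ) * w i j := by
        intro i
        by_cases hi : x i ∈ V i
        · obtain ⟨a, ha⟩ := (hV i _).1 hi
          exact ⟨a, fun _ => ha⟩
        · exact ⟨0, fun h => absurd h hi⟩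
      choose a ha using this
      refine ⟨(a : Germ (F : Filter I) (ℕ → ℚ)), Germ.coe_eq.2 ?_⟩
      filter_upwards [h] with i hi
      exact ha i hi
  have hone : ∀ᶠ i in (F : Filter I), (1 : ℂ) ∈ V i := (hmemK (fun _ => 1)).1 K.one_mem
  have hmul : ∀ᶠ i in (F : Filter I), ∀ x y : ℂ, (x ∈ V i ∧ y ∈ V i) → x * y ∈ V i := by
    refine eventually_forall_of_choice (fun i => ⟨(V i).zero_mem, (V i).zero_mem⟩) ?_
    intro x y hxy
    exact (hmemK (fun i => x i * y i)).1 (K.mul_mem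
      ((hmemK x).2 (Eventually.of_forall fun i => (hxy i).1))
      ((hmemK y).2 (Eventually.of_forall fun i => (hxy i).2)))
  have hinv : ∀ᶠ i in (F : Filter I), ∀ x y : ℂ, (x ∈ V i ∧ y ∈ V i) → x⁻¹ ∈ V i := by
    refine eventually_forall_of_choice (fun i => ⟨(V i).zero_mem, (V i).zero_mem⟩) ?_
    intro x y hxy
    exact (hmemK (fun i => (x i)⁻¹)).1 (K.inv_mem
      ((hmemK x).2 (Eventually.of_forall fun i => (hxy i).1)))
  have hk : ∀ i, ∃ k : NumberSubfield, ((1 : ℂ) ∈ V i ∧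
      (∀ x y : ℂ, (x ∈ V i ∧ y ∈ V i) → x * y ∈ V i) ∧
      (∀ x y : ℂ, (x ∈ V i ∧ y ∈ V i) → x⁻¹ ∈ V i)) → ∀ z, z ∈ k.1 ↔ z ∈ V i := by
    intro i
    by_cases hi : ((1 : ℂ) ∈ V i ∧
      (∀ x y : ℂ, (x ∈ V i ∧ y ∈ V i) → x * y ∈ V i) ∧
      (∀ x y : ℂ, (x ∈ V i ∧ y ∈ V i) → x⁻¹ ∈ V i))
    · obtain ⟨h1, h2, h3⟩ := hi
      let A : Subalgebra ℚ ℂ := (V i).toSubalgebra h1 fun x y hx hy => h2 x y ⟨hx, hy⟩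
      let k : IntermediateField ℚ ℂ := A.toIntermediateField fun x hx => h3 x x ⟨hx, hx⟩
      have hfin : FiniteDimensional ℚ (V i) :=
        FiniteDimensional.span_of_finite ℚ ((Finset.finite_toSet _).image _)
      exact ⟨⟨k, hfin⟩, fun _ z => Iff.rfl⟩
    · exact ⟨⟨⊥, inferInstance⟩, fun h => absurd h hi⟩
  choose k hk using hk
  refine ⟨(k : Germ (F : Filter I) NumberSubfield), fun x => ?_⟩
  induction x using Germ.inductionOn with | _ x =>
  rw [hmemK, Germ.liftRel_coe]
  refine eventually_congr ?_
  filter_upwards [hone, hmul, hinv] with i h1 h2 h3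
  exact (hk i ⟨h1, h2, h3⟩ (x i)).symm

/-- The element of `*𝒦` of which `K` is the set of elements is unique. -/
theorem hyperNumberField_germ_unique {K : Subfield (Hyper F ℂ)} {κ μ : Hyper F NumberSubfield}
    (hκ : ∀ x : Hyper F ℂ,
      x ∈ K ↔ Germ.LiftRel (fun (z : ℂ) (k : NumberSubfield) => z ∈ k.1) x κ)
    (hμ : ∀ x : Hyper F ℂ,
      x ∈ K ↔ Germ.LiftRel (fun (z : ℂ) (k : NumberSubfield) => z ∈ k.1) x μ) : κ = μ := by
  induction κ using Germ.inductionOn with | _ k =>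
  induction μ using Germ.inductionOn with | _ m =>
  have h1 : ∀ᶠ i in (F : Filter I), ∀ x y : ℂ, x ∈ (k i).1 → x ∈ (m i).1 :=
    eventually_forall_of_choice (P := fun i x _ => x ∈ (k i).1) (Q := fun i x _ => x ∈ (m i).1)
      (fun i => (k i).1.zero_mem) fun x _ hx =>
        Germ.liftRel_coe.1 ((hμ x).1 ((hκ x).2 (Germ.liftRel_coe.2 (Eventually.of_forall hx))))
  have h2 : ∀ᶠ i in (F : Filter I), ∀ x y : ℂ, x ∈ (m i).1 → x ∈ (k i).1 :=
    eventually_forall_of_choice (P := fun i x _ => x ∈ (m i).1) (Q := fun i x _ => x ∈ (k i).1)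
      (fun i => (m i).1.zero_mem) fun x _ hx =>
        Germ.liftRel_coe.1 ((hκ x).1 ((hμ x).2 (Germ.liftRel_coe.2 (Eventually.of_forall hx))))
  refine Germ.coe_eq.2 ?_
  filter_upwards [h1, h2] with i a b
  exact Subtype.ext (SetLike.ext fun x => ⟨a x 0, b x 0⟩)

/-- A hyper number field, as an element of `*𝒦`. -/
def IsHyperNumberField.toStar {K : Subfield (Hyper F ℂ)} (hK : IsHyperNumberField K) :
    Hyper F NumberSubfield :=
  hK.exists_germ.choose

theorem IsHyperNumberField.mem_iff {K : Subfield (Hyper F ℂ)} (hK : IsHyperNumberField K)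
    (x : Hyper F ℂ) :
    x ∈ K ↔ Germ.LiftRel (fun (z : ℂ) (k : NumberSubfield) => z ∈ k.1) x hK.toStar :=
  hK.exists_germ.choose_spec x

end HyperFields

/-- For a number field `k`, the partial Dedekind zeta function `ζ_M(s) = ∑_{N(𝔞) ≤ M} N(𝔞)^{-s}`;
the sum is over the finitely many nonzero ideals `𝔞` of the ring of integers of `k` whose norm is at
most `M`. -/
def partialDedekindZeta (k : NumberSubfield) (M : ℕ) (s : ℂ) : ℂ :=
  ∑ᶠ 𝔞 ∈ {𝔞 : Ideal (NumberField.RingOfIntegers k.1) | 𝔞 ≠ ⊥ ∧ Ideal.absNorm 𝔞 ≤ M},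
    1 / (Ideal.absNorm 𝔞 : ℂ) ^ s

/-! ### Invariants of a hyper number field

An invariant of number fields is a function on `𝒦`; its nonstandard extension is a function on `*𝒦`.
As cardinalities, sums and determinants of hyperfinite internal objects are the nonstandard
extensions of the finite ones, these are the corresponding internal invariants of `K`. -/

namespace IsHyperNumberField

variable {I : Type*} {F : Ultrafilter I} {K : Subfield (Hyper F ℂ)}

/-- The partial hyper Dedekind zeta function `ζ_M(s)` for `M ∈ *ℕ`: the hyperfinite sum of
`N(𝔞)^{-s}` over the nonzero internal ideals `𝔞` of the ring of hyperintegers of `K` whose norm is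
at most `M`. -/
def partialZeta (hK : IsHyperNumberField K) (M : Hyper F ℕ) (s : Hyper F ℂ) : Hyper F ℂ :=
  happ (happ (Germ.map partialDedekindZeta hK.toStar) M) s

/-- The number `r₁` of hyperreal embeddings. -/
def r₁ (hK : IsHyperNumberField K) : Hyper F ℕ :=
  Germ.map (fun k : NumberSubfield => NumberField.InfinitePlace.nrRealPlaces k.1) hK.toStar

/-- The number `r₂` of conjugate pairs of hypercomplex embeddings that are not hyperreal. -/
def r₂ (hK : IsHyperNumberField K) : Hyper F ℕ :=
  Germ.map (fun k : NumberSubfield => NumberField.InfinitePlace.nrComplexPlaces k.1) hK.toStar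

/-- The discriminant `d`, a hyperinteger. -/
def discr (hK : IsHyperNumberField K) : Hyper F ℤ :=
  Germ.map (fun k : NumberSubfield => NumberField.discr k.1) hK.toStar

/-- The absolute value `|d|` of the discriminant, as a hypercomplex number. -/
def absDiscr (hK : IsHyperNumberField K) : Hyper F ℂ :=
  Germ.map (fun d : ℤ => ((|d| : ℤ) : ℂ)) hK.discr

/-- The class number `h`, the internal cardinality of the group of classes of internal ideals. -/
def classNumber (hK : IsHyperNumberField K) : Hyper F ℕ :=
  Germ.map (fun k : NumberSubfield => NumberField.classNumber k.1) hK.toStar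

/-- The hyper regulator `*R`. -/
def regulator (hK : IsHyperNumberField K) : Hyper F ℝ :=
  Germ.map (fun k : NumberSubfield => NumberField.Units.regulator k.1) hK.toStar

/-- The number `w` of roots of unity in `K`. -/
def rootsOfUnityCount (hK : IsHyperNumberField K) : Hyper F ℕ :=
  Germ.map (fun k : NumberSubfield => NumberField.Units.torsionOrder k.1) hK.toStar

/-- The residue `2^{r₁} (2π)^{r₂} h *R / (w |d|^{1/2})`. -/
def zetaResidue (hK : IsHyperNumberField K) : Hyper F ℂ :=
  hpow (hconst F 2) hK.r₁ * hpow (hconst F (2 * Real.pi)) hK.r₂ * hnat hK.classNumber *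
      hreal hK.regulator /
    (hnat hK.rootsOfUnityCount * hcpow hK.absDiscr (hconst F (1 / 2)))

/-- The factor `*A(s)` of the functional equation of a hyper number field of degree `n`:
`2^n (2π)^{-ns} |d|^{s - 1/2} *cos(πs/2)^{r₁ + r₂} *sin(πs/2)^{r₂} *Γ(s)^n`. -/
def zetaFactor (hK : IsHyperNumberField K) (n : Hyper F ℕ) (s : Hyper F ℂ) : Hyper F ℂ :=
  hpow (hconst F 2) n * hcpow (hconst F (2 * Real.pi)) (-(hnat n * s)) *
    hcpow hK.absDiscr (s - hconst F (1 / 2)) *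
    hpow (hcos (hconst F (Real.pi / 2) * s)) (hK.r₁ + hK.r₂) *
    hpow (hsin (hconst F (Real.pi / 2) * s)) hK.r₂ * hpow (hGamma s) n

end IsHyperNumberField

end

/-! A hyper number field is an ultraproduct of number fields k_i, and every object in the statement
is the germ of its ordinary counterpart for k_i. The continuation is therefore the germ of the
continued Dedekind zeta functions of the k_i, and each assertion transfers from Hecke's classical
theorem. The transfer needs ε-δ choices made coordinate by coordinate (`hasQLimit_coe`,
`qAnalyticOn_coe`) and the fact that the hyper degree is the germ of the degrees
(`HasHyperDegree.eventually_eq_finrank`).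

The bulk of the proof is Hecke's theorem for one number field of degree n. Poisson summation for a
Gaussian (`tsum_exp_neg_pi_quadratic`), applied to the Gram matrix of ∑ n_w y_w |x|_w² on a
fractional ideal J, relates the theta series of J with weights y to that of the trace dual of J with
weights y⁻¹ (`tsum_exp_placeForm`). Write y as t times weights of product one. The latter are
parametrized by the logarithmic space, on which the units act by translation. Integrating the theta
series over a fundamental domain of the unit lattice and unfolding turns the sum over nonzero x in J
into a sum over the integral ideals of one class (`lintegral_tsum_coneForm`). Summed over the
classes, and with t rescaled by |d|^(-1/n), this gives a function θ with θ(1/t) = t^(n/2) θ(t)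
(`totalTheta_inversion`).

In logarithmic coordinates the Mellin integral separates into one gamma integral per place
(`mellin_coneIntegral`), so the Mellin transform of θ minus its constant term is the zeta function
times its gamma factor (`thetaPair_Λ_eq`). The theory of `WeakFEPair` yields continuation and
symmetry under s ↦ 1 - s. The inverse gamma factor is entire and vanishes at 0, so only the pole at
1 survives; the quotient of the inverse gamma factors at 1 - s and s is the factor of the functional
equation (`dedekindContinuation_one_sub`). Neither the normalization of Haar measure nor the volume
of the unit domain is evaluated: the residue is identified by comparison with the class number
formula as s tends to 1 from the right (`dedekindZeta_eq`). -/

noncomputable section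

/-! ### Poisson summation on ℝ^ι -/

section PoissonSummation

open MeasureTheory Real TopologicalSpace

variable {ι : Type*} [Fintype ι]

/-- A finite set of functions lies in the product of its coordinate projections, so the partial sums
are bounded by the product of the one-variable sums. -/
theorem summable_prod_pi {α : Type*} {f : ι → α → ℝ} (hf0 : ∀ i a, 0 ≤ f i a)
    (hf : ∀ i, Summable (f i)) : Summable fun m : ι → α => ∏ i, f i (m i) := by
  classical
  refine summable_of_sum_le (c := ∏ i, ∑' a, f i a)
    (fun m => Finset.prod_nonneg fun i _ => hf0 i _) fun u => ?_
  calc ∑ m ∈ u, ∏ i, f i (m i)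
      ≤ ∑ m ∈ Fintype.piFinset fun i => u.image fun m => m i, ∏ i, f i (m i) := by
        refine Finset.sum_le_sum_of_subset_of_nonneg (fun m hm => ?_)
          fun m _ _ => Finset.prod_nonneg fun i _ => hf0 i _
        exact Fintype.mem_piFinset.2 fun i => Finset.mem_image_of_mem _ hm
    _ = ∏ i, ∑ a ∈ u.image fun m => m i, f i a := by rw [Finset.prod_univ_sum]
    _ ≤ ∏ i, ∑' a, f i a := Finset.prod_le_prod
        (fun i _ => Finset.sum_nonneg fun a _ => hf0 i a)
        fun i _ => (hf i).sum_le_tsum _ fun a _ => hf0 i a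

/-- The inclusion of `ℤ^ι` in `ℝ^ι`. -/
def intVec (m : ι → ℤ) : ι → ℝ := fun i => m i

/-- The half-open unit cube. -/
def unitCube (ι : Type*) : Set (ι → ℝ) := {x | ∀ i, x i ∈ Set.Ioc (0 : ℝ) 1}

theorem measurableSet_unitCube : MeasurableSet (unitCube ι) :=
  MeasurableSet.univ_pi' fun _ => measurableSet_Ioc

/-- The integral translates of the half-open cube tile ℝ^ι. This unfolds Fourier coefficients and,
applied to the norm, justifies exchanging sum and integral. -/
theorem hasSum_setIntegral_unitCube {E : Type*} [NormedAddCommGroup E] [NormedSpace ℝ E]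
    {f : (ι → ℝ) → E} (hf : Integrable f) :
    HasSum (fun m : ι → ℤ => ∫ x in unitCube ι, f (x + intVec m)) (∫ x, f x) := by
  let S : (ι → ℤ) → Set (ι → ℝ) := fun m => (fun x => x - intVec m) ⁻¹' unitCube ι
  have hS : ∀ m, MeasurableSet (S m) := fun m =>
    measurableSet_unitCube.preimage (measurable_id.sub_const _)
  -- The cubes are closed on the right, so the index of the cube containing x is the ceiling minus
  -- one; disjointness and covering both follow from this.
  have hmem : ∀ m x, x ∈ S m ↔ ∀ i, ⌈x i⌉ = m i + 1 := by
    intro m x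
    simp only [S, unitCube, intVec, Set.mem_preimage, Set.mem_ofPred_eq, Pi.sub_apply, Set.mem_Ioc]
    refine forall_congr' fun i => ?_
    rw [Int.ceil_eq_iff]
    push_cast
    constructor <;> rintro ⟨h1, h2⟩ <;> constructor <;> linarith
  have hdisj : Pairwise (Function.onFun Disjoint S) := by
    intro m k hmk
    refine Set.disjoint_left.2 fun x hx hx' => hmk (funext fun i => ?_)
    have h1 := (hmem m x).1 hx i
    have h2 := (hmem k x).1 hx' i
    omega
  have hU : ⋃ m, S m = Set.univ := by
    refine Set.eq_univ_of_forall fun x => Set.mem_iUnion.2 ⟨fun i => ⌈x i⌉ - 1, ?_⟩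
    exact (hmem _ _).2 fun i => by ring
  have key := hasSum_integral_iUnion hS hdisj (f := f) (μ := volume) hf.integrableOn
  rw [hU, setIntegral_univ] at key
  convert key using 2 with m
  have := (measurePreserving_sub_right (volume : Measure (ι → ℝ)) (intVec m)).setIntegral_preimage_emb
    (MeasurableEquiv.subRight (intVec m)).measurableEmbedding (fun x => f (x + intVec m)) (unitCube ι)
  simpa [S] using this.symm

open UnitAddTorus in
/-- **Poisson summation** for the lattice `ℤ^ι` in `ℝ^ι`. -/
theorem tsum_intVec_eq_tsum_integral {f : C(ι → ℝ, ℂ)} (hf : Integrable f)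
    (hK : ∀ K : Compacts (ι → ℝ), Summable fun m : ι → ℤ =>
      ‖(f.comp (ContinuousMap.addRight (intVec m))).restrict K‖)
    (hs : Summable fun m : ι → ℤ =>
      ∫ x : ι → ℝ, Complex.exp (-(2 * π * Complex.I * ((∑ i, m i * x i : ℝ) : ℂ))) * f x) :
    ∑' m : ι → ℤ, f (intVec m) =
      ∑' m : ι → ℤ, ∫ x : ι → ℝ, Complex.exp (-(2 * π * Complex.I * ((∑ i, m i * x i : ℝ) : ℂ))) * f x := by
  classical
  have hsum := ContinuousMap.summable_of_locally_summable_norm hK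
  -- The periodization of f, which factors through the torus.
  let G : C(ι → ℝ, ℂ) := ∑' m : ι → ℤ, f.comp (ContinuousMap.addRight (intVec m))
  have hG : ∀ x, G x = ∑' m : ι → ℤ, f (x + intVec m) := fun x => by
    simp [G, ← ContinuousMap.tsum_apply hsum]
  let q : (ι → ℝ) → UnitAddTorus ι := fun x i => (x i : UnitAddCircle)
  have hq : IsOpenQuotientMap q :=
    IsOpenQuotientMap.piMap (f := fun (_ : ι) (x : ℝ) => (x : UnitAddCircle))
      fun _ => QuotientAddGroup.isOpenQuotientMap_mk
  have hper : ∀ x y, q x = q y → G x = G y := by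
    intro x y hxy
    have : ∀ i, ∃ k : ℤ, y i = x i + k := by
      intro i
      have h := congrFun hxy i
      obtain ⟨k, hk⟩ := (QuotientAddGroup.eq (s := AddSubgroup.zmultiples (1 : ℝ))).1 h
      refine ⟨k, ?_⟩
      simp at hk
      linarith
    choose k hk using this
    have hy : y = x + intVec k := funext hk
    rw [hG, hG, hy, ← (Equiv.addLeft k).tsum_eq]
    refine tsum_congr fun m => ?_
    congr 1
    ext i
    simp [intVec, add_assoc]
  -- G is composed with a set-theoretic section of the projection. Periodicity makes the result
  -- independent of the section, and continuity is tested after pulling back along the quotient map.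
  let Φ : C(UnitAddTorus ι, ℂ) :=
    ⟨fun t => G (Function.surjInv hq.surjective t), by
      rw [hq.isQuotientMap.continuous_iff]
      refine G.continuous.congr fun x => hper _ _ ?_
      exact (Function.surjInv_eq hq.surjective _).symm⟩
  have hΦ : ∀ x, Φ (q x) = G x := fun x => hper _ _ (Function.surjInv_eq hq.surjective _)
  have hexp : ∀ (m : ι → ℤ) (x : ι → ℝ), mFourier (-m) (q x) =
      Complex.exp (-(2 * π * Complex.I * ((∑ i, m i * x i : ℝ) : ℂ))) := by
    intro m x
    simp only [mFourier, ContinuousMap.coe_mk, q, fourier_coe_apply, ← Complex.exp_sum]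
    congr 1
    push_cast
    rw [Finset.mul_sum, ← Finset.sum_neg_distrib]
    refine Finset.sum_congr rfl fun i _ => ?_
    simp
    ring
  have hcoeff : ∀ m, mFourierCoeff Φ m =
      ∫ x : ι → ℝ, Complex.exp (-(2 * π * Complex.I * ((∑ i, m i * x i : ℝ) : ℂ))) * f x := by
    intro m
    let e : (ι → ℝ) → ℂ := fun x => Complex.exp (-(2 * π * Complex.I * ((∑ i, m i * x i : ℝ) : ℂ)))
    have he : ∀ x, ‖e x‖ = 1 := by
      intro x
      simp only [e]
      rw [show -(2 * π * Complex.I * ((∑ i, m i * x i : ℝ) : ℂ)) =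
        ((-(2 * π * ∑ i, m i * x i) : ℝ) : ℂ) * Complex.I by push_cast; ring]
      exact Complex.norm_exp_ofReal_mul_I _
    have hec : Continuous e := by fun_prop
    have hint : Integrable fun x => e x * f x :=
      hf.bdd_mul (c := 1) hec.aestronglyMeasurable (Eventually.of_forall fun x => (he x).le)
    have hper' : ∀ x (k : ι → ℤ), e (x + intVec k) = e x := by
      intro x k
      simp only [e, ← hexp]
      congr 1
      ext i
      simp [q, intVec]
    -- With base point 0 the coefficient is an integral over the half-open unit cube. The characters
    -- are invariant under integer translations, so the sum over translates unfolds to an integral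
    -- over ℝ^ι.
    rw [mFourierCoeff_eq_integral Φ m 0]
    simp only [Pi.zero_apply, zero_add]
    change ∫ x in unitCube ι, mFourier (-m) (q x) • Φ (q x) = _
    simp only [hexp, hΦ, hG, smul_eq_mul]
    rw [← (hasSum_setIntegral_unitCube hint).tsum_eq]
    refine Eq.trans ?_ (integral_tsum_of_summable_integral_norm ?_ ?_).symm
    · simp only [hper', tsum_mul_left]
      rfl
    · intro k
      exact (hint.comp_add_right _).integrableOn
    · refine (hasSum_setIntegral_unitCube hint.norm).summable
  have hs' : Summable (mFourierCoeff Φ) := by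
    simpa only [funext hcoeff] using hs
  -- The Fourier series is evaluated at the origin, where the periodization is the lattice sum and
  -- every character equals 1.
  have := (hasSum_mFourier_series_apply_of_summable hs' (q 0)).tsum_eq
  rw [hΦ, hG] at this
  simp only [zero_add] at this
  rw [← this]
  refine tsum_congr fun m => ?_
  rw [hcoeff, smul_eq_mul]
  have h1 := hexp (-m) 0
  rw [neg_neg] at h1
  simp [h1]

end PoissonSummation

/-! ### Theta inversion for positive definite quadratic forms -/

section GaussianTheta

open MeasureTheory Real TopologicalSpace Matrix

variable {ι : Type*} [Fintype ι]

/-- In one variable k ≤ k² reduces to a geometric series; the general summand is a product over the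
coordinates. -/
theorem summable_exp_neg_mul_sum_sq {c : ℝ} (hc : 0 < c) :
    Summable fun m : ι → ℤ => rexp (-c * ∑ i, (m i : ℝ) ^ 2) := by
  have h1 : Summable fun k : ℤ => rexp (-c * (k : ℝ) ^ 2) := by
    have h2 : Summable fun k : ℕ => rexp (-c * (k : ℝ) ^ 2) := by
      refine Summable.of_nonneg_of_le (fun _ => (exp_pos _).le) (fun k => ?_)
        (Real.summable_exp_nat_mul_iff.2 (neg_lt_zero.2 hc))
      refine exp_le_exp.2 ?_
      have : (k : ℝ) ≤ (k : ℝ) ^ 2 := by exact_mod_cast Nat.le_self_pow two_ne_zero k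
      nlinarith
    exact Summable.of_nat_of_neg (by simpa using h2) (by simpa using h2)
  refine (summable_prod_pi (fun (_ : ι) k => (exp_pos _).le) (fun _ : ι => h1)).congr fun m => ?_
  rw [← Real.exp_sum, Finset.mul_sum]

theorem dotProduct_transpose_mul_self_mulVec (B : Matrix ι ι ℝ) (x : ι → ℝ) :
    x ⬝ᵥ (Bᵀ * B) *ᵥ x = ∑ i, (B *ᵥ x) i ^ 2 := by
  rw [← mulVec_mulVec, dotProduct_mulVec, vecMul_transpose]
  simp [dotProduct, sq]

variable [DecidableEq ι]

/-- Cauchy–Schwarz for x = B⁻¹(Bx). The constant is the inverse of one plus the squared Frobenius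
norm of B⁻¹, the summand 1 securing positivity in all cases. -/
theorem exists_mul_sum_sq_le_sum_mulVec_sq {B : Matrix ι ι ℝ} (hB : B.det ≠ 0) :
    ∃ c > 0, ∀ x : ι → ℝ, c * ∑ i, x i ^ 2 ≤ ∑ i, (B *ᵥ x) i ^ 2 := by
  let C : ℝ := 1 + ∑ i, ∑ j, B⁻¹ i j ^ 2
  have hC : 0 < C := by positivity
  refine ⟨C⁻¹, inv_pos.2 hC, fun x => ?_⟩
  rw [inv_mul_le_iff₀ hC]
  have hx : x = B⁻¹ *ᵥ (B *ᵥ x) := by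
    rw [mulVec_mulVec, nonsing_inv_mul _ (isUnit_iff_ne_zero.2 hB), one_mulVec]
  set y := B *ᵥ x
  calc ∑ i, x i ^ 2 = ∑ i, (∑ j, B⁻¹ i j * y j) ^ 2 := by
        conv_lhs => rw [hx]
        rfl
    _ ≤ ∑ i, (∑ j, B⁻¹ i j ^ 2) * ∑ j, y j ^ 2 :=
        Finset.sum_le_sum fun i _ => Finset.sum_mul_sq_le_sq_mul_sq _ _ _
    _ = (∑ i, ∑ j, B⁻¹ i j ^ 2) * ∑ j, y j ^ 2 := by rw [Finset.sum_mul]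
    _ ≤ C * ∑ j, y j ^ 2 := by
        refine mul_le_mul_of_nonneg_right ?_ (by positivity)
        simp [C]

theorem summable_exp_neg_pi_sum_mulVec_sq {B : Matrix ι ι ℝ} (hB : B.det ≠ 0) :
    Summable fun m : ι → ℤ => rexp (-π * ∑ i, (B *ᵥ intVec m) i ^ 2) := by
  obtain ⟨c, hc, h⟩ := exists_mul_sum_sq_le_sum_mulVec_sq hB
  refine Summable.of_nonneg_of_le (fun _ => (exp_pos _).le) (fun m => ?_)
    (summable_exp_neg_mul_sum_sq (mul_pos pi_pos hc))
  refine exp_le_exp.2 ?_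
  have := mul_le_mul_of_nonneg_left (h (intVec m)) pi_pos.le
  simp only [intVec] at this ⊢
  linarith

theorem integral_comp_mulVec {B : Matrix ι ι ℝ} (hB : B.det ≠ 0) {g : (ι → ℝ) → ℂ}
    (hg : Continuous g) : ∫ x, g (B *ᵥ x) = |B.det|⁻¹ * ∫ x, g x := by
  have h := Real.map_matrix_volume_pi_eq_smul_volume_pi hB
  have h2 : ∫ x, g x ∂(Measure.map (Matrix.toLin' B) volume) = ∫ x, g (B *ᵥ x) := by
    rw [integral_map (LinearMap.continuous_of_finiteDimensional _).aemeasurable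
      hg.aestronglyMeasurable]
    rfl
  rw [← h2, h, integral_smul_measure, ENNReal.toReal_ofReal (abs_nonneg _), abs_inv]
  simp

theorem integrable_comp_mulVec {B : Matrix ι ι ℝ} (hB : B.det ≠ 0) {g : (ι → ℝ) → ℂ}
    (hg : Integrable g) (hgc : Continuous g) : Integrable fun x => g (B *ᵥ x) := by
  have h := Real.map_matrix_volume_pi_eq_smul_volume_pi hB
  have : Integrable g (Measure.map (Matrix.toLin' B) volume) := by
    rw [h]
    exact hg.smul_measure ENNReal.ofReal_ne_top
  exact (integrable_map_measure hgc.aestronglyMeasurable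
    (LinearMap.continuous_of_finiteDimensional _).aemeasurable).1 this

/-- The Gaussian is its own Fourier transform, and the substitution y = Bx turns the frequency m
into B⁻ᵀm at the cost of |det B|⁻¹. -/
theorem tsum_exp_neg_pi_sum_mulVec_sq {B : Matrix ι ι ℝ} (hB : B.det ≠ 0) :
    ∑' m : ι → ℤ, rexp (-π * ∑ i, (B *ᵥ intVec m) i ^ 2) =
      |B.det|⁻¹ * ∑' m : ι → ℤ, rexp (-π * ∑ i, (B⁻¹ᵀ *ᵥ intVec m) i ^ 2) := by
  let g : (ι → ℝ) → ℂ := fun x => Complex.exp (-π * ∑ i, (x i : ℂ) ^ 2 )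
  have hg : Continuous g := by fun_prop
  have hgi : Integrable g := by
    simpa [g] using GaussianFourier.integrable_cexp_neg_mul_sum_add (b := π)
      (by simpa using pi_pos) (0 : ι → ℂ)
  have hgr : ∀ x, g x = (rexp (-π * ∑ i, x i ^ 2) : ℂ) := fun x => by simp [g]
  let f : C(ι → ℝ, ℂ) := ⟨fun x => g (B *ᵥ x), hg.comp (by fun_prop)⟩
  have hff : ∀ x, f x = g (B *ᵥ x) := fun _ => rfl
  have hfi : Integrable f := integrable_comp_mulVec hB hgi hg
  have hB' : (B⁻¹ᵀ).det ≠ 0 := by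
    rw [det_transpose, det_nonsing_inv]
    simpa using hB
  have hFT : ∀ m : ι → ℤ,
      ∫ x : ι → ℝ, Complex.exp (-(2 * π * Complex.I * ((∑ i, m i * x i : ℝ) : ℂ))) * f x =
        ((|B.det|⁻¹ * rexp (-π * ∑ i, (B⁻¹ᵀ *ᵥ intVec m) i ^ 2) : ℝ) : ℂ) := by
    intro m
    set v := B⁻¹ᵀ *ᵥ intVec m with hv
    have hpair : ∀ x : ι → ℝ, (∑ i, m i * x i : ℝ) = ∑ i, v i * (B *ᵥ x) i := by
      intro x
      change intVec m ⬝ᵥ x = v ⬝ᵥ (B *ᵥ x)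
      rw [hv, dotProduct_mulVec, ← mulVec_transpose, mulVec_mulVec, ← transpose_mul,
        nonsing_inv_mul _ (isUnit_iff_ne_zero.2 hB), transpose_one, one_mulVec]
    let G : (ι → ℝ) → ℂ := fun y =>
      Complex.exp (-(2 * π * Complex.I * ((∑ i, v i * y i : ℝ) : ℂ))) * g y
    have hG : Continuous G := by fun_prop
    have h1 := integral_comp_mulVec hB hG
    simp only [hpair, hff]
    rw [h1]
    have h2 := GaussianFourier.integral_cexp_neg_mul_sum_add (b := π) (by simpa using pi_pos)
      (fun i => -(2 * π * Complex.I) * v i)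
    have h3 : ∫ x, G x = Complex.exp ((∑ i, (-(2 * π * Complex.I) * v i) ^ 2) / (4 * π)) := by
      rw [div_self (by exact_mod_cast pi_ne_zero), Complex.one_cpow, one_mul] at h2
      rw [← h2]
      congr 1
      ext x
      simp only [G, g, ← Complex.exp_add]
      congr 1
      push_cast
      rw [Finset.mul_sum, add_comm, ← Finset.sum_neg_distrib]
      congr 1
      refine Finset.sum_congr rfl fun i _ => ?_
      ring
    rw [h3]
    push_cast
    congr 2
    simp only [mul_pow, neg_sq, Complex.I_sq, ← Finset.mul_sum]
    have : (π : ℂ) ≠ 0 := by exact_mod_cast pi_ne_zero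
    field_simp
    norm_num
    ring
  have key := tsum_intVec_eq_tsum_integral hfi ?_ ?_
  · rw [tsum_congr hFT, tsum_congr fun m => (hff _).trans (hgr _), ← Complex.ofReal_tsum,
      ← Complex.ofReal_tsum, tsum_mul_left] at key
    exact Complex.ofReal_injective key
  · intro K
    obtain ⟨c, hc, h⟩ := exists_mul_sum_sq_le_sum_mulVec_sq hB
    obtain ⟨R, hR⟩ : ∃ R, ∀ x ∈ K, ∑ i, x i ^ 2 ≤ R := by
      obtain ⟨R, hR⟩ := K.isCompact.exists_bound_of_continuousOn
        (f := fun x : ι → ℝ => ∑ i, x i ^ 2) (by fun_prop)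
      exact ⟨R, fun x hx => (le_abs_self _).trans (hR x hx)⟩
    refine Summable.of_nonneg_of_le (fun _ => norm_nonneg _) (fun m => ?_)
      ((summable_exp_neg_mul_sum_sq (ι := ι) (c := π * c / 2) (by positivity)).mul_left
        (rexp (π * c * R)))
    rw [ContinuousMap.norm_le _ (by positivity)]
    rintro ⟨x, hx⟩
    simp only [ContinuousMap.restrict_apply, ContinuousMap.comp_apply, ContinuousMap.coe_addRight,
      hff, hgr, Complex.norm_real, Real.norm_eq_abs, abs_exp, ← Real.exp_add]
    refine exp_le_exp.2 ?_
    have h1 := h (x + intVec m)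
    have h2 := hR x hx
    -- Coordinatewise this is (m + 2x)² ≥ 0. It dominates the translated Gaussians on a compact set
    -- by one Gaussian in m.
    have h3 : ∑ i, (m i : ℝ) ^ 2 / 2 ≤ ∑ i, ((x + intVec m) i ^ 2 + x i ^ 2) := by
      refine Finset.sum_le_sum fun i _ => ?_
      simp only [Pi.add_apply, intVec]
      nlinarith [sq_nonneg (m i + 2 * x i : ℝ)]
    rw [Finset.sum_add_distrib, ← Finset.sum_div] at h3
    have h4 : π * (c * ((∑ i, (m i : ℝ) ^ 2) / 2)) ≤ π * (∑ i, (B *ᵥ (x + intVec m)) i ^ 2 + c * R) := by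
      refine mul_le_mul_of_nonneg_left ?_ pi_pos.le
      have := mul_le_mul_of_nonneg_left h3 hc.le
      have := mul_le_mul_of_nonneg_left h2 hc.le
      linarith
    linarith
  · simp only [hFT]
    exact Complex.ofRealCLM.summable ((summable_exp_neg_pi_sum_mulVec_sq hB').mul_left _)

theorem Matrix.PosDef.exists_eq_transpose_mul_self {A : Matrix ι ι ℝ} (hA : A.PosDef) :
    ∃ B : Matrix ι ι ℝ, A = Bᵀ * B ∧ B.det ≠ 0 ∧ √A.det = |B.det| := by
  open scoped MatrixOrder in
  obtain ⟨B, hB⟩ := CStarAlgebra.nonneg_iff_eq_star_mul_self.mp hA.posSemidef.nonneg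
  rw [star_eq_conjTranspose, conjTranspose_eq_transpose_of_trivial] at hB
  have hdet : A.det = B.det ^ 2 := by rw [hB, det_mul, det_transpose, sq]
  refine ⟨B, hB, fun h => hA.det_pos.ne' (by simp [hdet, h]), ?_⟩
  rw [hdet, sqrt_sq_eq_abs]

theorem summable_exp_neg_pi_quadratic {A : Matrix ι ι ℝ} (hA : A.PosDef) :
    Summable fun m : ι → ℤ => rexp (-π * (intVec m ⬝ᵥ A *ᵥ intVec m)) := by
  obtain ⟨B, rfl, hB, -⟩ := hA.exists_eq_transpose_mul_self
  simpa only [dotProduct_transpose_mul_self_mulVec] using summable_exp_neg_pi_sum_mulVec_sq hB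

/-- The theta inversion formula for a positive definite quadratic form. -/
theorem tsum_exp_neg_pi_quadratic {A : Matrix ι ι ℝ} (hA : A.PosDef) :
    ∑' m : ι → ℤ, rexp (-π * (intVec m ⬝ᵥ A *ᵥ intVec m)) =
      (√A.det)⁻¹ * ∑' m : ι → ℤ, rexp (-π * (intVec m ⬝ᵥ A⁻¹ *ᵥ intVec m)) := by
  obtain ⟨B, hAB, hB, hdet⟩ := hA.exists_eq_transpose_mul_self
  have hinv : A⁻¹ = B⁻¹ᵀᵀ * B⁻¹ᵀ := by
    rw [hAB, Matrix.mul_inv_rev, transpose_transpose, transpose_nonsing_inv]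
  rw [hdet, hinv]
  simp only [dotProduct_transpose_mul_self_mulVec]
  simp only [hAB, dotProduct_transpose_mul_self_mulVec]
  exact tsum_exp_neg_pi_sum_mulVec_sq hB

end GaussianTheta

/-! ### Gram matrices of the weighted forms on a number field -/

section NumberFieldTheta

open NumberField NumberField.InfinitePlace Module Matrix Real
open scoped nonZeroDivisors

variable {K : Type*} [Field K]

/-- The positive definite form `∑_w n_w y_w |x|_w²` on a number field. -/
def placeForm [NumberField K] (y : InfinitePlace K → ℝ) (x : K) : ℝ :=
  ∑ w, mult w * y w * w x ^ 2

variable [NumberField K]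

/-- Exactly `mult w` embeddings induce the place w. -/
theorem sum_embeddings_eq_sum_places {M : Type*} [Semiring M] (f : InfinitePlace K → M) :
    ∑ σ : K →+* ℂ, f (mk σ) = ∑ w, mult w * f w := by
  classical
  rw [← Finset.sum_fiberwise (s := Finset.univ) (g := fun σ : K →+* ℂ => mk σ)]
  refine Finset.sum_congr rfl fun w _ => ?_
  rw [Finset.sum_congr rfl (g := fun _ => f w) fun σ hσ => by rw [(Finset.mem_filter.1 hσ).2],
    Finset.sum_const, card_filter_mk_eq, nsmul_eq_mul]

theorem prod_embeddings_eq_prod_places {M : Type*} [CommMonoid M] (f : InfinitePlace K → M) :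
    ∏ σ : K →+* ℂ, f (mk σ) = ∏ w, f w ^ mult w := by
  classical
  rw [← Finset.prod_fiberwise (s := Finset.univ) (g := fun σ : K →+* ℂ => mk σ)]
  refine Finset.prod_congr rfl fun w _ => ?_
  rw [Finset.prod_congr rfl (g := fun _ => f w) fun σ hσ => by rw [(Finset.mem_filter.1 hσ).2],
    Finset.prod_const, card_filter_mk_eq]

/-- The matrix `(σ(b_i))` of a family indexed by the embeddings. -/
def embMatrix (b : (K →+* ℂ) → K) : Matrix (K →+* ℂ) (K →+* ℂ) ℂ := of fun i σ => σ (b i)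

/-- The Gram matrix of `placeForm y` on a family of elements. -/
def placeGram (y : InfinitePlace K → ℝ) (b : (K →+* ℂ) → K) :
    Matrix (K →+* ℂ) (K →+* ℂ) ℝ :=
  of fun i j => ∑ σ : K →+* ℂ, y (mk σ) * (σ (b i) * (starRingEnd ℂ) (σ (b j))).re

theorem transpose_placeGram (y : InfinitePlace K → ℝ) (b : (K →+* ℂ) → K) :
    (placeGram y b)ᵀ = placeGram y b := by
  ext i j
  simp only [transpose_apply, placeGram, of_apply, Complex.mul_re, Complex.conj_re,
    Complex.conj_im]
  exact Finset.sum_congr rfl fun σ _ => by ring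

theorem dotProduct_placeGram_mulVec (y : InfinitePlace K → ℝ) (b : (K →+* ℂ) → K)
    (x : (K →+* ℂ) → ℝ) :
    x ⬝ᵥ placeGram y b *ᵥ x = ∑ σ : K →+* ℂ, y (mk σ) * ‖∑ i, x i * σ (b i)‖ ^ 2 := by
  have h : ∀ σ : K →+* ℂ, ‖∑ i, x i * σ (b i)‖ ^ 2 =
      ∑ i, ∑ j, x i * x j * (σ (b i) * (starRingEnd ℂ) (σ (b j))).re := by
    intro σ
    rw [← Complex.normSq_eq_norm_sq, ← Complex.ofReal_re (Complex.normSq _), ← Complex.mul_conj,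
      map_sum, Finset.sum_mul_sum, Complex.re_sum]
    refine Finset.sum_congr rfl fun i _ => ?_
    rw [Complex.re_sum]
    refine Finset.sum_congr rfl fun j _ => ?_
    rw [map_mul, Complex.conj_ofReal, ← Complex.re_ofReal_mul]
    congr 1
    push_cast
    ring
  simp only [h, dotProduct, mulVec, placeGram, of_apply, Finset.mul_sum, Finset.sum_mul]
  rw [Finset.sum_comm' (t' := Finset.univ) (s' := fun _ => Finset.univ) (by simp)]
  conv_rhs => rw [Finset.sum_comm]; enter [2, i]; rw [Finset.sum_comm]
  conv_lhs => rw [Finset.sum_comm]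
  refine Finset.sum_congr rfl fun i _ => Finset.sum_congr rfl fun j _ =>
    Finset.sum_congr rfl fun σ _ => ?_
  ring

theorem dotProduct_placeGram_mulVec_intVec (y : InfinitePlace K → ℝ) (b : (K →+* ℂ) → K)
    (m : (K →+* ℂ) → ℤ) :
    intVec m ⬝ᵥ placeGram y b *ᵥ intVec m = placeForm y (∑ i, m i • b i) := by
  rw [dotProduct_placeGram_mulVec, placeForm]
  rw [← Finset.sum_congr rfl (fun w _ => (mul_assoc _ _ _).symm), ← sum_embeddings_eq_sum_places
    fun w => y w * w (∑ i, m i • b i) ^ 2]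
  refine Finset.sum_congr rfl fun σ _ => ?_
  congr 2
  rw [InfinitePlace.apply, map_sum]
  simp [intVec]

variable [DecidableEq (K →+* ℂ)]

/-- Conjugation permutes the embeddings and preserves their places, so the sum of the complex terms
is real and the real parts in `placeGram` lose nothing. Indexing the basis by the embeddings makes
`embMatrix` square. -/
theorem map_placeGram (y : InfinitePlace K → ℝ) (b : (K →+* ℂ) → K) :
    (placeGram y b).map Complex.ofReal =
      embMatrix b * diagonal (fun σ => (y (mk σ) : ℂ)) * (embMatrix b)ᴴ := by
  ext i j
  have h : (starRingEnd ℂ) (∑ σ : K →+* ℂ, y (mk σ) * (σ (b i) * (starRingEnd ℂ) (σ (b j)))) =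
      ∑ σ : K →+* ℂ, y (mk σ) * (σ (b i) * (starRingEnd ℂ) (σ (b j))) := by
    rw [map_sum, ← Equiv.sum_comp (ComplexEmbedding.involutive_conjugate K).toPerm]
    refine Finset.sum_congr rfl fun σ _ => ?_
    simp [mk_conjugate_eq]
  have h2 := Complex.conj_eq_iff_re.1 h
  rw [mul_apply]
  simp only [mul_diagonal, map_apply, placeGram, of_apply, embMatrix, conjTranspose_apply,
    RCLike.star_def]
  rw [show ∑ σ : K →+* ℂ, σ (b i) * (y (mk σ) : ℂ) * (starRingEnd ℂ) (σ (b j)) =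
    ∑ σ : K →+* ℂ, y (mk σ) * (σ (b i) * (starRingEnd ℂ) (σ (b j))) from
    Finset.sum_congr rfl fun σ _ => by ring, ← h2, Complex.re_sum]
  simp

/-- The trace is the sum over the embeddings, so trace duality of bases is inversion of embedding
matrices up to a transposition. -/
theorem embMatrix_mul_transpose_traceDual (b : Basis (K →+* ℂ) ℚ K) :
    embMatrix b * (embMatrix b.traceDual)ᵀ = 1 := by
  ext i j
  have h := trace_eq_sum_embeddings (K := ℚ) ℂ (x := b i * b.traceDual j)
  rw [Basis.trace_mul_traceDual] at h
  rw [mul_apply]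
  simp only [embMatrix, of_apply, transpose_apply, ← map_mul]
  rw [← (RingHom.equivRatAlgHom K ℂ).symm.sum_comp]
  refine h.symm.trans ?_
  rw [one_apply]
  split_ifs <;> simp

theorem isUnit_det_embMatrix (b : Basis (K →+* ℂ) ℚ K) : IsUnit (embMatrix b).det :=
  isUnit_det_of_right_inverse (embMatrix_mul_transpose_traceDual b)

theorem norm_det_embMatrix_sq (b : Basis (K →+* ℂ) ℚ K) :
    ‖(embMatrix b).det‖ ^ 2 = |(Algebra.discr ℚ b : ℝ)| := by
  have h := Algebra.discr_eq_det_embeddingsMatrixReindex_pow_two ℚ ℂ b (RingHom.equivRatAlgHom K ℂ)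
  have h2 : Algebra.embeddingsMatrixReindex ℚ ℂ b (RingHom.equivRatAlgHom K ℂ) = embMatrix b := rfl
  rw [h2] at h
  rw [← norm_pow, ← h]
  simp

/-- The two matrices are M Y Mᴴ and N Y⁻¹ Nᴴ with M Nᵀ = 1. The second is symmetric, and in its
transposed form Nᵀᴴ Y⁻¹ Nᵀ the factors cancel in order. -/
theorem placeGram_mul_placeGram_traceDual {y : InfinitePlace K → ℝ} (hy : ∀ w, 0 < y w)
    (b : Basis (K →+* ℂ) ℚ K) :
    placeGram y b * placeGram (fun w => (y w)⁻¹) b.traceDual = 1 := by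
  set M := embMatrix b
  set N := embMatrix b.traceDual
  have hMN : M * Nᵀ = 1 := embMatrix_mul_transpose_traceDual b
  have hNM : Nᵀ * M = 1 := mul_eq_one_comm.1 hMN
  have hMN' : Mᴴ * Nᵀᴴ = 1 := by rw [← conjTranspose_mul, hNM, conjTranspose_one]
  have hY : diagonal (fun σ : K →+* ℂ => (y (mk σ) : ℂ)) *
      diagonal (fun σ : K →+* ℂ => (((y (mk σ))⁻¹ : ℝ) : ℂ)) = 1 := by
    rw [diagonal_mul_diagonal, ← diagonal_one]
    congr 1
    ext σ
    rw [← Complex.ofReal_mul, mul_inv_cancel₀ (hy _).ne', Complex.ofReal_one]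
  have h2 : (placeGram (fun w => (y w)⁻¹) b.traceDual).map Complex.ofReal =
      Nᵀᴴ * diagonal (fun σ : K →+* ℂ => (((y (mk σ))⁻¹ : ℝ) : ℂ)) * Nᵀ := by
    rw [← transpose_placeGram, transpose_map, map_placeGram, transpose_mul, transpose_mul,
      diagonal_transpose, ← Matrix.mul_assoc]
    rfl
  apply Matrix.map_injective Complex.ofReal_injective
  change ((placeGram y b * _).map Complex.ofRealHom) = (1 : Matrix _ _ ℝ).map Complex.ofRealHom
  rw [Matrix.map_mul]
  change (placeGram y b).map Complex.ofReal * (placeGram _ _).map Complex.ofReal = _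
  rw [map_placeGram, h2]
  calc M * diagonal (fun σ => (y (mk σ) : ℂ)) * Mᴴ *
        (Nᵀᴴ * diagonal (fun σ : K →+* ℂ => (((y (mk σ))⁻¹ : ℝ) : ℂ)) * Nᵀ)
      = M * diagonal (fun σ => (y (mk σ) : ℂ)) * (Mᴴ * Nᵀᴴ) *
        diagonal (fun σ : K →+* ℂ => (((y (mk σ))⁻¹ : ℝ) : ℂ)) * Nᵀ := by
        simp only [Matrix.mul_assoc]
    _ = 1 := by
        rw [hMN', Matrix.mul_one, Matrix.mul_assoc M, hY, Matrix.mul_one, hMN]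
    _ = _ := by simp

theorem inv_placeGram {y : InfinitePlace K → ℝ} (hy : ∀ w, 0 < y w)
    (b : Basis (K →+* ℂ) ℚ K) :
    (placeGram y b)⁻¹ = placeGram (fun w => (y w)⁻¹) b.traceDual :=
  inv_eq_right_inv (placeGram_mul_placeGram_traceDual hy b)

theorem det_placeGram (y : InfinitePlace K → ℝ) (b : Basis (K →+* ℂ) ℚ K) :
    (placeGram y b).det = |(Algebra.discr ℚ b : ℝ)| * ∏ w, y w ^ mult w := by
  have h := congrArg det (map_placeGram y b)
  rw [det_mul, det_mul, det_conjTranspose, det_diagonal, mul_right_comm, RCLike.star_def,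
    Complex.mul_conj, Complex.normSq_eq_norm_sq, norm_det_embMatrix_sq,
    prod_embeddings_eq_prod_places (fun w => (y w : ℂ))] at h
  have h2 : ((placeGram y b).map Complex.ofReal).det = ((placeGram y b).det : ℂ) :=
    ((Complex.ofRealHom).map_det _).symm
  rw [h2] at h
  exact_mod_cast h

/-- A zero of the form is a real vector annihilated by the embedding matrix, which is invertible.
Since x is real, linear independence of b over ℚ alone would not suffice. -/
theorem posDef_placeGram {y : InfinitePlace K → ℝ} (hy : ∀ w, 0 < y w)
    (b : Basis (K →+* ℂ) ℚ K) : (placeGram y b).PosDef := by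
  refine PosDef.of_dotProduct_mulVec_pos ?_ fun x hx => ?_
  · rw [IsHermitian, conjTranspose_eq_transpose_of_trivial, transpose_placeGram]
  · rw [star_trivial, dotProduct_placeGram_mulVec]
    refine lt_of_le_of_ne (Finset.sum_nonneg fun σ _ => mul_nonneg (hy _).le (sq_nonneg _)) ?_
    intro h0
    have h1 : ∀ σ : K →+* ℂ, ∑ i, (x i : ℂ) * σ (b i) = 0 := by
      intro σ
      have := (Finset.sum_eq_zero_iff_of_nonneg fun σ _ =>
        mul_nonneg (hy _).le (sq_nonneg _)).1 h0.symm σ (Finset.mem_univ _)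
      simpa [(hy _).ne'] using this
    have h2 : (fun i => (x i : ℂ)) ᵥ* embMatrix b = 0 := funext h1
    have h3 := eq_zero_of_vecMul_eq_zero (isUnit_det_embMatrix b).ne_zero h2
    exact hx (funext fun i => by simpa using congrFun h3 i)

theorem summable_exp_placeForm_basis {y : InfinitePlace K → ℝ} (hy : ∀ w, 0 < y w)
    (b : Basis (K →+* ℂ) ℚ K) :
    Summable fun m : (K →+* ℂ) → ℤ => rexp (-π * placeForm y (∑ i, m i • b i)) := by
  simpa only [dotProduct_placeGram_mulVec_intVec] using
    summable_exp_neg_pi_quadratic (posDef_placeGram hy b)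

theorem tsum_exp_placeForm_basis {y : InfinitePlace K → ℝ} (hy : ∀ w, 0 < y w)
    (b : Basis (K →+* ℂ) ℚ K) :
    ∑' m : (K →+* ℂ) → ℤ, rexp (-π * placeForm y (∑ i, m i • b i)) =
      (√(|(Algebra.discr ℚ b : ℝ)| * ∏ w, y w ^ mult w))⁻¹ *
        ∑' m : (K →+* ℂ) → ℤ,
          rexp (-π * placeForm (fun w => (y w)⁻¹) (∑ i, m i • b.traceDual i)) := by
  have h := tsum_exp_neg_pi_quadratic (posDef_placeGram hy b)
  simpa only [inv_placeGram hy, det_placeGram, dotProduct_placeGram_mulVec_intVec] using h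

end NumberFieldTheta

/-! ### Theta inversion for fractional ideals -/

section IdealTheta

open NumberField NumberField.InfinitePlace Module Real
open scoped nonZeroDivisors

variable {K : Type*} [Field K] [NumberField K]

/-- The change of basis from an integral basis has determinant ± the norm of J, and discriminants
scale by its square. -/
theorem discr_basisOfFractionalIdeal (J : (FractionalIdeal (𝓞 K)⁰ K)ˣ)
    {ι : Type*} [Fintype ι] [DecidableEq ι] (e : Free.ChooseBasisIndex ℤ J ≃ ι) :
    |(Algebra.discr ℚ ((basisOfFractionalIdeal K J).reindex e) : ℝ)| =
      |(discr K : ℝ)| * (FractionalIdeal.absNorm (J : FractionalIdeal (𝓞 K)⁰ K) : ℝ) ^ 2 := by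
  classical
  have e' : Free.ChooseBasisIndex ℤ (𝓞 K) ≃ Free.ChooseBasisIndex ℤ J := by
    refine Fintype.equivOfCardEq ?_
    rw [← finrank_eq_card_chooseBasisIndex, ← finrank_eq_card_chooseBasisIndex]
    exact (fractionalIdeal_rank K J).symm
  set b := (basisOfFractionalIdeal K J).reindex e'.symm with hb
  have h1 : Algebra.discr ℚ ((basisOfFractionalIdeal K J).reindex e) = Algebra.discr ℚ b := by
    rw [hb, Basis.coe_reindex, Basis.coe_reindex, Algebra.discr_reindex, Algebra.discr_reindex]
  have h2 := Algebra.discr_of_matrix_vecMul (A := ℚ) (integralBasis K)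
    ((integralBasis K).toMatrix b)
  rw [Basis.toMatrix_map_vecMul, ← Basis.det_apply, ← coe_discr] at h2
  rw [h1, h2, ← det_basisOfFractionalIdeal_eq_absNorm K J e', ← hb]
  push_cast
  rw [abs_mul, mul_comm, abs_pow, sq_abs]

/-- The coordinates of a lattice with respect to a `ℤ`-basis. -/
def latticeEquiv {ι : Type*} [Fintype ι] (b : Basis ι ℚ K) {S : Set K}
    (hS : ∀ x, x ∈ S ↔ x ∈ Submodule.span ℤ (Set.range b)) : (ι → ℤ) ≃ S :=
  (b.restrictScalars ℤ).equivFun.symm.toEquiv.trans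
    (Equiv.subtypeEquivRight fun x => (hS x).symm)

theorem coe_latticeEquiv {ι : Type*} [Fintype ι] (b : Basis ι ℚ K) {S : Set K}
    (hS : ∀ x, x ∈ S ↔ x ∈ Submodule.span ℤ (Set.range b)) (m : ι → ℤ) :
    (latticeEquiv b hS m : K) = ∑ i, m i • b i := by
  simp [latticeEquiv, Basis.equivFun_symm_apply]

/-- Both index sets have [K : ℚ] elements; a ℤ-basis of J indexed by the embeddings is what the
square Gram matrices require. -/
theorem exists_basis_fractionalIdeal (J : (FractionalIdeal (𝓞 K)⁰ K)ˣ) :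
    ∃ b : Basis (K →+* ℂ) ℚ K,
      (∀ x, x ∈ ((J : FractionalIdeal (𝓞 K)⁰ K) : Set K) ↔
        x ∈ Submodule.span ℤ (Set.range b)) ∧
      ∀ [DecidableEq (K →+* ℂ)], |(Algebra.discr ℚ b : ℝ)| =
        |(discr K : ℝ)| * (FractionalIdeal.absNorm (J : FractionalIdeal (𝓞 K)⁰ K) : ℝ) ^ 2 := by
  have e : Free.ChooseBasisIndex ℤ J ≃ (K →+* ℂ) := by
    refine Fintype.equivOfCardEq ?_
    rw [Embeddings.card, ← finrank_eq_card_basis (basisOfFractionalIdeal K J)]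
  refine ⟨(basisOfFractionalIdeal K J).reindex e, fun x => ?_, discr_basisOfFractionalIdeal J e⟩
  rw [Basis.range_reindex, mem_span_basisOfFractionalIdeal]

theorem summable_exp_placeForm (J : (FractionalIdeal (𝓞 K)⁰ K)ˣ)
    {y : InfinitePlace K → ℝ} (hy : ∀ w, 0 < y w) :
    Summable fun x : (J : FractionalIdeal (𝓞 K)⁰ K) => rexp (-π * placeForm y (x : K)) := by
  classical
  obtain ⟨b, hb, -⟩ := exists_basis_fractionalIdeal J
  have h := summable_exp_placeForm_basis hy b
  simp only [← coe_latticeEquiv b hb] at h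
  exact (latticeEquiv b hb).summable_iff.1 h

/-- The theta inversion formula for a fractional ideal and its dual for the trace form. -/
theorem tsum_exp_placeForm (J : (FractionalIdeal (𝓞 K)⁰ K)ˣ)
    {y : InfinitePlace K → ℝ} (hy : ∀ w, 0 < y w) :
    ∑' x : (J : FractionalIdeal (𝓞 K)⁰ K), rexp (-π * placeForm y (x : K)) =
      (√(|(discr K : ℝ)| * (FractionalIdeal.absNorm (J : FractionalIdeal (𝓞 K)⁰ K) : ℝ) ^ 2 *
        ∏ w, y w ^ mult w))⁻¹ *
      ∑' x : FractionalIdeal.dual ℤ ℚ (J : FractionalIdeal (𝓞 K)⁰ K),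
        rexp (-π * placeForm (fun w => (y w)⁻¹) (x : K)) := by
  classical
  obtain ⟨b, hb, hd⟩ := exists_basis_fractionalIdeal J
  have hb' : ∀ x, x ∈ (FractionalIdeal.dual ℤ ℚ (J : FractionalIdeal (𝓞 K)⁰ K) : Set K) ↔
      x ∈ Submodule.span ℤ (Set.range b.traceDual) := by
    intro x
    have h1 : ((J : FractionalIdeal (𝓞 K)⁰ K) : Submodule (𝓞 K) K).restrictScalars ℤ =
        Submodule.span ℤ (Set.range b) := by
      ext x
      exact hb x
    rw [← Submodule.traceDual_span_of_basis ℤ _ b h1, ← FractionalIdeal.coe_dual ℤ ℚ J.ne_zero]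
    rfl
  have h := tsum_exp_placeForm_basis hy b
  simp only [← coe_latticeEquiv b hb, ← coe_latticeEquiv b.traceDual hb'] at h
  rw [(latticeEquiv b hb).tsum_eq (fun x => rexp (-π * placeForm y (x : K))),
    (latticeEquiv b.traceDual hb').tsum_eq
      (fun x => rexp (-π * placeForm (fun w => (y w)⁻¹) (x : K))), hd] at h
  exact h

end IdealTheta

/-! ### Units acting on the logarithmic space, and unfolding -/

section UnitUnfolding

open NumberField NumberField.InfinitePlace NumberField.Units NumberField.Units.dirichletUnitTheorem
open Module Real MeasureTheory
open scoped nonZeroDivisors ENNReal Classical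

variable {K : Type*} [Field K] [NumberField K]

/-- The logarithmic weights: the vector `(μ_w)` with `∑_w n_w μ_w = 0` attached to a point of the
logarithmic space. -/
def logWeight (l : logSpace K) (w : InfinitePlace K) : ℝ :=
  if h : w = w₀ then -2 * (∑ v, l v) / mult w else 2 * l ⟨w, h⟩ / mult w

theorem logWeight_w₀ (l : logSpace K) :
    logWeight l w₀ = -2 * (∑ v, l v) / mult (w₀ : InfinitePlace K) := by
  simp [logWeight]

theorem logWeight_of_ne (l : logSpace K) (w : {w : InfinitePlace K // w ≠ w₀}) :
    logWeight l w.1 = 2 * l w / mult w.1 := by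
  simp [logWeight, w.2]

theorem logWeight_add (l m : logSpace K) (w : InfinitePlace K) :
    logWeight (l + m) w = logWeight l w + logWeight m w := by
  by_cases h : w = w₀
  · subst h
    simp only [logWeight_w₀, Pi.add_apply, Finset.sum_add_distrib]
    ring
  · simp only [logWeight_of_ne _ ⟨w, h⟩, Pi.add_apply]
    ring

theorem logWeight_smul (c : ℝ) (l : logSpace K) (w : InfinitePlace K) :
    logWeight (c • l) w = c * logWeight l w := by
  by_cases h : w = w₀
  · subst h
    simp only [logWeight_w₀, Pi.smul_apply, smul_eq_mul, ← Finset.mul_sum]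
    ring
  · simp only [logWeight_of_ne _ ⟨w, h⟩, Pi.smul_apply, smul_eq_mul]
    ring

theorem logWeight_neg (l : logSpace K) (w : InfinitePlace K) :
    logWeight (-l) w = -logWeight l w := by
  rw [← neg_one_smul ℝ l, logWeight_smul, neg_one_mul]

theorem sum_places_eq_add_sum {M : Type*} [AddCommMonoid M] (f : InfinitePlace K → M) :
    ∑ w, f w = f w₀ + ∑ w : {w : InfinitePlace K // w ≠ w₀}, f w.1 := by
  rw [← Finset.add_sum_erase _ _ (Finset.mem_univ w₀)]
  congr 1
  refine (Finset.sum_subtype _ (fun w => ?_) f)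
  simp

theorem sum_mult_mul_logWeight (l : logSpace K) : ∑ w, mult w * logWeight l w = 0 := by
  rw [sum_places_eq_add_sum, logWeight_w₀]
  simp only [logWeight_of_ne]
  have h : ∀ w : InfinitePlace K, (mult w : ℝ) ≠ 0 := fun w => mult_coe_ne_zero
  simp only [mul_div_cancel₀ _ (h _), ← Finset.mul_sum]
  ring

/-- A vector of weights with `∑_w n_w μ_w = 0` comes from the logarithmic space. -/
theorem logWeight_eq_of_sum_eq_zero {μ : InfinitePlace K → ℝ} (hμ : ∑ w, mult w * μ w = 0) :
    logWeight (fun w : {w : InfinitePlace K // w ≠ w₀} => mult w.1 * μ w.1 / 2) = μ := by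
  have h : ∀ w : InfinitePlace K, (mult w : ℝ) ≠ 0 := fun w => mult_coe_ne_zero
  ext w
  by_cases hw : w = w₀
  · subst hw
    rw [logWeight_w₀, ← Finset.sum_div]
    rw [sum_places_eq_add_sum] at hμ
    have := h w₀
    field_simp
    linarith
  · rw [logWeight_of_ne _ ⟨w, hw⟩]
    have := h w
    field_simp

/-- The factor 2 in `logWeight` is chosen for this: translation by the logarithm of a unit
multiplies the weight at w by |u|_w², exactly as multiplying x by u does in the form. -/
theorem logWeight_logEmbedding (u : (𝓞 K)ˣ) (w : InfinitePlace K) :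
    logWeight (logEmbedding K (Additive.ofMul u)) w = 2 * Real.log (w (u : K)) := by
  have h : ∀ w : InfinitePlace K, (mult w : ℝ) ≠ 0 := fun w => mult_coe_ne_zero
  have h2 : ∑ w : InfinitePlace K, mult w * (2 * Real.log (w (u : K))) = 0 := by
    have := sum_mult_mul_log u
    rw [← mul_zero (2 : ℝ), ← this, Finset.mul_sum]
    exact Finset.sum_congr rfl fun _ _ => by ring
  rw [← congrFun (logWeight_eq_of_sum_eq_zero h2) w]
  congr 1
  ext v
  rw [logEmbedding_component]
  ring

/-- The exponentials of the logarithmic weights. -/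
def coneWeight (l : logSpace K) (w : InfinitePlace K) : ℝ := rexp (logWeight l w)

theorem coneWeight_pos (l : logSpace K) (w : InfinitePlace K) : 0 < coneWeight l w := exp_pos _

theorem coneWeight_neg (l : logSpace K) (w : InfinitePlace K) :
    coneWeight (-l) w = (coneWeight l w)⁻¹ := by
  rw [coneWeight, logWeight_neg, Real.exp_neg, coneWeight]

theorem prod_coneWeight_pow (l : logSpace K) : ∏ w, coneWeight l w ^ mult w = 1 := by
  simp only [coneWeight, ← Real.exp_nat_mul, ← Real.exp_sum, sum_mult_mul_logWeight, Real.exp_zero]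

theorem continuous_logWeight (w : InfinitePlace K) :
    Continuous fun l : logSpace K => logWeight l w := by
  by_cases h : w = w₀
  · subst h
    simp only [logWeight_w₀]
    fun_prop
  · simp only [logWeight_of_ne _ ⟨w, h⟩]
    fun_prop

theorem continuous_coneWeight (w : InfinitePlace K) :
    Continuous fun l : logSpace K => coneWeight l w := (continuous_logWeight w).rexp

/-- The form `placeForm` with weights of fixed product `t ^ n`. -/
def coneForm (t : ℝ) (l : logSpace K) (x : K) : ℝ := placeForm (fun w => t * coneWeight l w) x

theorem coneForm_eq (t : ℝ) (l : logSpace K) (x : K) :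
    coneForm t l x = t * ∑ w, mult w * coneWeight l w * w x ^ 2 := by
  rw [coneForm, placeForm, Finset.mul_sum]
  exact Finset.sum_congr rfl fun _ _ => by ring

theorem continuous_coneForm (t : ℝ) (x : K) : Continuous fun l : logSpace K => coneForm t l x := by
  have := continuous_coneWeight (K := K)
  simp only [coneForm_eq]
  fun_prop

theorem coneForm_unit_mul (t : ℝ) (l : logSpace K) (u : (𝓞 K)ˣ) (x : K) :
    coneForm t l (u * x) = coneForm t (l + logEmbedding K (Additive.ofMul u)) x := by
  rw [coneForm_eq, coneForm_eq]
  congr 1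
  refine Finset.sum_congr rfl fun w _ => ?_
  have hu : 0 < w (u : K) := InfinitePlace.pos_iff.2 (by simp)
  rw [coneWeight, coneWeight, logWeight_add, logWeight_logEmbedding, Real.exp_add, map_mul,
    two_mul, Real.exp_add, Real.exp_log hu]
  ring

/-- Every nonzero element is, up to its norm, in the orbit of `1`. -/
theorem exists_coneForm_eq {x : K} (hx : x ≠ 0) : ∃ m : logSpace K, ∀ t l,
    coneForm t l x =
      coneForm (t * (|Algebra.norm ℚ x| : ℝ) ^ (2 / finrank ℚ K : ℝ)) (l + m) 1 := by
  set N : ℝ := (|Algebra.norm ℚ x| : ℝ)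
  have hN : 0 < N := by
    simpa [N] using (Algebra.norm_ne_zero_iff (R := ℚ).2 hx)
  have hn : (finrank ℚ K : ℝ) ≠ 0 := by exact_mod_cast (finrank_pos (R := ℚ) (M := K)).ne'
  have hwx : ∀ w : InfinitePlace K, 0 < w x := fun w => InfinitePlace.pos_iff.2 hx
  -- The numbers 2 log |x|_w minus their weighted mean (2/n) log |N(x)| have weighted sum zero,
  -- hence come from a translation of the logarithmic space.
  have hμ : ∑ w : InfinitePlace K, mult w *
      (2 * Real.log (w x) - 2 / finrank ℚ K * Real.log N) = 0 := by
    have h1 : ∑ w : InfinitePlace K, mult w * Real.log (w x) = Real.log N := by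
      rw [show N = _ from (by simp [N] : N = ((|Algebra.norm ℚ x| : ℚ) : ℝ)), ← prod_eq_abs_norm,
        Real.log_prod fun w _ => (pow_pos (hwx w) _).ne']
      simp
    have h2 : ∑ w : InfinitePlace K, (mult w : ℝ) = finrank ℚ K := by
      exact_mod_cast sum_mult_eq (K := K)
    simp only [mul_sub, Finset.sum_sub_distrib, ← Finset.sum_mul, h2]
    rw [← Finset.sum_congr rfl fun w _ => (mul_left_comm _ _ _), ← Finset.mul_sum, h1]
    field_simp
    ring
  refine ⟨fun w => mult w.1 *
    (2 * Real.log (w.1 x) - 2 / finrank ℚ K * Real.log N) / 2, fun t l => ?_⟩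
  rw [coneForm_eq, coneForm_eq, mul_assoc]
  congr 1
  rw [Finset.mul_sum]
  refine Finset.sum_congr rfl fun w _ => ?_
  rw [coneWeight, coneWeight, logWeight_add, congrFun (logWeight_eq_of_sum_eq_zero hμ) w,
    Real.exp_add, Real.exp_sub, Real.rpow_def_of_pos hN, mul_comm (Real.log N),
    two_mul (Real.log _), Real.exp_add, Real.exp_log (hwx w), map_one]
  field_simp

/-- The Gaussian integral over the logarithmic space. -/
def coneIntegral (K : Type*) [Field K] [NumberField K] (t : ℝ) : ℝ≥0∞ :=
  ∫⁻ l : logSpace K, ENNReal.ofReal (rexp (-π * coneForm t l 1))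

/-- Translation invariance of the measure forgets everything about x except its norm. -/
theorem lintegral_coneForm {x : K} (hx : x ≠ 0) (t : ℝ) :
    ∫⁻ l : logSpace K, ENNReal.ofReal (rexp (-π * coneForm t l x)) =
      coneIntegral K (t * (|Algebra.norm ℚ x| : ℝ) ^ (2 / finrank ℚ K : ℝ)) := by
  obtain ⟨m, hm⟩ := exists_coneForm_eq hx
  simp only [hm]
  exact lintegral_add_right_eq_self
    (fun l => ENNReal.ofReal (rexp (-π * coneForm
      (t * (|Algebra.norm ℚ x| : ℝ) ^ (2 / finrank ℚ K : ℝ)) l 1))) m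

/-- A fundamental domain for the action of the units on the logarithmic space. -/
def unitDomain (K : Type*) [Field K] [NumberField K] : Set (logSpace K) :=
  ZSpan.fundamentalDomain ((basisUnitLattice K).ofZLatticeBasis ℝ (unitLattice K))

theorem isAddFundamentalDomain_unitDomain :
    IsAddFundamentalDomain (unitLattice K) (unitDomain K) :=
  ZLattice.isAddFundamentalDomain (basisUnitLattice K) volume

theorem volume_unitDomain_ne_top : volume (unitDomain K) ≠ ∞ :=
  (ZSpan.fundamentalDomain_isBounded _).measure_lt_top.ne

/-- The units modulo torsion map bijectively to the unit lattice, so every lattice point is hit once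
for each root of unity. Values in `ℝ≥0∞` make the rearrangements unconditional. -/
theorem tsum_units (φ : logSpace K → ℝ≥0∞) :
    ∑' u : (𝓞 K)ˣ, φ (logEmbedding K (Additive.ofMul u)) =
      torsionOrder K * ∑' v : unitLattice K, φ v := by
  let e : (𝓞 K)ˣ ≃ ((𝓞 K)ˣ ⧸ torsion K) × torsion K := Subgroup.groupEquivQuotientProdSubgroup
  have he : ∀ u, (e u).1 = QuotientGroup.mk u := fun u => rfl
  rw [← (Additive.ofMul.trans (logEmbeddingEquiv K).toEquiv).tsum_eq, ← ENNReal.tsum_mul_left]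
  have h1 : ∀ u : (𝓞 K)ˣ, φ (logEmbedding K (Additive.ofMul u)) =
      φ (logEmbeddingEquiv K (Additive.ofMul (e u).1)) := fun u => by
    rw [he, logEmbeddingEquiv_apply]
  rw [tsum_congr h1, e.tsum_eq fun p => φ (logEmbeddingEquiv K (Additive.ofMul p.1)),
    ENNReal.tsum_prod (f := fun q _ => φ (logEmbeddingEquiv K (Additive.ofMul q)))]
  refine tsum_congr fun q => ?_
  simp only [ENNReal.tsum_const, torsionOrder]
  rw [ENat.card_eq_coe_natCard]
  simp

instance : VAddInvariantMeasure (unitLattice K) (logSpace K) volume :=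
  inferInstanceAs <| VAddInvariantMeasure (unitLattice K).toAddSubgroup (logSpace K) volume

/-- The unit lattice translates of the domain tile the logarithmic space, and each translation comes
from as many units as there are roots of unity. -/
theorem tsum_units_setLIntegral (g : logSpace K → ℝ≥0∞) :
    ∑' u : (𝓞 K)ˣ, ∫⁻ l in unitDomain K, g (l + logEmbedding K (Additive.ofMul u)) =
      torsionOrder K * ∫⁻ l, g l := by
  rw [tsum_units fun v => ∫⁻ l in unitDomain K, g (l + v),
    isAddFundamentalDomain_unitDomain.lintegral_eq_tsum'']
  congr 1
  refine tsum_congr fun v => ?_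
  simp only [add_comm, Submodule.vadd_def, vadd_eq_add]

/-! ### Elements of a fractional ideal and integral ideals in a class -/

/-- The nonzero integral ideals in a class. -/
abbrev IdealsInClass (c : ClassGroup (𝓞 K)) : Type _ :=
  {𝔞 : (Ideal (𝓞 K))⁰ // ClassGroup.mk0 𝔞 = c}

/-- As c is inverse to the class of J, the ideal 𝔞J is principal. -/
theorem exists_generator {J : (FractionalIdeal (𝓞 K)⁰ K)ˣ} {c : ClassGroup (𝓞 K)}
    (hc : c * ClassGroup.mk K J = 1) (𝔞 : IdealsInClass c) :
    ∃ x : K, x ≠ 0 ∧ FractionalIdeal.spanSingleton (𝓞 K)⁰ x =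
      ((𝔞.1 : Ideal (𝓞 K)) : FractionalIdeal (𝓞 K)⁰ K) * J := by
  have h : ClassGroup.mk K (FractionalIdeal.mk0 K 𝔞.1 * J) = 1 := by
    rw [map_mul, ClassGroup.mk_mk0, 𝔞.2, hc]
  obtain ⟨x, hx⟩ := (FractionalIdeal.isPrincipal_iff _).1 (ClassGroup.mk_eq_one_iff.1 h)
  rw [Units.val_mul, FractionalIdeal.coe_mk0] at hx
  refine ⟨x, ?_, hx.symm⟩
  rintro rfl
  rw [FractionalIdeal.spanSingleton_zero] at hx
  exact (FractionalIdeal.mk0 K 𝔞.1 * J).ne_zero hx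

theorem spanSingleton_eq_iff {x y : K} :
    FractionalIdeal.spanSingleton (𝓞 K)⁰ x = FractionalIdeal.spanSingleton (𝓞 K)⁰ y ↔
      ∃ u : (𝓞 K)ˣ, (u : K) * x = y := by
  rw [← FractionalIdeal.coeToSubmodule_inj, FractionalIdeal.coe_spanSingleton,
    FractionalIdeal.coe_spanSingleton, Submodule.span_singleton_eq_span_singleton]
  simp only [Units.smul_def, Algebra.smul_def]

/-- A generator of the principal ideal `𝔞J`. -/
def classGenerator {J : (FractionalIdeal (𝓞 K)⁰ K)ˣ} {c : ClassGroup (𝓞 K)}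
    (hc : c * ClassGroup.mk K J = 1) (𝔞 : IdealsInClass c) : K :=
  (exists_generator hc 𝔞).choose

section

variable {J : (FractionalIdeal (𝓞 K)⁰ K)ˣ} {c : ClassGroup (𝓞 K)}
    (hc : c * ClassGroup.mk K J = 1) (𝔞 : IdealsInClass c)

theorem classGenerator_ne_zero : classGenerator hc 𝔞 ≠ 0 :=
  (exists_generator hc 𝔞).choose_spec.1

theorem spanSingleton_classGenerator :
    FractionalIdeal.spanSingleton (𝓞 K)⁰ (classGenerator hc 𝔞) =
      ((𝔞.1 : Ideal (𝓞 K)) : FractionalIdeal (𝓞 K)⁰ K) * J :=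
  (exists_generator hc 𝔞).choose_spec.2

theorem abs_norm_classGenerator :
    (|Algebra.norm ℚ (classGenerator hc 𝔞)| : ℚ) =
      Ideal.absNorm (𝔞.1 : Ideal (𝓞 K)) *
        FractionalIdeal.absNorm (J : FractionalIdeal (𝓞 K)⁰ K) := by
  rw [← FractionalIdeal.absNorm_span_singleton (𝓞 K), spanSingleton_classGenerator hc 𝔞, map_mul,
    FractionalIdeal.coeIdeal_absNorm]

theorem unit_mul_classGenerator_mem (u : (𝓞 K)ˣ) :
    (u : K) * classGenerator hc 𝔞 ∈ (J : FractionalIdeal (𝓞 K)⁰ K) := by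
  have h : FractionalIdeal.spanSingleton (𝓞 K)⁰ ((u : K) * classGenerator hc 𝔞) ≤ J := by
    rw [← spanSingleton_eq_iff.2 ⟨u, rfl⟩,
      spanSingleton_classGenerator]
    exact mul_le_of_le_one_left' FractionalIdeal.coeIdeal_le_one
  exact h (FractionalIdeal.mem_spanSingleton_self _ _)

/-- The nonzero elements of `J` are the products of a unit with a generator of an ideal `𝔞J`. -/
def elementsEquiv :
    IdealsInClass c × (𝓞 K)ˣ ≃ {x : (J : FractionalIdeal (𝓞 K)⁰ K) // (x : K) ≠ 0} := by
  refine Equiv.ofBijective (fun p => ⟨⟨p.2 * classGenerator hc p.1,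
    unit_mul_classGenerator_mem hc p.1 p.2⟩,
      mul_ne_zero (by simp) (classGenerator_ne_zero hc p.1)⟩) ⟨?_, ?_⟩
  · rintro ⟨𝔞, u⟩ ⟨𝔟, v⟩ h
    have h1 : (u : K) * classGenerator hc 𝔞 = v * classGenerator hc 𝔟 := by
      simpa [Subtype.ext_iff] using h
    have h2 : 𝔞 = 𝔟 := by
      have h3 := congrArg (FractionalIdeal.spanSingleton (𝓞 K)⁰) h1
      rw [← spanSingleton_eq_iff.2 ⟨u, rfl⟩,
        ← spanSingleton_eq_iff.2 ⟨v, rfl⟩,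
        spanSingleton_classGenerator, spanSingleton_classGenerator] at h3
      exact Subtype.ext (Subtype.ext (FractionalIdeal.coeIdeal_injective
        (mul_right_cancel₀ J.ne_zero h3)))
    subst h2
    have h4 := mul_right_cancel₀ (classGenerator_ne_zero hc 𝔞) h1
    have : u = v := Units.ext (RingOfIntegers.ext h4)
    rw [this]
  · rintro ⟨⟨x, hxJ⟩, hx⟩
    -- The ideal attached to x is xJ⁻¹, which is integral because x lies in J.
    have h1 : FractionalIdeal.spanSingleton (𝓞 K)⁰ x * (J⁻¹ : (FractionalIdeal (𝓞 K)⁰ K)ˣ) ≤ 1 := by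
      rw [← J.mul_inv]
      refine mul_le_mul_left ?_ _
      rwa [FractionalIdeal.spanSingleton_le_iff_mem]
    obtain ⟨I, hI⟩ := FractionalIdeal.le_one_iff_exists_coeIdeal.1 h1
    have hIJ : (I : FractionalIdeal (𝓞 K)⁰ K) * J = FractionalIdeal.spanSingleton (𝓞 K)⁰ x := by
      rw [hI, mul_assoc, J.inv_mul, mul_one]
    have hI0 : I ≠ ⊥ := by
      rintro rfl
      rw [FractionalIdeal.coeIdeal_bot, zero_mul, eq_comm,
        FractionalIdeal.spanSingleton_eq_zero_iff] at hIJ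
      exact hx hIJ
    let I' : (Ideal (𝓞 K))⁰ := ⟨I, mem_nonZeroDivisors_of_ne_zero hI0⟩
    have hcl : ClassGroup.mk0 I' = c := by
      have h2 : ClassGroup.mk K (FractionalIdeal.mk0 K I' * J) = 1 := by
        rw [ClassGroup.mk_eq_one_iff, FractionalIdeal.isPrincipal_iff]
        exact ⟨x, hIJ⟩
      rw [map_mul, ClassGroup.mk_mk0] at h2
      exact mul_right_cancel (h2.trans hc.symm)
    have h3 : FractionalIdeal.spanSingleton (𝓞 K)⁰ (classGenerator hc ⟨I', hcl⟩) =
        FractionalIdeal.spanSingleton (𝓞 K)⁰ x := by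
      rw [spanSingleton_classGenerator]
      exact hIJ
    obtain ⟨u, hu⟩ := spanSingleton_eq_iff.1 h3
    exact ⟨(⟨I', hcl⟩, u), Subtype.ext (Subtype.ext hu)⟩

theorem coe_elementsEquiv (p : IdealsInClass c × (𝓞 K)ˣ) :
    ((elementsEquiv hc p).1 : K) = p.2 * classGenerator hc p.1 := rfl

theorem countable_fractionalIdeal : Countable (J : FractionalIdeal (𝓞 K)⁰ K) := by
  obtain ⟨b, hb, -⟩ := exists_basis_fractionalIdeal J
  exact (latticeEquiv b hb).symm.injective.countable

/-- **Unfolding**: the integral over the unit domain of the theta series of `J`. -/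
theorem lintegral_tsum_coneForm (hc : c * ClassGroup.mk K J = 1) (t : ℝ) :
    ∫⁻ l in unitDomain K, ∑' x : {x : (J : FractionalIdeal (𝓞 K)⁰ K) // (x : K) ≠ 0},
        ENNReal.ofReal (rexp (-π * coneForm t l (x.1 : K))) =
      torsionOrder K * ∑' 𝔞 : IdealsInClass c, coneIntegral K (t *
        (Ideal.absNorm (𝔞.1 : Ideal (𝓞 K)) *
          FractionalIdeal.absNorm (J : FractionalIdeal (𝓞 K)⁰ K) : ℝ) ^
            (2 / finrank ℚ K : ℝ)) := by
  have hJ : Countable (J : FractionalIdeal (𝓞 K)⁰ K) := countable_fractionalIdeal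
  have hJ' : Countable {x : (J : FractionalIdeal (𝓞 K)⁰ K) // (x : K) ≠ 0} := Subtype.countable
  have hcount : Countable (IdealsInClass c × (𝓞 K)ˣ) := (elementsEquiv hc).injective.countable
  have hm : ∀ x : K, Measurable fun l : logSpace K =>
      ENNReal.ofReal (rexp (-π * coneForm t l x)) := fun x =>
    (((continuous_coneForm t x).const_mul _).rexp).measurable.ennreal_ofReal
  simp only [← (elementsEquiv hc).tsum_eq fun x : {x : (J : FractionalIdeal (𝓞 K)⁰ K) // (x : K) ≠ 0} =>
    ENNReal.ofReal (rexp (-π * coneForm t _ (x.1 : K)))]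
  rw [lintegral_tsum fun p => (hm _).aemeasurable, ENNReal.tsum_prod', ← ENNReal.tsum_mul_left]
  refine tsum_congr fun 𝔞 => ?_
  simp only [coe_elementsEquiv, coneForm_unit_mul]
  -- For fixed 𝔞 the units spread the domain over the whole space, and the integral there depends
  -- only on the norm of the generator, which is N(𝔞)N(J) up to sign.
  rw [tsum_units_setLIntegral fun l => ENNReal.ofReal (rexp (-π * coneForm t l _)),
    lintegral_coneForm (classGenerator_ne_zero hc 𝔞)]
  congr 4
  have := congrArg (fun q : ℚ => (q : ℝ)) (abs_norm_classGenerator hc 𝔞)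
  push_cast at this
  exact this

end

end UnitUnfolding

/-! ### The Mellin transform of the integral over the logarithmic space -/

section ConeMellin

open NumberField NumberField.InfinitePlace NumberField.Units NumberField.Units.dirichletUnitTheorem
open Module Real MeasureTheory Set
open scoped nonZeroDivisors ENNReal Classical

/-- The substitution t = eˣ turns Mellin integrals into integrals over ℝ, where the change of
variables to the places becomes linear. -/
theorem integrableOn_Ioi_iff_integrable_exp {f : ℝ → ℂ} :
    IntegrableOn f (Ioi 0) ↔ Integrable fun x : ℝ => (rexp x : ℂ) * f (rexp x) := by
  have h := integrableOn_image_iff_integrableOn_abs_deriv_smul (s := Set.univ) (f := rexp)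
    (f' := rexp) MeasurableSet.univ (fun x _ => (Real.hasDerivAt_exp x).hasDerivWithinAt)
    Real.exp_injective.injOn f
  rw [image_univ, Real.range_exp, integrableOn_univ] at h
  simpa [abs_of_pos (Real.exp_pos _)] using h

theorem integral_Ioi_eq_integral_exp (f : ℝ → ℂ) :
    ∫ t in Ioi 0, f t = ∫ x : ℝ, (rexp x : ℂ) * f (rexp x) := by
  have h := integral_image_eq_integral_abs_deriv_smul (s := Set.univ) (f := rexp)
    (f' := rexp) MeasurableSet.univ (fun x _ => (Real.hasDerivAt_exp x).hasDerivWithinAt)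
    Real.exp_injective.injOn f
  rw [image_univ, Real.range_exp, setIntegral_univ] at h
  simpa [abs_of_pos (Real.exp_pos _)] using h

theorem exp_mul_cpow_exp (x : ℝ) (z : ℂ) :
    (rexp x : ℂ) * (rexp x : ℂ) ^ (z - 1) = Complex.exp (z * x) := by
  rw [Complex.cpow_def_of_ne_zero (by exact_mod_cast (Real.exp_pos x).ne'),
    ← Complex.ofReal_log (Real.exp_pos x).le, Real.log_exp, Complex.ofReal_exp, ← Complex.exp_add]
  congr 1
  ring

theorem mellinConvergent_iff_integrable_exp {f : ℝ → ℂ} {z : ℂ} :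
    MellinConvergent f z ↔ Integrable fun x : ℝ => Complex.exp (z * x) * f (rexp x) := by
  rw [MellinConvergent, integrableOn_Ioi_iff_integrable_exp]
  simp only [smul_eq_mul, ← mul_assoc, exp_mul_cpow_exp]

theorem mellin_eq_integral_exp (f : ℝ → ℂ) (z : ℂ) :
    mellin f z = ∫ x : ℝ, Complex.exp (z * x) * f (rexp x) := by
  rw [mellin, integral_Ioi_eq_integral_exp]
  simp only [smul_eq_mul, ← mul_assoc, exp_mul_cpow_exp]

theorem mellin_exp_neg_mul {r : ℝ} (hr : 0 < r) {z : ℂ} (hz : 0 < z.re) :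
    mellin (fun t => (rexp (-r * t) : ℂ)) z = (1 / r : ℂ) ^ z * Complex.Gamma z := by
  rw [← Complex.integral_cpow_mul_exp_neg_mul_Ioi hz (by simpa using hr), mellin]
  simp

theorem mellinConvergent_exp_neg_mul {r : ℝ} (hr : 0 < r) {z : ℂ} (hz : 0 < z.re) :
    MellinConvergent (fun t => (rexp (-r * t) : ℂ)) z := by
  have h : MellinConvergent (fun t => (rexp (-t) : ℂ)) z := by
    have := Complex.GammaIntegral_convergent hz
    rw [MellinConvergent]
    refine this.congr_fun (fun x _ => ?_) measurableSet_Ioi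
    simp [mul_comm]
  have := (MellinConvergent.comp_mul_left hr).2 h
  simpa using this

variable {K : Type*} [Field K] [NumberField K]

theorem sum_mult_real : ∑ w : InfinitePlace K, (mult w : ℝ) = finrank ℚ K := by
  exact_mod_cast sum_mult_eq (K := K)

/-- Logarithmic coordinates on the weights, as a linear map. -/
def logCoordLinear (K : Type*) [Field K] [NumberField K] :
    (ℝ × logSpace K) →ₗ[ℝ] (InfinitePlace K → ℝ) where
  toFun p w := p.1 + logWeight p.2 w
  map_add' p q := by
    ext w
    simp only [Prod.fst_add, Prod.snd_add, logWeight_add, Pi.add_apply]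
    ring
  map_smul' c p := by
    ext w
    simp only [Prod.smul_fst, Prod.smul_snd, logWeight_smul, Pi.smul_apply, smul_eq_mul,
      RingHom.id_apply]
    ring

/-- The first coordinate is the weighted mean over the places; what remains has weighted sum zero
and so is a vector of logarithmic weights. -/
theorem bijective_logCoordLinear : Function.Bijective (logCoordLinear K) := by
  have hn : (finrank ℚ K : ℝ) ≠ 0 := by exact_mod_cast (finrank_pos (R := ℚ) (M := K)).ne'
  constructor
  · rw [← LinearMap.ker_eq_bot, LinearMap.ker_eq_bot']
    rintro ⟨τ, l⟩ h
    have h1 : ∀ w, τ + logWeight l w = 0 := fun w => congrFun h w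
    have h2 : ∑ w : InfinitePlace K, mult w * (τ + logWeight l w) = 0 := by simp [h1]
    simp only [mul_add, Finset.sum_add_distrib, sum_mult_mul_logWeight, ← Finset.sum_mul,
      sum_mult_real, add_zero] at h2
    have hτ : τ = 0 := (mul_eq_zero.1 h2).resolve_left hn
    subst hτ
    refine Prod.ext rfl (funext fun w => ?_)
    have h3 := h1 w.1
    rw [logWeight_of_ne, zero_add] at h3
    have : (mult w.1 : ℝ) ≠ 0 := mult_coe_ne_zero
    simpa [this] using h3
  · intro ξ
    set τ := (∑ w : InfinitePlace K, mult w * ξ w) / finrank ℚ K with hτ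
    have hμ : ∑ w : InfinitePlace K, mult w * (ξ w - τ) = 0 := by
      simp only [mul_sub, Finset.sum_sub_distrib, ← Finset.sum_mul, sum_mult_real, hτ]
      field_simp
      ring
    refine ⟨(τ, fun w => mult w.1 * (ξ w.1 - τ) / 2), funext fun w => ?_⟩
    change τ + logWeight _ w = ξ w
    rw [congrFun (logWeight_eq_of_sum_eq_zero hμ) w]
    ring

/-- Logarithmic coordinates on the weights. -/
def logCoord (K : Type*) [Field K] [NumberField K] :
    (ℝ × logSpace K) ≃L[ℝ] (InfinitePlace K → ℝ) :=
  (LinearEquiv.ofBijective (logCoordLinear K) bijective_logCoordLinear).toContinuousLinearEquiv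

theorem logCoord_apply (p : ℝ × logSpace K) (w : InfinitePlace K) :
    logCoord K p w = p.1 + logWeight p.2 w := rfl

theorem sum_mult_mul_logCoord (p : ℝ × logSpace K) :
    ∑ w, mult w * logCoord K p w = finrank ℚ K * p.1 := by
  simp only [logCoord_apply, mul_add, Finset.sum_add_distrib, sum_mult_mul_logWeight,
    ← Finset.sum_mul, sum_mult_real, add_zero]

/-- Uniqueness of Haar measure. The constant is left undetermined, since the residue of the zeta
function is obtained by other means. -/
theorem exists_map_logCoord : ∃ C : ℝ, 0 < C ∧
    Measure.map (logCoord K) (volume : Measure (ℝ × logSpace K)) =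
      ENNReal.ofReal C • (volume : Measure (InfinitePlace K → ℝ)) := by
  have : (volume : Measure (ℝ × logSpace K)).IsAddHaarMeasure :=
    inferInstanceAs ((volume : Measure ℝ).prod (volume : Measure (logSpace K))).IsAddHaarMeasure
  set μ := Measure.map (logCoord K) (volume : Measure (ℝ × logSpace K))
  have hμ : μ.IsAddHaarMeasure := (logCoord K).isAddHaarMeasure_map _
  refine ⟨Measure.addHaarScalarFactor μ volume,
    Measure.addHaarScalarFactor_pos_of_isAddHaarMeasure μ volume, ?_⟩
  rw [ENNReal.ofReal_coe_nnreal]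
  exact Measure.isAddLeftInvariant_eq_smul μ volume

theorem measurableEmbedding_logCoord : MeasurableEmbedding (logCoord K) :=
  (logCoord K).toHomeomorph.measurableEmbedding

/-- The constant by which `logCoord` changes the measure. -/
def logCoordConst (K : Type*) [Field K] [NumberField K] : ℝ := (exists_map_logCoord (K := K)).choose

theorem logCoordConst_pos : 0 < logCoordConst K := (exists_map_logCoord (K := K)).choose_spec.1

theorem map_logCoord : Measure.map (logCoord K) (volume : Measure (ℝ × logSpace K)) =
    ENNReal.ofReal (logCoordConst K) • (volume : Measure (InfinitePlace K → ℝ)) :=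
  (exists_map_logCoord (K := K)).choose_spec.2

/-- The integrand of the Mellin transform of the cone integral. -/
def coneIntegrand (z : ℂ) (p : ℝ × logSpace K) : ℂ :=
  Complex.exp (z * p.1) * (rexp (-π * coneForm (rexp p.1) p.2 (1 : K)) : ℂ)

/-- In the coordinates ξ_w both exponents are sums over the places: zτ is ∑ (z n_w / n) ξ_w, and the
form at 1 is ∑ n_w exp(ξ_w). The multiple integral thus becomes a product of gamma integrals. -/
theorem coneIntegrand_eq (z : ℂ) (p : ℝ × logSpace K) :
    coneIntegrand z p = ∏ w, (Complex.exp (z * mult w / finrank ℚ K * logCoord K p w) *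
      (rexp (-(π * mult w) * rexp (logCoord K p w)) : ℂ)) := by
  have hn : (finrank ℚ K : ℂ) ≠ 0 := by exact_mod_cast (finrank_pos (R := ℚ) (M := K)).ne'
  rw [Finset.prod_mul_distrib, ← Complex.exp_sum, ← Complex.ofReal_prod, ← Real.exp_sum,
    coneIntegrand]
  congr 2
  · have h := congrArg (fun x : ℝ => (x : ℂ)) (sum_mult_mul_logCoord p)
    push_cast at h
    rw [← Finset.sum_congr rfl fun w _ => show z / finrank ℚ K * (mult w * logCoord K p w) = _ by ring,
      ← Finset.mul_sum, h]
    field_simp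
  · congr 1
    rw [coneForm_eq, Finset.mul_sum, Finset.mul_sum]
    refine Finset.sum_congr rfl fun w _ => ?_
    rw [logCoord_apply, Real.exp_add, coneWeight, map_one]
    ring

theorem re_mul_mult_div_pos {z : ℂ} (hz : 0 < z.re) (w : InfinitePlace K) :
    0 < (z * mult w / finrank ℚ K).re := by
  have h1 : (0 : ℝ) < finrank ℚ K := by exact_mod_cast (finrank_pos (R := ℚ) (M := K))
  have h2 : (0 : ℝ) < mult w := by exact_mod_cast mult_pos
  rw [show z * mult w / finrank ℚ K = z * ((mult w / finrank ℚ K : ℝ) : ℂ) by push_cast; ring,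
    Complex.re_mul_ofReal]
  positivity

theorem integrable_coneIntegrand {z : ℂ} (hz : 0 < z.re) :
    Integrable (coneIntegrand z : ℝ × logSpace K → ℂ) := by
  have h1 : ∀ w : InfinitePlace K, Integrable fun x : ℝ =>
      Complex.exp (z * mult w / finrank ℚ K * x) * (rexp (-(π * mult w) * rexp x) : ℂ) := fun w =>
    mellinConvergent_iff_integrable_exp.1 (mellinConvergent_exp_neg_mul
      (mul_pos pi_pos (by exact_mod_cast mult_pos)) (re_mul_mult_div_pos hz w))
  have h2 := Integrable.fintype_prod h1
  have h3 : Integrable (fun ξ : InfinitePlace K → ℝ => ∏ w,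
      (Complex.exp (z * mult w / finrank ℚ K * ξ w) * (rexp (-(π * mult w) * rexp (ξ w)) : ℂ)))
      (Measure.map (logCoord K) volume) := by
    rw [map_logCoord]
    exact h2.smul_measure ENNReal.ofReal_ne_top
  rw [measurableEmbedding_logCoord.integrable_map_iff] at h3
  exact h3.congr (Eventually.of_forall fun p => (coneIntegrand_eq z p).symm)

theorem integral_coneIntegrand {z : ℂ} (hz : 0 < z.re) :
    ∫ p : ℝ × logSpace K, coneIntegrand z p = logCoordConst K *
      ∏ w : InfinitePlace K, ((1 / (π * mult w : ℝ) : ℂ) ^ (z * mult w / finrank ℚ K) *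
        Complex.Gamma (z * mult w / finrank ℚ K)) := by
  have h1 : ∀ w : InfinitePlace K, ∫ x : ℝ,
      Complex.exp (z * mult w / finrank ℚ K * x) * (rexp (-(π * mult w) * rexp x) : ℂ) =
      (1 / (π * mult w : ℝ) : ℂ) ^ (z * mult w / finrank ℚ K) *
        Complex.Gamma (z * mult w / finrank ℚ K) := fun w => by
    rw [← mellin_exp_neg_mul (mul_pos pi_pos (by exact_mod_cast mult_pos))
      (re_mul_mult_div_pos hz w), mellin_eq_integral_exp]
  have h3 : ∫ ξ : InfinitePlace K → ℝ, ∏ w,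
      (Complex.exp (z * mult w / finrank ℚ K * ξ w) * (rexp (-(π * mult w) * rexp (ξ w)) : ℂ))
      ∂(Measure.map (logCoord K) volume) = ∫ p : ℝ × logSpace K, coneIntegrand z p := by
    rw [measurableEmbedding_logCoord.integral_map]
    exact integral_congr_ae (Eventually.of_forall fun p => (coneIntegrand_eq z p).symm)
  rw [← h3, map_logCoord, integral_smul_measure, ENNReal.toReal_ofReal logCoordConst_pos.le,
    integral_fintype_prod_volume_eq_prod (f := fun (w : InfinitePlace K) (x : ℝ) =>
      Complex.exp (z * mult w / finrank ℚ K * x) * (rexp (-(π * mult w) * rexp x) : ℂ)),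
    Finset.prod_congr rfl fun w _ => h1 w]
  simp

/-- The form is linear in t, and its slope is at least n because eˣ ≥ 1 + x and the logarithmic
weights have weighted sum zero. This is the source of the exponential decay of the theta functions.
-/
theorem coneForm_one_mono {s t : ℝ} (h : s ≤ t) (l : logSpace K) :
    coneForm s l (1 : K) + finrank ℚ K * (t - s) ≤ coneForm t l (1 : K) := by
  have h1 : (finrank ℚ K : ℝ) ≤ ∑ w, mult w * coneWeight l w * w (1 : K) ^ 2 := by
    calc (finrank ℚ K : ℝ) = ∑ w : InfinitePlace K, mult w * (logWeight l w + 1) := by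
          simp only [mul_add, Finset.sum_add_distrib, sum_mult_mul_logWeight, mul_one,
            sum_mult_real, zero_add]
      _ ≤ _ := by
          refine Finset.sum_le_sum fun w _ => ?_
          rw [map_one, one_pow, mul_one]
          exact mul_le_mul_of_nonneg_left (Real.add_one_le_exp _) (by positivity)
  rw [coneForm_eq, coneForm_eq]
  nlinarith

theorem coneIntegral_le {s t : ℝ} (h : s ≤ t) :
    coneIntegral K t ≤
      ENNReal.ofReal (rexp (-π * finrank ℚ K * (t - s))) * coneIntegral K s := by
  rw [coneIntegral, coneIntegral, ← lintegral_const_mul' _ _ ENNReal.ofReal_ne_top]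
  refine lintegral_mono fun l => ?_
  rw [← ENNReal.ofReal_mul (Real.exp_pos _).le, ← Real.exp_add]
  refine ENNReal.ofReal_le_ofReal (Real.exp_le_exp.2 ?_)
  have := mul_le_mul_of_nonneg_left (coneForm_one_mono h l) pi_pos.le
  linarith

theorem antitone_coneIntegral : Antitone (coneIntegral K) := fun s t h => by
  refine (coneIntegral_le h).trans (mul_le_of_le_one_left' ?_)
  rw [ENNReal.ofReal_le_one, Real.exp_le_one_iff]
  have : 0 ≤ π * finrank ℚ K * (t - s) := by
    have := sub_nonneg.2 h
    positivity
  linarith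

/-- Fubini gives finiteness at almost every scale, and monotonicity extends it to all positive t.
The exponent z = 1 could be any with positive real part. -/
theorem coneIntegral_ne_top {t : ℝ} (ht : 0 < t) : coneIntegral K t ≠ ∞ := by
  have h := (integrable_coneIntegrand (K := K) (z := 1) (by simp)).prod_right_ae
  obtain ⟨τ, hτ, hlt⟩ := (Measure.dense_of_ae h).exists_lt (Real.log t)
  have h1 : Integrable fun l : logSpace K => rexp (-π * coneForm (rexp τ) l (1 : K)) := by
    have h2 := (Integrable.norm hτ).const_mul (rexp τ)⁻¹
    refine h2.congr (Eventually.of_forall fun l => ?_)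
    simp only [coneIntegrand, one_mul, norm_mul, Complex.norm_exp_ofReal, Complex.norm_real,
      Real.norm_eq_abs, Real.abs_exp]
    rw [inv_mul_cancel_left₀ (Real.exp_pos _).ne']
  have h3 : coneIntegral K (rexp τ) ≠ ∞ := by
    have := h1.hasFiniteIntegral
    rw [hasFiniteIntegral_iff_ofReal (Eventually.of_forall fun l => (Real.exp_pos _).le)] at this
    exact this.ne
  refine ne_top_of_le_ne_top h3 (antitone_coneIntegral ?_)
  exact ((Real.lt_log_iff_exp_lt ht).1 hlt).le

theorem toReal_coneIntegral (t : ℝ) :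
    ((coneIntegral K t).toReal : ℂ) = ∫ l : logSpace K, (rexp (-π * coneForm t l (1 : K)) : ℂ) := by
  have hc : Continuous fun l : logSpace K => rexp (-π * coneForm t l (1 : K)) :=
    ((continuous_coneForm t (1 : K)).const_mul _).rexp
  rw [integral_complex_ofReal, integral_eq_lintegral_of_nonneg_ae
    (Eventually.of_forall fun l => (Real.exp_pos _).le) hc.aestronglyMeasurable]
  rfl

theorem mellinConvergent_coneIntegral {z : ℂ} (hz : 0 < z.re) :
    MellinConvergent (fun t => ((coneIntegral K t).toReal : ℂ)) z := by
  rw [mellinConvergent_iff_integrable_exp]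
  have h := (integrable_coneIntegrand (K := K) hz).integral_prod_left
  simpa only [coneIntegrand, integral_const_mul, ← toReal_coneIntegral] using h

theorem mellin_coneIntegral {z : ℂ} (hz : 0 < z.re) :
    mellin (fun t => ((coneIntegral K t).toReal : ℂ)) z = logCoordConst K *
      ∏ w : InfinitePlace K, ((1 / (π * mult w : ℝ) : ℂ) ^ (z * mult w / finrank ℚ K) *
        Complex.Gamma (z * mult w / finrank ℚ K)) := by
  rw [← integral_coneIntegrand hz, mellin_eq_integral_exp]
  rw [Measure.volume_eq_prod, integral_prod _ (integrable_coneIntegrand (K := K) hz)]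
  simp only [coneIntegrand, integral_const_mul, ← toReal_coneIntegral]

end ConeMellin

/-! ### Theta functions of ideal classes and their inversion -/

section TotalTheta

open NumberField NumberField.InfinitePlace NumberField.Units NumberField.Units.dirichletUnitTheorem
open Module Real MeasureTheory Set
open scoped nonZeroDivisors ENNReal Classical

variable {K : Type*} [Field K] [NumberField K]

/-- The theta series of a fractional ideal, as a function of the weights. -/
def coneTheta (J : (FractionalIdeal (𝓞 K)⁰ K)ˣ) (t : ℝ) (l : logSpace K) : ℝ≥0∞ :=
  ∑' x : (J : FractionalIdeal (𝓞 K)⁰ K), ENNReal.ofReal (rexp (-π * coneForm t l (x : K)))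

/-- The integral over the unit domain of the theta series of a fractional ideal. -/
def thetaIntegral (J : (FractionalIdeal (𝓞 K)⁰ K)ˣ) (t : ℝ) : ℝ≥0∞ :=
  ∫⁻ l in unitDomain K, coneTheta J t l

/-- The theta function of an ideal class. -/
def idealTheta (c : ClassGroup (𝓞 K)) (t : ℝ) : ℝ≥0∞ :=
  volume (unitDomain K) + torsionOrder K * ∑' 𝔞 : IdealsInClass c,
    coneIntegral K (t * (Ideal.absNorm (𝔞.1 : Ideal (𝓞 K)) : ℝ) ^ (2 / finrank ℚ K : ℝ))

theorem absNorm_unit_pos (J : (FractionalIdeal (𝓞 K)⁰ K)ˣ) :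
    (0 : ℝ) < FractionalIdeal.absNorm (J : FractionalIdeal (𝓞 K)⁰ K) := by
  have h : FractionalIdeal.absNorm (J : FractionalIdeal (𝓞 K)⁰ K) ≠ 0 := by
    rw [Ne, FractionalIdeal.absNorm_eq_zero_iff]
    exact J.ne_zero
  exact_mod_cast lt_of_le_of_ne (FractionalIdeal.absNorm_nonneg _) h.symm

/-- The element 0 contributes the volume of the domain and the other elements unfold over ideals.
Within a class, J then matters only through a rescaling of t. -/
theorem thetaIntegral_eq_idealTheta {J : (FractionalIdeal (𝓞 K)⁰ K)ˣ} {c : ClassGroup (𝓞 K)}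
    (hc : c * ClassGroup.mk K J = 1) (t : ℝ) :
    thetaIntegral J t = idealTheta c (t *
      (FractionalIdeal.absNorm (J : FractionalIdeal (𝓞 K)⁰ K) : ℝ) ^ (2 / finrank ℚ K : ℝ)) := by
  have h1 : ∀ l : logSpace K, coneTheta J t l = 1 +
      ∑' x : {x : (J : FractionalIdeal (𝓞 K)⁰ K) // (x : K) ≠ 0},
        ENNReal.ofReal (rexp (-π * coneForm t l (x.1 : K))) := fun l => by
    rw [coneTheta, ENNReal.tsum_eq_add_tsum_ite ⟨0, FractionalIdeal.zero_mem _⟩]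
    congr 1
    · simp [coneForm_eq]
    · refine Eq.trans ?_ (tsum_subtype {x : (J : FractionalIdeal (𝓞 K)⁰ K) | (x : K) ≠ 0}
        fun x => ENNReal.ofReal (rexp (-π * coneForm t l (x : K)))).symm
      refine tsum_congr fun x => ?_
      by_cases hx : x = ⟨0, FractionalIdeal.zero_mem _⟩
      · simp [hx]
      · have : (x : K) ≠ 0 := fun h => hx (Subtype.ext h)
        rw [if_neg hx, indicator_of_mem]
        exact this
  simp only [thetaIntegral, h1]
  rw [lintegral_add_left measurable_const, lintegral_tsum_coneForm hc, setLIntegral_one, idealTheta]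
  congr 2
  refine tsum_congr fun 𝔞 => ?_
  rw [Real.mul_rpow (by positivity) (absNorm_unit_pos J).le]
  congr 1
  ring

/-- Multiplication by a unit permutes J. -/
theorem coneTheta_add_logEmbedding (J : (FractionalIdeal (𝓞 K)⁰ K)ˣ) (t : ℝ) (l : logSpace K)
    (u : (𝓞 K)ˣ) : coneTheta J t (l + logEmbedding K (Additive.ofMul u)) = coneTheta J t l := by
  have hmem : ∀ (u : (𝓞 K)ˣ) (x : (J : FractionalIdeal (𝓞 K)⁰ K)),
      (u : K) * x ∈ (J : FractionalIdeal (𝓞 K)⁰ K) := fun u x => by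
    have := Submodule.smul_mem ((J : FractionalIdeal (𝓞 K)⁰ K) : Submodule (𝓞 K) K) (u : 𝓞 K) x.2
    rwa [Algebra.smul_def] at this
  have huv : ∀ u : (𝓞 K)ˣ, (u : K) * ((u⁻¹ : (𝓞 K)ˣ) : K) = 1 := fun u => by
    rw [← NumberField.Units.coe_mul, mul_inv_cancel, NumberField.Units.coe_one]
  let e : {x : K // x ∈ (J : FractionalIdeal (𝓞 K)⁰ K)} ≃
      {x : K // x ∈ (J : FractionalIdeal (𝓞 K)⁰ K)} :=
    { toFun := fun x => ⟨u * x, hmem u x⟩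
      invFun := fun x => ⟨(u⁻¹ : (𝓞 K)ˣ) * x, hmem u⁻¹ x⟩
      left_inv := fun x => Subtype.ext (by
        change ((u⁻¹ : (𝓞 K)ˣ) : K) * (u * x) = x
        rw [← mul_assoc, mul_comm _ (u : K), huv, one_mul])
      right_inv := fun x => Subtype.ext (by
        change (u : K) * (((u⁻¹ : (𝓞 K)ˣ) : K) * x) = x
        rw [← mul_assoc, huv, one_mul]) }
  rw [coneTheta, coneTheta,
    ← e.tsum_eq fun x => ENNReal.ofReal (rexp (-π * coneForm t l (x : K)))]
  refine tsum_congr fun x => ?_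
  rw [← coneForm_unit_mul]
  rfl

theorem coneTheta_vadd (J : (FractionalIdeal (𝓞 K)⁰ K)ˣ) (t : ℝ) (v : unitLattice K)
    (l : logSpace K) : coneTheta J t (v +ᵥ l) = coneTheta J t l := by
  obtain ⟨v, hv⟩ := v
  obtain ⟨u, -, rfl⟩ := hv
  rw [← coneTheta_add_logEmbedding J t l u.toMul, add_comm]
  rfl

/-- Theta inversion sends l to -l. The negative of the domain is again a fundamental domain, and the
integral of a periodic function does not depend on the domain. -/
theorem setLIntegral_unitDomain_neg (g : logSpace K → ℝ≥0∞)
    (hg : ∀ (v : unitLattice K) (l), g (v +ᵥ l) = g l) :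
    ∫⁻ l in unitDomain K, g (-l) = ∫⁻ l in unitDomain K, g l := by
  have hmp : MeasurePreserving (fun l : logSpace K => -l) volume volume :=
    Measure.measurePreserving_neg volume
  have h1 : IsAddFundamentalDomain (unitLattice K) ((fun l : logSpace K => -l) ⁻¹' unitDomain K) :=
    isAddFundamentalDomain_unitDomain.preimage_of_equiv hmp.quasiMeasurePreserving
      (e := fun v => -v) neg_involutive.bijective fun v l => by
        change -((-v : unitLattice K) +ᵥ l) = v +ᵥ -l
        simp only [Submodule.vadd_def, vadd_eq_add, Submodule.coe_neg, neg_add, neg_neg]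
  have h2 := hmp.setLIntegral_comp_preimage_emb
    (MeasurableEquiv.neg (logSpace K)).measurableEmbedding (fun l => g (-l)) (unitDomain K)
  simp only [neg_neg] at h2
  rw [← h2]
  exact h1.setLIntegral_eq isAddFundamentalDomain_unitDomain g hg

/-- The inverse different, as an invertible fractional ideal. -/
def inverseDifferent (K : Type*) [Field K] [NumberField K] : (FractionalIdeal (𝓞 K)⁰ K)ˣ :=
  Units.mk0 (FractionalIdeal.dual ℤ ℚ (1 : FractionalIdeal (𝓞 K)⁰ K)) (by simp)

theorem coe_inverseDifferent_mul_inv (J : (FractionalIdeal (𝓞 K)⁰ K)ˣ) :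
    ((inverseDifferent K * J⁻¹ : (FractionalIdeal (𝓞 K)⁰ K)ˣ) : FractionalIdeal (𝓞 K)⁰ K) =
      FractionalIdeal.dual ℤ ℚ (J : FractionalIdeal (𝓞 K)⁰ K) := by
  rw [FractionalIdeal.dual_eq_mul_inv, Units.val_mul, Units.val_inv_eq_inv_val]
  rfl

theorem absNorm_inverseDifferent :
    (FractionalIdeal.absNorm (inverseDifferent K : FractionalIdeal (𝓞 K)⁰ K) : ℝ) =
      |(discr K : ℝ)|⁻¹ := by
  have h := coeIdeal_differentIdeal ℤ ℚ K (𝓞 K)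
  have h2 : ((differentIdeal ℤ (𝓞 K) : Ideal (𝓞 K)) : FractionalIdeal (𝓞 K)⁰ K) =
      (inverseDifferent K : FractionalIdeal (𝓞 K)⁰ K)⁻¹ := h
  have h3 := congrArg FractionalIdeal.absNorm h2
  rw [FractionalIdeal.coeIdeal_absNorm, NumberField.absNorm_differentIdeal K, map_inv₀] at h3
  have h4 := congrArg (fun q : ℚ => (q : ℝ)⁻¹) h3
  push_cast at h4
  rw [inv_inv] at h4
  rw [← h4, Nat.cast_natAbs, Int.cast_abs]

/-- The cone weights have product one, so the determinant factor is tⁿ; the inverse weights belong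
to t⁻¹ and -l, and the dual of J is the inverse different times J⁻¹. -/
theorem coneTheta_inversion (J : (FractionalIdeal (𝓞 K)⁰ K)ˣ) {t : ℝ} (ht : 0 < t)
    (l : logSpace K) :
    coneTheta J t l = ENNReal.ofReal (√(|(discr K : ℝ)| *
        (FractionalIdeal.absNorm (J : FractionalIdeal (𝓞 K)⁰ K) : ℝ) ^ 2 * t ^ finrank ℚ K))⁻¹ *
      coneTheta (inverseDifferent K * J⁻¹) t⁻¹ (-l) := by
  have hy : ∀ w : InfinitePlace K, 0 < t * coneWeight l w := fun w =>
    mul_pos ht (coneWeight_pos l w)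
  have hy' : ∀ w : InfinitePlace K, 0 < t⁻¹ * coneWeight (-l) w := fun w =>
    mul_pos (inv_pos.2 ht) (coneWeight_pos _ w)
  have hprod : ∏ w : InfinitePlace K, (t * coneWeight l w) ^ mult w = t ^ finrank ℚ K := by
    simp only [mul_pow, Finset.prod_mul_distrib, prod_coneWeight_pow, mul_one,
      Finset.prod_pow_eq_pow_sum, sum_mult_eq]
  have hinv : (fun w : InfinitePlace K => (t * coneWeight l w)⁻¹) =
      fun w => t⁻¹ * coneWeight (-l) w := by
    ext w
    rw [coneWeight_neg, mul_inv]
  have h := tsum_exp_placeForm J hy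
  rw [hprod, hinv, ← coe_inverseDifferent_mul_inv] at h
  have h1 := summable_exp_placeForm J hy
  have h2 := summable_exp_placeForm (inverseDifferent K * J⁻¹) hy'
  simp only [coneTheta, coneForm]
  rw [← ENNReal.ofReal_tsum_of_nonneg (fun _ => (Real.exp_pos _).le) h1, h,
    ENNReal.ofReal_mul (inv_nonneg.2 (Real.sqrt_nonneg _)),
    ENNReal.ofReal_tsum_of_nonneg (fun _ => (Real.exp_pos _).le) h2]

theorem thetaIntegral_inversion (J : (FractionalIdeal (𝓞 K)⁰ K)ˣ) {t : ℝ} (ht : 0 < t) :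
    thetaIntegral J t = ENNReal.ofReal (√(|(discr K : ℝ)| *
        (FractionalIdeal.absNorm (J : FractionalIdeal (𝓞 K)⁰ K) : ℝ) ^ 2 * t ^ finrank ℚ K))⁻¹ *
      thetaIntegral (inverseDifferent K * J⁻¹) t⁻¹ := by
  rw [thetaIntegral, thetaIntegral, 
    ← setLIntegral_unitDomain_neg _ (coneTheta_vadd (inverseDifferent K * J⁻¹) t⁻¹),
    ← lintegral_const_mul' _ _ ENNReal.ofReal_ne_top]
  exact lintegral_congr fun l => coneTheta_inversion J ht l

theorem idealTheta_inversion (c : ClassGroup (𝓞 K)) {τ : ℝ} (hτ : 0 < τ) :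
    idealTheta c (|(discr K : ℝ)| ^ (-1 / finrank ℚ K : ℝ) * τ) =
      ENNReal.ofReal (τ ^ (-(finrank ℚ K / 2 : ℝ))) *
      idealTheta (c⁻¹ * (ClassGroup.mk K (inverseDifferent K))⁻¹)
        (|(discr K : ℝ)| ^ (-1 / finrank ℚ K : ℝ) * τ⁻¹) := by
  obtain ⟨J, hJ⟩ : ∃ J : (FractionalIdeal (𝓞 K)⁰ K)ˣ, ClassGroup.mk K J = c⁻¹ := by
    obtain ⟨I, hI⟩ := ClassGroup.mk0_surjective c⁻¹
    exact ⟨FractionalIdeal.mk0 K I, by rw [ClassGroup.mk_mk0, hI]⟩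
  have hc : c * ClassGroup.mk K J = 1 := by rw [hJ, mul_inv_cancel]
  have hc' : c⁻¹ * (ClassGroup.mk K (inverseDifferent K))⁻¹ *
      ClassGroup.mk K (inverseDifferent K * J⁻¹) = 1 := by
    rw [map_mul, map_inv, hJ, inv_inv]
    group
  have hd : 0 < |(discr K : ℝ)| := abs_pos.2 (by exact_mod_cast discr_ne_zero K)
  have hn : (finrank ℚ K : ℝ) ≠ 0 := by exact_mod_cast (finrank_pos (R := ℚ) (M := K)).ne'
  set d := |(discr K : ℝ)|
  set N : ℝ := (FractionalIdeal.absNorm (J : FractionalIdeal (𝓞 K)⁰ K) : ℝ) with hN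
  have hNpos : 0 < N := absNorm_unit_pos J
  have hN' : (FractionalIdeal.absNorm ((inverseDifferent K * J⁻¹ : (FractionalIdeal (𝓞 K)⁰ K)ˣ) :
      FractionalIdeal (𝓞 K)⁰ K) : ℝ) = d⁻¹ * N⁻¹ := by
    rw [Units.val_mul, map_mul, Rat.cast_mul, absNorm_inverseDifferent, Units.val_inv_eq_inv_val,
      map_inv₀, Rat.cast_inv]
  -- This scale t satisfies t N^(2/n) = d^(-1/n) τ. As the dual of J has norm 1/(dN), the other side
  -- acquires the same shape with τ⁻¹, and √(d N² tⁿ) reduces to τ^(n/2).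
  have ht : 0 < d ^ (-1 / finrank ℚ K : ℝ) * τ * N ^ (-(2 / finrank ℚ K : ℝ)) := by positivity
  have h := thetaIntegral_inversion J ht
  rw [thetaIntegral_eq_idealTheta hc, thetaIntegral_eq_idealTheta hc', hN', ← hN] at h
  have e1 : d ^ (-1 / finrank ℚ K : ℝ) * τ * N ^ (-(2 / finrank ℚ K : ℝ)) *
      N ^ (2 / finrank ℚ K : ℝ) = d ^ (-1 / finrank ℚ K : ℝ) * τ := by
    rw [mul_assoc, ← Real.rpow_add hNpos, neg_add_cancel, Real.rpow_zero, mul_one]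
  have e2 : (d ^ (-1 / finrank ℚ K : ℝ) * τ * N ^ (-(2 / finrank ℚ K : ℝ)))⁻¹ *
      (d⁻¹ * N⁻¹) ^ (2 / finrank ℚ K : ℝ) = d ^ (-1 / finrank ℚ K : ℝ) * τ⁻¹ := by
    rw [Real.mul_rpow (by positivity) (by positivity), Real.inv_rpow hd.le, Real.inv_rpow hNpos.le,
      Real.rpow_neg hNpos.le, neg_div, Real.rpow_neg hd.le]
    have h3 : d ^ (2 / finrank ℚ K : ℝ) =
        d ^ (1 / finrank ℚ K : ℝ) * d ^ (1 / finrank ℚ K : ℝ) := by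
      rw [← Real.rpow_add hd]
      congr 1
      ring
    have h4 : N ^ (2 / finrank ℚ K : ℝ) ≠ 0 := by positivity
    have h5 : d ^ (1 / finrank ℚ K : ℝ) ≠ 0 := by positivity
    rw [h3]
    field_simp
  have e3 : (√(d * N ^ 2 * (d ^ (-1 / finrank ℚ K : ℝ) * τ *
      N ^ (-(2 / finrank ℚ K : ℝ))) ^ finrank ℚ K))⁻¹ = τ ^ (-(finrank ℚ K / 2 : ℝ)) := by
    have h6 : (d ^ (-1 / finrank ℚ K : ℝ) * τ *
      N ^ (-(2 / finrank ℚ K : ℝ))) ^ finrank ℚ K = d⁻¹ * τ ^ (finrank ℚ K : ℝ) * (N ^ 2)⁻¹ := by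
      rw [mul_pow, mul_pow, ← Real.rpow_natCast (d ^ _), ← Real.rpow_natCast (N ^ _),
        ← Real.rpow_mul hd.le, ← Real.rpow_mul hNpos.le, div_mul_cancel₀ _ hn, ← neg_div,
        div_mul_cancel₀ _ hn, Real.rpow_neg_one, Real.rpow_neg hNpos.le, Real.rpow_natCast]
      rw [Real.rpow_two]
    rw [h6, show d * N ^ 2 * (d⁻¹ * τ ^ (finrank ℚ K : ℝ) * (N ^ 2)⁻¹) = τ ^ (finrank ℚ K : ℝ) by
      field_simp, Real.sqrt_eq_rpow, ← Real.rpow_mul hτ.le, Real.rpow_neg hτ.le]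
    congr 2
    ring
  rwa [e1, e2, e3] at h

/-- The sum of the theta functions over the ideal classes, with the sum over all ideals. -/
def totalTheta (K : Type*) [Field K] [NumberField K] (τ : ℝ) : ℝ≥0∞ :=
  ∑ c : ClassGroup (𝓞 K), idealTheta c (|(discr K : ℝ)| ^ (-1 / finrank ℚ K : ℝ) * τ)

/-- Inversion exchanges the theta functions of different classes; the map c ↦ c⁻¹[𝔡⁻¹]⁻¹, with 𝔡 the
different, permutes the classes, so the sum is self-dual. -/
theorem totalTheta_inversion {τ : ℝ} (hτ : 0 < τ) :
    totalTheta K τ = ENNReal.ofReal (τ ^ (-(finrank ℚ K / 2 : ℝ))) * totalTheta K τ⁻¹ := by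
  rw [totalTheta, Finset.sum_congr rfl fun c _ => idealTheta_inversion c hτ, ← Finset.mul_sum]
  congr 1
  exact Equiv.sum_comp ((Equiv.inv _).trans (Equiv.mulRight _)) fun c =>
    idealTheta c (|(discr K : ℝ)| ^ (-1 / finrank ℚ K : ℝ) * τ⁻¹)

/-- The sum over all nonzero ideals of the Gaussian integrals. -/
def idealSum (K : Type*) [Field K] [NumberField K] (τ : ℝ) : ℝ≥0∞ :=
  ∑' 𝔞 : (Ideal (𝓞 K))⁰, coneIntegral K (|(discr K : ℝ)| ^ (-1 / finrank ℚ K : ℝ) * τ *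
    (Ideal.absNorm (𝔞 : Ideal (𝓞 K)) : ℝ) ^ (2 / finrank ℚ K : ℝ))

theorem totalTheta_eq (τ : ℝ) : totalTheta K τ =
    classNumber K * volume (unitDomain K) + torsionOrder K * idealSum K τ := by
  simp only [totalTheta, idealTheta]
  rw [Finset.sum_add_distrib, Finset.sum_const, Finset.card_univ, nsmul_eq_mul, ← Finset.mul_sum]
  congr 2
  rw [idealSum, ← (Equiv.sigmaFiberEquiv fun 𝔞 : (Ideal (𝓞 K))⁰ => ClassGroup.mk0 𝔞).tsum_eq,
    ENNReal.tsum_sigma', tsum_fintype]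
  rfl

end TotalTheta

/-! ### The Dedekind zeta function as a sum over ideals -/

section IdealZeta

open NumberField NumberField.InfinitePlace NumberField.Units
open Module Real Set Asymptotics
open scoped nonZeroDivisors Topology Classical

variable {K : Type*} [Field K] [NumberField K]

theorem absNorm_pos_of_mem (𝔞 : (Ideal (𝓞 K))⁰) : 0 < Ideal.absNorm (𝔞 : Ideal (𝓞 K)) :=
  Nat.pos_of_ne_zero (Ideal.absNorm_ne_zero_of_nonZeroDivisors 𝔞)

theorem one_le_absNorm_of_mem (𝔞 : (Ideal (𝓞 K))⁰) :
    (1 : ℝ) ≤ Ideal.absNorm (𝔞 : Ideal (𝓞 K)) := by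
  exact_mod_cast absNorm_pos_of_mem 𝔞

theorem tendsto_sum_card_absNorm_eq_div :
    Tendsto (fun n : ℕ => (∑ k ∈ Finset.Icc 1 n,
      (Nat.card {I : Ideal (𝓞 K) // Ideal.absNorm I = k} : ℝ)) / n) atTop
      (𝓝 (dedekindZeta_residue K)) := by
  refine ((Ideal.tendsto_norm_le_div_atTop₀ K).comp tendsto_natCast_atTop_atTop).congr fun n => ?_
  simp only [Function.comp_apply, Nat.cast_le, ← Nat.cast_sum]
  congr
  -- The zero ideal, the only one of norm 0, accounts for the 1 between counting all ideals and
  -- counting the nonzero ones; it is matched by adjoining k = 0 to the range.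
  rw [← add_left_inj 1, ← Ideal.card_norm_le_eq_card_norm_le_add_one,
    show Finset.Icc 1 n = Finset.Ioc 0 n from Finset.Icc_succ_left_eq_Ioc _ _,
    show 1 = Nat.card {I : Ideal (𝓞 K) // Ideal.absNorm I = 0} by simp [Ideal.absNorm_eq_zero_iff],
    Finset.sum_Ioc_add_eq_sum_Icc (n.zero_le),
    ← Finset.card_preimage_eq_sum_card_image_eq
      (fun k _ => Ideal.finite_setOfPred_absNorm_eq k)]
  simp [Set.coe_eq_subtype]

/-- The number of nonzero ideals of norm at most n is O(n), and the coefficients are nonnegative. -/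
theorem LSeriesSummable_dedekindZeta {s : ℂ} (hs : 1 < s.re) :
    LSeriesSummable (fun n => (Nat.card {I : Ideal (𝓞 K) // Ideal.absNorm I = n} : ℂ)) s := by
  have h1 := tendsto_sum_card_absNorm_eq_div (K := K)
  have h2 : (fun n : ℕ => ∑ k ∈ Finset.Icc 1 n,
      (Nat.card {I : Ideal (𝓞 K) // Ideal.absNorm I = k} : ℝ)) =O[atTop]
        fun n => (n : ℝ) ^ (1 : ℝ) := by
    have h3 := (h1.isBigO_one ℝ).mul (isBigO_refl (fun n : ℕ => (n : ℝ)) atTop)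
    refine h3.congr' ?_ (Eventually.of_forall fun n => by simp)
    filter_upwards [eventually_ne_atTop 0] with n hn
    exact div_mul_cancel₀ _ (by exact_mod_cast hn)
  exact_mod_cast LSeriesSummable_of_sum_norm_bigO_and_nonneg h2 (fun _ => Nat.cast_nonneg _)
    zero_le_one hs

/-- The nonzero ideals, fibered over their norms. -/
def idealNormFiber (K : Type*) [Field K] [NumberField K] :
    (Σ n : ℕ, {𝔞 : (Ideal (𝓞 K))⁰ // Ideal.absNorm (𝔞 : Ideal (𝓞 K)) = n}) ≃ (Ideal (𝓞 K))⁰ :=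
  Equiv.sigmaFiberEquiv fun 𝔞 : (Ideal (𝓞 K))⁰ => Ideal.absNorm (𝔞 : Ideal (𝓞 K))

theorem finite_idealNormFiber (n : ℕ) :
    Finite {𝔞 : (Ideal (𝓞 K))⁰ // Ideal.absNorm (𝔞 : Ideal (𝓞 K)) = n} :=
  ((Ideal.finite_setOfPred_absNorm_le₀ (S := 𝓞 K) n).subset fun _ h => le_of_eq h).to_subtype

theorem countable_ideals : Countable (Ideal (𝓞 K))⁰ := by
  have := finite_idealNormFiber (K := K)
  exact (idealNormFiber K).symm.injective.countable

theorem card_idealNormFiber {n : ℕ} (hn : n ≠ 0) :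
    Nat.card {𝔞 : (Ideal (𝓞 K))⁰ // Ideal.absNorm (𝔞 : Ideal (𝓞 K)) = n} =
      Nat.card {I : Ideal (𝓞 K) // Ideal.absNorm I = n} := by
  refine Nat.card_congr
    { toFun := fun 𝔞 => ⟨𝔞.1, 𝔞.2⟩
      invFun := fun I => ⟨⟨I.1, mem_nonZeroDivisors_of_ne_zero ?_⟩, I.2⟩
      left_inv := fun _ => rfl
      right_inv := fun _ => rfl }
  intro h
  exact hn (I.2 ▸ h ▸ Ideal.absNorm_bot)

theorem tsum_idealNormFiber {E : Type*} [NormedField E] [CharZero E] (g : ℕ → E) {n : ℕ} (hn : n ≠ 0) :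
    ∑' 𝔞 : {𝔞 : (Ideal (𝓞 K))⁰ // Ideal.absNorm (𝔞 : Ideal (𝓞 K)) = n},
      g (Ideal.absNorm (𝔞.1 : Ideal (𝓞 K))) =
        Nat.card {I : Ideal (𝓞 K) // Ideal.absNorm I = n} * g n := by
  have := finite_idealNormFiber (K := K) n
  have := Fintype.ofFinite {𝔞 : (Ideal (𝓞 K))⁰ // Ideal.absNorm (𝔞 : Ideal (𝓞 K)) = n}
  rw [tsum_congr fun 𝔞 => congrArg g 𝔞.2, tsum_fintype, Finset.sum_const, Finset.card_univ,
    ← Nat.card_eq_fintype_card, card_idealNormFiber hn, nsmul_eq_mul]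

/-- The coefficient at 0 of the L-series counts the zero ideal, but the term there is 0 by
convention. The sum over nonzero ideals agrees, since none has norm 0. -/
theorem tsum_idealNormFiber_zero {E : Type*} [NormedField E] (g : ℕ → E) :
    ∑' 𝔞 : {𝔞 : (Ideal (𝓞 K))⁰ // Ideal.absNorm (𝔞 : Ideal (𝓞 K)) = 0},
      g (Ideal.absNorm (𝔞.1 : Ideal (𝓞 K))) = 0 := by
  have : IsEmpty {𝔞 : (Ideal (𝓞 K))⁰ // Ideal.absNorm (𝔞 : Ideal (𝓞 K)) = 0} :=
    ⟨fun 𝔞 => (absNorm_pos_of_mem 𝔞.1).ne' 𝔞.2⟩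
  exact tsum_empty

theorem summable_absNorm_rpow {x : ℝ} (hx : 1 < x) :
    Summable fun 𝔞 : (Ideal (𝓞 K))⁰ => (Ideal.absNorm (𝔞 : Ideal (𝓞 K)) : ℝ) ^ (-x) := by
  rw [← (idealNormFiber K).summable_iff]
  have hfin := finite_idealNormFiber (K := K)
  refine (summable_sigma_of_nonneg fun p => Real.rpow_nonneg (Nat.cast_nonneg _) _).2 ⟨fun n => Summable.of_finite, ?_⟩
  have h := (LSeriesSummable_dedekindZeta (K := K) (s := x) (by simpa)).norm
  refine h.congr fun n => ?_
  rcases eq_or_ne n 0 with rfl | hn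
  · rw [LSeries.term_zero, norm_zero]
    exact (tsum_idealNormFiber_zero (K := K) fun k => (k : ℝ) ^ (-x)).symm
  · rw [LSeries.term_of_ne_zero hn]
    refine Eq.trans ?_ (tsum_idealNormFiber (K := K) (fun k => (k : ℝ) ^ (-x)) hn).symm
    rw [norm_div, Complex.norm_natCast, Complex.norm_natCast_cpow_of_pos (Nat.pos_of_ne_zero hn),
      Complex.ofReal_re, Real.rpow_neg (Nat.cast_nonneg _), div_eq_mul_inv]

theorem hasSum_absNorm_cpow {s : ℂ} (hs : 1 < s.re) :
    HasSum (fun 𝔞 : (Ideal (𝓞 K))⁰ => 1 / (Ideal.absNorm (𝔞 : Ideal (𝓞 K)) : ℂ) ^ s)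
      (dedekindZeta K s) := by
  have h1 : Summable fun 𝔞 : (Ideal (𝓞 K))⁰ => 1 / (Ideal.absNorm (𝔞 : Ideal (𝓞 K)) : ℂ) ^ s := by
    refine Summable.of_norm ((summable_absNorm_rpow (K := K) hs).congr fun 𝔞 => ?_)
    rw [norm_div, norm_one, Complex.norm_natCast_cpow_of_pos (absNorm_pos_of_mem 𝔞), one_div,
      Real.rpow_neg (Nat.cast_nonneg _)]
  have h2 : ∑' 𝔞 : (Ideal (𝓞 K))⁰, 1 / (Ideal.absNorm (𝔞 : Ideal (𝓞 K)) : ℂ) ^ s =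
      dedekindZeta K s := by
    have h3 := (idealNormFiber K).summable_iff.2 h1
    rw [← (idealNormFiber K).tsum_eq]
    refine h3.tsum_sigma.trans ?_
    rw [dedekindZeta, LSeries]
    refine tsum_congr fun n => ?_
    rcases eq_or_ne n 0 with rfl | hn
    · rw [LSeries.term_zero]
      exact tsum_idealNormFiber_zero (K := K) fun k => 1 / (k : ℂ) ^ s
    · rw [LSeries.term_of_ne_zero hn]
      refine (tsum_idealNormFiber (K := K) (fun k => 1 / (k : ℂ) ^ s) hn).trans ?_
      rw [mul_one_div]
  exact h2 ▸ h1.hasSum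

/-- The ideals of bounded norm form an increasing exhausting sequence of finite sets, along which
the unconditional sum converges. -/
theorem tendsto_finsum_absNorm_cpow {s : ℂ} (hs : 1 < s.re) :
    Tendsto (fun M : ℕ => ∑ᶠ 𝔞 ∈ {𝔞 : Ideal (𝓞 K) | 𝔞 ≠ ⊥ ∧ Ideal.absNorm 𝔞 ≤ M},
      1 / (Ideal.absNorm 𝔞 : ℂ) ^ s) atTop (𝓝 (dedekindZeta K s)) := by
  let S : ℕ → Finset (Ideal (𝓞 K))⁰ := fun M =>
    (Ideal.finite_setOfPred_absNorm_le₀ (S := 𝓞 K) M).toFinset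
  have hS : Tendsto S atTop atTop := by
    refine tendsto_atTop_finset_of_monotone (fun M N h => ?_) fun 𝔞 =>
      ⟨Ideal.absNorm (𝔞 : Ideal (𝓞 K)), by simp [S]⟩
    intro 𝔞 h𝔞
    simp only [S, Finite.mem_toFinset, Set.mem_ofPred_eq] at h𝔞 ⊢
    exact h𝔞.trans h
  refine ((hasSum_absNorm_cpow (K := K) hs).comp hS).congr fun M => ?_
  have h1 : {𝔞 : Ideal (𝓞 K) | 𝔞 ≠ ⊥ ∧ Ideal.absNorm 𝔞 ≤ M} =
      ((S M).map (Function.Embedding.subtype _) : Finset (Ideal (𝓞 K))) := by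
    ext 𝔞
    simp only [S, Set.mem_ofPred_eq, Finset.coe_map, Set.mem_image, Finset.mem_coe,
      Finite.mem_toFinset, Function.Embedding.subtype_apply, Subtype.exists]
    constructor
    · rintro ⟨h0, h1⟩
      exact ⟨𝔞, mem_nonZeroDivisors_of_ne_zero h0, h1, rfl⟩
    · rintro ⟨𝔟, h0, h1, rfl⟩
      exact ⟨nonZeroDivisors.ne_zero h0, h1⟩
  rw [h1, finsum_mem_coe_finset, Finset.sum_map]
  rfl

end IdealZeta

/-! ### The theta function as a functional-equation pair, and its Mellin transform -/

section ZetaMellin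

open NumberField NumberField.InfinitePlace NumberField.Units NumberField.Units.dirichletUnitTheorem
open Module Real MeasureTheory Set Asymptotics
open scoped nonZeroDivisors ENNReal Topology Classical

/-- The n-th term of the exponential series at c N^(2/n) is cⁿN²/n!. The theta terms are thereby
dominated by N⁻², which is summable over the ideals. -/
theorem exp_neg_mul_rpow_le {c N : ℝ} {n : ℕ} (hc : 0 < c) (hn : n ≠ 0) (hN : 1 ≤ N) :
    rexp (-(c * N ^ (2 / n : ℝ))) ≤ n.factorial / c ^ n * N ^ (-2 : ℝ) := by
  have hN0 : 0 < N := zero_lt_one.trans_le hN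
  have hn' : (n : ℝ) ≠ 0 := by exact_mod_cast hn
  have h := Real.pow_div_factorial_le_exp (x := c * N ^ (2 / n : ℝ)) (by positivity) n
  have h2 : (c * N ^ (2 / n : ℝ)) ^ n = c ^ n * N ^ (2 : ℝ) := by
    rw [mul_pow, ← Real.rpow_natCast (N ^ _), ← Real.rpow_mul hN0.le, div_mul_cancel₀ _ hn']
  rw [h2] at h
  rw [Real.exp_neg, Real.rpow_neg hN0.le]
  calc (rexp (c * N ^ (2 / n : ℝ)))⁻¹ ≤ (c ^ n * N ^ (2 : ℝ) / n.factorial)⁻¹ :=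
        inv_anti₀ (by positivity) h
    _ = _ := by
        rw [inv_div]
        field_simp

variable {K : Type*} [Field K] [NumberField K]

/-- The scale of the theta function which makes the inversion formula symmetric. -/
def discrScale (K : Type*) [Field K] [NumberField K] : ℝ :=
  |(discr K : ℝ)| ^ (-1 / finrank ℚ K : ℝ)

theorem discrScale_pos : 0 < discrScale K :=
  Real.rpow_pos_of_pos (abs_pos.2 (by exact_mod_cast discr_ne_zero K)) _

/-- The scale of the term of an ideal in the theta function. -/
def idealScale (𝔞 : (Ideal (𝓞 K))⁰) : ℝ :=
  discrScale K * (Ideal.absNorm (𝔞 : Ideal (𝓞 K)) : ℝ) ^ (2 / finrank ℚ K : ℝ)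

theorem discrScale_le_idealScale (𝔞 : (Ideal (𝓞 K))⁰) : discrScale K ≤ idealScale 𝔞 :=
  le_mul_of_one_le_right discrScale_pos.le
    (Real.one_le_rpow (one_le_absNorm_of_mem 𝔞) (by positivity))

theorem idealScale_pos (𝔞 : (Ideal (𝓞 K))⁰) : 0 < idealScale 𝔞 :=
  discrScale_pos.trans_le (discrScale_le_idealScale 𝔞)

theorem idealSum_eq (t : ℝ) :
    idealSum K t = ∑' 𝔞 : (Ideal (𝓞 K))⁰, coneIntegral K (idealScale 𝔞 * t) := by
  refine tsum_congr fun 𝔞 => ?_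
  congr 1
  rw [idealScale, discrScale]
  ring

theorem idealSum_ne_top {t : ℝ} (ht : 0 < t) : idealSum K t ≠ ∞ := by
  set n := finrank ℚ K with hn
  have hn0 : n ≠ 0 := (finrank_pos (R := ℚ) (M := K)).ne'
  set a := discrScale K with ha
  have ha0 : 0 < a := discrScale_pos
  set c := π * n * (a * t) with hc
  have hc0 : 0 < c := by positivity
  -- Every term is compared with the one at the smallest scale, that of norm 1; the exponential
  -- decay supplies a summable factor.
  have h1 : ∀ 𝔞 : (Ideal (𝓞 K))⁰, coneIntegral K (idealScale 𝔞 * t) ≤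
      ENNReal.ofReal (rexp c * (n.factorial / c ^ n *
        (Ideal.absNorm (𝔞 : Ideal (𝓞 K)) : ℝ) ^ (-2 : ℝ))) * coneIntegral K (a * t) := fun 𝔞 => by
    refine (coneIntegral_le (mul_le_mul_of_nonneg_right (discrScale_le_idealScale 𝔞) ht.le)).trans ?_
    gcongr
    calc rexp (-π * n * (idealScale 𝔞 * t - a * t))
        = rexp c * rexp (-(c * (Ideal.absNorm (𝔞 : Ideal (𝓞 K)) : ℝ) ^ (2 / n : ℝ))) := by
          rw [← Real.exp_add, idealScale, hc]
          congr 1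
          ring
      _ ≤ _ := by
          gcongr
          exact exp_neg_mul_rpow_le hc0 hn0 (one_le_absNorm_of_mem 𝔞)
  rw [idealSum_eq]
  refine ne_top_of_le_ne_top ?_ (ENNReal.tsum_le_tsum h1)
  rw [ENNReal.tsum_mul_right]
  refine ENNReal.mul_ne_top ?_ (coneIntegral_ne_top (by positivity))
  exact (((summable_absNorm_rpow (K := K) (x := 2) (by norm_num)).mul_left _).mul_left
    _).tsum_ofReal_ne_top

theorem idealSum_le {t : ℝ} (ht : 1 ≤ t) : idealSum K t ≤
    ENNReal.ofReal (rexp (-(π * finrank ℚ K * discrScale K) * (t - 1))) * idealSum K 1 := by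
  rw [idealSum_eq, idealSum_eq, ← ENNReal.tsum_mul_left]
  refine ENNReal.tsum_le_tsum fun 𝔞 => ?_
  refine (coneIntegral_le (s := idealScale 𝔞 * 1)
    (mul_le_mul_of_nonneg_left ht (idealScale_pos 𝔞).le)).trans ?_
  gcongr ENNReal.ofReal (rexp ?_) * _
  have h1 : 0 ≤ π * finrank ℚ K * (t - 1) := mul_nonneg (by positivity) (sub_nonneg.2 ht)
  have h2 := mul_le_mul_of_nonneg_left (discrScale_le_idealScale 𝔞) h1
  linarith

theorem antitoneOn_idealSum : AntitoneOn (fun t => (idealSum K t).toReal) (Ioi 0) := by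
  intro s hs t _ h
  refine ENNReal.toReal_mono (idealSum_ne_top hs) ?_
  rw [idealSum_eq, idealSum_eq]
  exact ENNReal.tsum_le_tsum fun 𝔞 =>
    antitone_coneIntegral (mul_le_mul_of_nonneg_left h (idealScale_pos 𝔞).le)

theorem locallyIntegrableOn_idealSum :
    LocallyIntegrableOn (fun t => ((idealSum K t).toReal : ℂ)) (Ioi 0) := by
  rw [locallyIntegrableOn_iff isOpen_Ioi.isLocallyClosed]
  intro k hk hkc
  exact ((antitoneOn_idealSum.mono hk).integrableOn_isCompact hkc).ofReal

theorem isBigO_idealSum (r : ℝ) :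
    (fun t => ((idealSum K t).toReal : ℂ)) =O[atTop] (fun t : ℝ => t ^ r) := by
  set b := π * finrank ℚ K * discrScale K with hb
  have hb0 : 0 < b := mul_pos (mul_pos pi_pos (by exact_mod_cast finrank_pos)) discrScale_pos
  refine IsBigO.trans ?_ (isLittleO_exp_neg_mul_rpow_atTop hb0 r).isBigO
  refine IsBigO.of_bound (rexp b * (idealSum K 1).toReal) ?_
  filter_upwards [eventually_ge_atTop 1] with t ht
  have h := ENNReal.toReal_mono
    (ENNReal.mul_ne_top ENNReal.ofReal_ne_top (idealSum_ne_top (K := K) one_pos)) (idealSum_le ht)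
  rw [ENNReal.toReal_mul, ENNReal.toReal_ofReal (Real.exp_pos _).le] at h
  rw [Complex.norm_real, Real.norm_of_nonneg ENNReal.toReal_nonneg,
    Real.norm_of_nonneg (Real.exp_pos _).le]
  refine h.trans (le_of_eq ?_)
  rw [mul_right_comm (rexp b), ← Real.exp_add, hb]
  congr 2
  ring

/-- The constant term of the theta function. -/
def thetaConst (K : Type*) [Field K] [NumberField K] : ℝ :=
  classNumber K * (volume (unitDomain K)).toReal

theorem toReal_totalTheta {t : ℝ} (ht : 0 < t) : (totalTheta K t).toReal =
    thetaConst K + torsionOrder K * (idealSum K t).toReal := by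
  rw [totalTheta_eq, ENNReal.toReal_add, ENNReal.toReal_mul, ENNReal.toReal_mul,
    ENNReal.toReal_natCast, ENNReal.toReal_natCast, thetaConst]
  · exact ENNReal.mul_ne_top (ENNReal.natCast_ne_top _) volume_unitDomain_ne_top
  · exact ENNReal.mul_ne_top (ENNReal.natCast_ne_top _) (idealSum_ne_top ht)

/-- The theta function with its inversion formula. -/
def thetaPair (K : Type*) [Field K] [NumberField K] : WeakFEPair ℂ :=
  have hint : LocallyIntegrableOn (fun t => ((totalTheta K t).toReal : ℂ)) (Ioi 0) := by
    have h : LocallyIntegrableOn (fun t => (thetaConst K : ℂ) +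
        torsionOrder K * ((idealSum K t).toReal : ℂ)) (Ioi 0) := by
      refine (locallyIntegrableOn_const _).add ?_
      exact locallyIntegrableOn_idealSum.smul (torsionOrder K : ℂ)
    rw [locallyIntegrableOn_iff isOpen_Ioi.isLocallyClosed] at h ⊢
    intro k hk hkc
    refine (h k hk hkc).congr_fun (fun t ht => ?_) hkc.measurableSet
    simp only
    rw [toReal_totalTheta (hk ht)]
    push_cast
    rfl
  have htop : ∀ r : ℝ, (fun t => ((totalTheta K t).toReal : ℂ) - (thetaConst K : ℂ)) =O[atTop]
      (fun t : ℝ => t ^ r) := fun r => by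
    refine ((isBigO_idealSum (K := K) r).const_mul_left (torsionOrder K : ℂ)).congr' ?_ .rfl
    filter_upwards [eventually_gt_atTop 0] with t ht
    rw [toReal_totalTheta ht]
    push_cast
    ring
  { f := fun t => ((totalTheta K t).toReal : ℂ)
    g := fun t => ((totalTheta K t).toReal : ℂ)
    k := finrank ℚ K / 2
    ε := 1
    f₀ := thetaConst K
    g₀ := thetaConst K
    hf_int := hint
    hg_int := hint
    hk := by
      have : 0 < finrank ℚ K := finrank_pos
      positivity
    hε := one_ne_zero
    -- The inversion formula at 1/x reads θ(1/x) = x^(n/2) θ(x).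
    h_feq := fun x hx => by
      have hx' : 0 < x := hx
      have h := totalTheta_inversion (K := K) (τ := 1 / x) (by positivity)
      rw [h, ENNReal.toReal_mul, ENNReal.toReal_ofReal (by positivity), one_div, inv_inv,
        Real.inv_rpow hx'.le, Real.rpow_neg hx'.le, inv_inv, one_mul, smul_eq_mul,
        Complex.ofReal_mul]
    hf_top := htop
    hg_top := htop }

/-- For a nonnegative function the absolute Mellin integral at z is the Mellin transform at Re z.
This provides the summability needed for integrating term by term. -/
theorem mellin_norm_coneIntegral {b : ℝ} (hb : 0 < b) (z : ℂ) :
    ∫ t : ℝ in Ioi 0, ‖(t : ℂ) ^ (z - 1) • ((coneIntegral K (b * t)).toReal : ℂ)‖ =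
      b ^ (-z.re) * ‖mellin (fun t => ((coneIntegral K t).toReal : ℂ)) (z.re : ℂ)‖ := by
  have h := mellin_comp_mul_left (fun t => ((coneIntegral K t).toReal : ℂ)) (z.re : ℂ) hb
  have h1 : mellin (fun t => ((coneIntegral K (b * t)).toReal : ℂ)) (z.re : ℂ) =
      ((∫ t : ℝ in Ioi 0, ‖(t : ℂ) ^ (z - 1) • ((coneIntegral K (b * t)).toReal : ℂ)‖ : ℝ) : ℂ) := by
    rw [mellin, ← integral_complex_ofReal]
    refine setIntegral_congr_fun measurableSet_Ioi fun t ht => ?_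
    have ht' : 0 < t := ht
    rw [norm_smul, Complex.norm_cpow_eq_rpow_re_of_pos ht', Complex.norm_real,
      Real.norm_of_nonneg ENNReal.toReal_nonneg, Complex.ofReal_mul,
      Complex.ofReal_cpow ht'.le, smul_eq_mul]
    simp
  rw [h] at h1
  have h2 := congrArg norm h1
  rw [Complex.norm_real, Real.norm_of_nonneg (integral_nonneg fun _ => norm_nonneg _),
    norm_smul, Complex.norm_cpow_eq_rpow_re_of_pos hb] at h2
  rw [← h2]
  simp

theorem idealScale_rpow (𝔞 : (Ideal (𝓞 K))⁰) (x : ℝ) : idealScale 𝔞 ^ (-x) =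
    discrScale K ^ (-x) *
      (Ideal.absNorm (𝔞 : Ideal (𝓞 K)) : ℝ) ^ (-(2 * x / finrank ℚ K)) := by
  rw [idealScale, Real.mul_rpow discrScale_pos.le (by positivity),
    ← Real.rpow_mul (Nat.cast_nonneg _)]
  congr 2
  ring

/-- The exponent 2z/n of the norm is the variable of the zeta function, so z = ns/2. -/
theorem idealScale_cpow (𝔞 : (Ideal (𝓞 K))⁰) (z : ℂ) : (idealScale 𝔞 : ℂ) ^ (-z) =
    (discrScale K : ℂ) ^ (-z) *
      (1 / (Ideal.absNorm (𝔞 : Ideal (𝓞 K)) : ℂ) ^ (2 * z / finrank ℚ K)) := by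
  have hN : (0 : ℝ) < Ideal.absNorm (𝔞 : Ideal (𝓞 K)) := by exact_mod_cast absNorm_pos_of_mem 𝔞
  rw [idealScale, Complex.ofReal_mul, Complex.mul_cpow_ofReal_nonneg discrScale_pos.le (by positivity),
    ← Complex.ofReal_natCast, one_div, ← Complex.cpow_neg]
  congr 1
  rw [Complex.cpow_def_of_ne_zero
      (Complex.ofReal_ne_zero.2 (Real.rpow_pos_of_pos hN _).ne'),
    Complex.cpow_def_of_ne_zero (Complex.ofReal_ne_zero.2 hN.ne'), ← Complex.ofReal_log (by positivity), ← Complex.ofReal_log (by positivity), Real.log_rpow hN]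
  congr 1
  push_cast
  ring

/-- The Mellin transform of the sum over all ideals. -/
theorem mellin_idealSum {z : ℂ} (hz : finrank ℚ K / 2 < z.re) :
    mellin (fun t => ((idealSum K t).toReal : ℂ)) z =
      (discrScale K : ℂ) ^ (-z) * mellin (fun t => ((coneIntegral K t).toReal : ℂ)) z *
        dedekindZeta K (2 * z / finrank ℚ K) := by
  have hn : (0 : ℝ) < finrank ℚ K := by exact_mod_cast finrank_pos (R := ℚ) (M := K)
  have hz0 : 0 < z.re := lt_trans (by positivity) hz
  have hre : (2 * z / finrank ℚ K).re = 2 * z.re / finrank ℚ K := by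
    rw [show 2 * z / (finrank ℚ K : ℂ) = ((2 / finrank ℚ K : ℝ) : ℂ) * z by push_cast; ring,
      Complex.re_ofReal_mul]
    ring
  have h1x : 1 < 2 * z.re / finrank ℚ K := by
    rw [lt_div_iff₀ hn]
    linarith
  have := countable_ideals (K := K)
  have h1 : ∀ 𝔞 : (Ideal (𝓞 K))⁰, Integrable
      (fun t : ℝ => (t : ℂ) ^ (z - 1) • ((coneIntegral K (idealScale 𝔞 * t)).toReal : ℂ))
      (volume.restrict (Ioi 0)) := fun 𝔞 =>
    (MellinConvergent.comp_mul_left (idealScale_pos 𝔞)).2 (mellinConvergent_coneIntegral hz0)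
  have h2 : Summable fun 𝔞 : (Ideal (𝓞 K))⁰ => ∫ t : ℝ in Ioi 0,
      ‖(t : ℂ) ^ (z - 1) • ((coneIntegral K (idealScale 𝔞 * t)).toReal : ℂ)‖ := by
    simp only [fun 𝔞 : (Ideal (𝓞 K))⁰ =>
      mellin_norm_coneIntegral (K := K) (idealScale_pos 𝔞) z, idealScale_rpow]
    exact ((summable_absNorm_rpow (K := K) h1x).mul_left _).mul_right _
  have h3 := (hasSum_integral_of_summable_integral_norm h1 h2).tsum_eq
  have h4 : ∀ 𝔞 : (Ideal (𝓞 K))⁰, ∫ t : ℝ in Ioi 0,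
      (t : ℂ) ^ (z - 1) • ((coneIntegral K (idealScale 𝔞 * t)).toReal : ℂ) =
      (discrScale K : ℂ) ^ (-z) * mellin (fun t => ((coneIntegral K t).toReal : ℂ)) z *
        (1 / (Ideal.absNorm (𝔞 : Ideal (𝓞 K)) : ℂ) ^ (2 * z / finrank ℚ K)) := fun 𝔞 => by
    have h5 := mellin_comp_mul_left (fun t => ((coneIntegral K t).toReal : ℂ)) z (idealScale_pos 𝔞)
    rw [mellin] at h5
    rw [h5, smul_eq_mul, idealScale_cpow]
    ring
  simp only [h4] at h3
  rw [tsum_mul_left, (hasSum_absNorm_cpow (by rwa [hre])).tsum_eq] at h3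
  rw [h3, mellin]
  refine setIntegral_congr_fun measurableSet_Ioi fun t ht => ?_
  have ht' : 0 < t := ht
  simp only [smul_eq_mul]
  rw [tsum_mul_left, idealSum_eq, ENNReal.tsum_toReal_eq fun 𝔞 =>
    coneIntegral_ne_top (mul_pos (idealScale_pos 𝔞) ht'), Complex.ofReal_tsum]

/-- To the right of n/2, `Λ` is the Mellin transform of the theta function without its constant
term, that is, of `torsionOrder K` times the ideal sum. -/
theorem thetaPair_Λ {z : ℂ} (hz : finrank ℚ K / 2 < z.re) : (thetaPair K).Λ z =
    torsionOrder K * ((discrScale K : ℂ) ^ (-z) *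
      mellin (fun t => ((coneIntegral K t).toReal : ℂ)) z * dedekindZeta K (2 * z / finrank ℚ K)) := by
  rw [← mellin_idealSum hz, ← ((thetaPair K).hasMellin hz).2]
  have h := mellin_const_smul (fun t => ((idealSum K t).toReal : ℂ)) z (torsionOrder K : ℂ)
  rw [smul_eq_mul] at h
  rw [← h]
  refine setIntegral_congr_fun measurableSet_Ioi fun t ht => ?_
  have ht' : 0 < t := ht
  simp only [smul_eq_mul]
  congr 1
  change ((totalTheta K t).toReal : ℂ) - (thetaConst K : ℂ) = _
  rw [toReal_totalTheta ht']
  push_cast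
  ring

end ZetaMellin

/-! ### Continuation, residue and functional equation for a number field -/

section DedekindContinuation

open NumberField NumberField.InfinitePlace NumberField.Units NumberField.Units.dirichletUnitTheorem
open Module Real MeasureTheory Set
open scoped nonZeroDivisors Topology Classical

variable {K : Type*} [Field K] [NumberField K]

/-- The absolute value of the discriminant, as a real number. -/
def realAbsDiscr (K : Type*) [Field K] [NumberField K] : ℝ := |(discr K : ℝ)|

/-- The inverse of the gamma factor `|d|^{s/2} Γ_ℝ(s)^{r₁} Γ_ℂ(s)^{r₂}`. -/
def invGammaFactor (K : Type*) [Field K] [NumberField K] (s : ℂ) : ℂ :=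
  (realAbsDiscr K : ℂ) ^ (-s / 2) * (Complex.Gammaℝ s)⁻¹ ^ nrRealPlaces K *
    (Complex.Gammaℂ s)⁻¹ ^ nrComplexPlaces K

theorem realAbsDiscr_pos : 0 < realAbsDiscr K := abs_pos.2 (by exact_mod_cast discr_ne_zero K)

theorem differentiable_invGammaFactor : Differentiable ℂ (invGammaFactor K) := by
  have h : (realAbsDiscr K : ℂ) ≠ 0 := Complex.ofReal_ne_zero.2 realAbsDiscr_pos.ne'
  have h1 : Differentiable ℂ fun s : ℂ => (realAbsDiscr K : ℂ) ^ (-s / 2) := fun s =>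
    DifferentiableAt.const_cpow (by fun_prop) (Or.inl h)
  exact (h1.mul (Complex.differentiable_Gammaℝ_inv.pow _)).mul
    (Complex.differentiable_Gammaℂ_inv.pow _)

/-- Both inverse gamma functions vanish at 0 and there is at least one infinite place. This zero
cancels the pole of `Λ` at 0. -/
theorem invGammaFactor_zero : invGammaFactor K 0 = 0 := by
  have h1 : (Complex.Gammaℝ 0)⁻¹ = 0 := by
    rw [inv_eq_zero, Complex.Gammaℝ_eq_zero_iff]
    exact ⟨0, by simp⟩
  have h2 : (Complex.Gammaℂ 0)⁻¹ = 0 := by simp [Complex.Gammaℂ_def]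
  have h3 := card_add_two_mul_card_eq_rank K
  have h4 : 0 < finrank ℚ K := finrank_pos
  rw [invGammaFactor, h1, h2]
  by_cases hr : nrRealPlaces K = 0
  · have : nrComplexPlaces K ≠ 0 := by omega
    rw [zero_pow this, mul_zero]
  · rw [zero_pow hr, mul_zero, zero_mul]

theorem prod_places_eq_pow {M : Type*} [CommMonoid M] (f : ℕ → M) :
    ∏ w : InfinitePlace K, f (mult w) = f 1 ^ nrRealPlaces K * f 2 ^ nrComplexPlaces K := by
  rw [← Fintype.prod_subtype_mul_prod_subtype (fun w : InfinitePlace K => IsReal w)]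
  congr 1
  · rw [Finset.prod_congr rfl (g := fun _ => f 1) fun w _ => by rw [mult, if_pos w.2],
      Finset.prod_const, Finset.card_univ]
  · rw [Finset.prod_congr rfl (g := fun _ => f 2) fun w _ => by rw [mult, if_neg w.2],
      Finset.prod_const, Finset.card_univ]
    congr 1
    exact Fintype.card_congr (Equiv.subtypeEquivRight fun w => not_isReal_iff_isComplex)

/-- The constant relating the Mellin transform of the theta function to the zeta function. -/
def completedConst (K : Type*) [Field K] [NumberField K] : ℝ :=
  torsionOrder K * logCoordConst K / 2 ^ nrComplexPlaces K

theorem completedConst_pos : 0 < completedConst K := by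
  have h1 := torsionOrder_pos K
  have h2 := logCoordConst_pos (K := K)
  unfold completedConst
  positivity

/-- For z = ns/2 the exponent z n_w / n is s/2 at a real place and s at a complex one, producing
Γ_ℝ(s) and Γ_ℂ(s)/2. The halves account for the power of 2 in `completedConst`. -/
theorem thetaPair_Λ_eq {s : ℂ} (hs : 1 < s.re) :
    dedekindZeta K s = (completedConst K : ℂ)⁻¹ * invGammaFactor K s *
      (thetaPair K).Λ (finrank ℚ K * s / 2) := by
  have hn : (0 : ℝ) < finrank ℚ K := by exact_mod_cast finrank_pos (R := ℚ) (M := K)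
  have hnc : (finrank ℚ K : ℂ) ≠ 0 := by exact_mod_cast hn.ne'
  have hre : (finrank ℚ K * s / 2 : ℂ).re = finrank ℚ K * s.re / 2 := by
    rw [show (finrank ℚ K * s / 2 : ℂ) = ((finrank ℚ K / 2 : ℝ) : ℂ) * s by push_cast; ring,
      Complex.re_ofReal_mul]
    ring
  have hz : finrank ℚ K / 2 < (finrank ℚ K * s / 2 : ℂ).re := by
    rw [hre]
    have := mul_lt_mul_of_pos_left hs hn
    linarith
  have hz0 : 0 < (finrank ℚ K * s / 2 : ℂ).re := lt_trans (by positivity) hz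
  have hs0 : 0 < s.re := zero_lt_one.trans hs
  have hd : (realAbsDiscr K : ℂ) ≠ 0 := Complex.ofReal_ne_zero.2 realAbsDiscr_pos.ne'
  have hR : Complex.Gammaℝ s ≠ 0 := Complex.Gammaℝ_ne_zero_of_re_pos hs0
  have hC : Complex.Gammaℂ s ≠ 0 := by
    rw [Complex.Gammaℂ_def]
    refine mul_ne_zero (mul_ne_zero two_ne_zero ?_) (Complex.Gamma_ne_zero_of_re_pos hs0)
    rw [Complex.cpow_ne_zero_iff]
    exact Or.inl (by exact_mod_cast two_pi_pos.ne')
  have hcc : (completedConst K : ℂ) ≠ 0 := Complex.ofReal_ne_zero.2 completedConst_pos.ne'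
  have h1 : (1 / (π * (1 : ℕ) : ℝ) : ℂ) ^ (finrank ℚ K * s / 2 * (1 : ℕ) / finrank ℚ K) *
      Complex.Gamma (finrank ℚ K * s / 2 * (1 : ℕ) / finrank ℚ K) = Complex.Gammaℝ s := by
    rw [show (finrank ℚ K * s / 2 * (1 : ℕ) / finrank ℚ K : ℂ) = s / 2 by field_simp; simp,
      Complex.Gammaℝ_def, Nat.cast_one, mul_one, one_div, Complex.inv_cpow,
      neg_div, Complex.cpow_neg]
    · rw [Complex.arg_ofReal_of_nonneg pi_pos.le]
      exact pi_pos.ne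
  have h2 : (1 / (π * (2 : ℕ) : ℝ) : ℂ) ^ (finrank ℚ K * s / 2 * (2 : ℕ) / finrank ℚ K) *
      Complex.Gamma (finrank ℚ K * s / 2 * (2 : ℕ) / finrank ℚ K) = Complex.Gammaℂ s / 2 := by
    rw [show (finrank ℚ K * s / 2 * (2 : ℕ) / finrank ℚ K : ℂ) = s by field_simp; simp,
      Complex.Gammaℂ_def, one_div, Complex.cpow_neg, mul_comm π, Complex.inv_cpow]
    · push_cast
      ring
    · rw [Complex.arg_ofReal_of_nonneg (by positivity)]
      exact pi_pos.ne
  have h3 : (discrScale K : ℂ) ^ (-(finrank ℚ K * s / 2) : ℂ) =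
      ((realAbsDiscr K : ℂ) ^ (-s / 2))⁻¹ := by
    rw [discrScale, ← realAbsDiscr, Complex.cpow_def_of_ne_zero
      (Complex.ofReal_ne_zero.2 (Real.rpow_pos_of_pos realAbsDiscr_pos _).ne'),
      Complex.cpow_def_of_ne_zero hd, ← Complex.ofReal_log (Real.rpow_pos_of_pos realAbsDiscr_pos _).le,
      ← Complex.ofReal_log realAbsDiscr_pos.le, Real.log_rpow realAbsDiscr_pos, ← Complex.exp_neg]
    congr 1
    push_cast
    field_simp
  rw [thetaPair_Λ hz, mellin_coneIntegral hz0, prod_places_eq_pow fun m =>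
    (1 / (π * m : ℝ) : ℂ) ^ (finrank ℚ K * s / 2 * m / finrank ℚ K : ℂ) *
      Complex.Gamma (finrank ℚ K * s / 2 * m / finrank ℚ K), h1, h2, h3,
    show (2 * (finrank ℚ K * s / 2) / finrank ℚ K : ℂ) = s by field_simp, invGammaFactor]
  have h4 : (realAbsDiscr K : ℂ) ^ (-s / 2) ≠ 0 := by simp [hd]
  have h5 : (torsionOrder K : ℂ) ≠ 0 := by exact_mod_cast (torsionOrder_pos K).ne'
  have h6 : (logCoordConst K : ℂ) ≠ 0 := Complex.ofReal_ne_zero.2 logCoordConst_pos.ne'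
  rw [completedConst]
  push_cast
  rw [div_pow, inv_pow, inv_pow]
  generalize (realAbsDiscr K : ℂ) ^ (-s / 2) = D at h4 ⊢
  field_simp

/-- The factor of the functional equation. -/
def dedekindFactor (K : Type*) [Field K] [NumberField K] (s : ℂ) : ℂ :=
  2 ^ finrank ℚ K * (2 * π : ℂ) ^ (-(finrank ℚ K * s)) *
    ((|discr K| : ℤ) : ℂ) ^ (s - 1 / 2) *
    Complex.cos (π / 2 * s) ^ (nrRealPlaces K + nrComplexPlaces K) *
    Complex.sin (π / 2 * s) ^ nrComplexPlaces K * Complex.Gamma s ^ finrank ℚ K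

/-- The reflection formula with the double angle formula for the sine. Keeping Γ_ℂ(s)² apart matches
the one Γ_ℂ(s) arising from each real place, so that the total exponent r₁ + 2r₂ is the degree. -/
theorem inv_Gammaℂ_one_sub {s : ℂ} (hs : ∀ m : ℕ, s ≠ -m) :
    (Complex.Gammaℂ (1 - s))⁻¹ = Complex.Gammaℂ s ^ 2 * Complex.cos (π / 2 * s) *
      Complex.sin (π / 2 * s) * (Complex.Gammaℂ s)⁻¹ := by
  have hG : Complex.Gamma s ≠ 0 := Complex.Gamma_ne_zero hs
  have h2pi : (2 * π : ℂ) ≠ 0 := by exact_mod_cast two_pi_pos.ne'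
  have hpow : ∀ z : ℂ, (2 * π : ℂ) ^ z ≠ 0 := fun z => by
    simp [pi_ne_zero]
  have hC : Complex.Gammaℂ s ≠ 0 := by
    rw [Complex.Gammaℂ_def]
    exact mul_ne_zero (mul_ne_zero two_ne_zero (hpow _)) hG
  have h1 : Complex.sin (π * s) = 2 * Complex.sin (π / 2 * s) * Complex.cos (π / 2 * s) := by
    rw [← Complex.sin_two_mul]
    congr 1
    ring
  have h2 := Complex.Gamma_mul_Gamma_one_sub s
  have h3 : (Complex.Gamma (1 - s))⁻¹ = Complex.Gamma s * Complex.sin (π * s) / π := by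
    have h4 : Complex.Gamma (1 - s) = π / Complex.sin (π * s) / Complex.Gamma s := by
      rw [← h2, mul_div_cancel_left₀ _ hG]
    rw [h4, inv_div, div_div_eq_mul_div]
  rw [show Complex.Gammaℂ s ^ 2 * Complex.cos (π / 2 * s) *
      Complex.sin (π / 2 * s) * (Complex.Gammaℂ s)⁻¹ = Complex.Gammaℂ s * Complex.cos (π / 2 * s) *
      Complex.sin (π / 2 * s) by field_simp, Complex.Gammaℂ_def, Complex.Gammaℂ_def, mul_inv, h3, h1,
    mul_inv, neg_sub, Complex.cpow_sub _ _ h2pi, Complex.cpow_one, Complex.cpow_neg]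
  have := hpow s
  have hpi : (π : ℂ) ≠ 0 := by exact_mod_cast pi_ne_zero
  field_simp

theorem invGammaFactor_one_sub {s : ℂ} (hs : ∀ m : ℕ, s ≠ -m) :
    invGammaFactor K (1 - s) = dedekindFactor K s * invGammaFactor K s := by
  have hd : (realAbsDiscr K : ℂ) ≠ 0 := Complex.ofReal_ne_zero.2 realAbsDiscr_pos.ne'
  have hd' : (((|discr K| : ℤ) : ℂ)) = (realAbsDiscr K : ℂ) := by
    rw [realAbsDiscr, ← Int.cast_abs, Complex.ofReal_intCast]
  have hn := card_add_two_mul_card_eq_rank K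
  have h2pi : (2 * π : ℂ) ≠ 0 := by exact_mod_cast two_pi_pos.ne'
  have hG : ∀ m : ℕ, Complex.Gammaℂ s ^ m =
      2 ^ m * (2 * π : ℂ) ^ (-(m * s)) * Complex.Gamma s ^ m := fun m => by
    rw [Complex.Gammaℂ_def, mul_pow, mul_pow, ← Complex.cpow_nat_mul]
    congr 3
    ring
  have hdd : (realAbsDiscr K : ℂ) ^ (-(1 - s) / 2) =
      (realAbsDiscr K : ℂ) ^ (s - 1 / 2) * (realAbsDiscr K : ℂ) ^ (-s / 2) := by
    rw [← Complex.cpow_add _ _ hd]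
    congr 1
    ring
  have hA : dedekindFactor K s = (realAbsDiscr K : ℂ) ^ (s - 1 / 2) *
      Complex.Gammaℂ s ^ (nrRealPlaces K + 2 * nrComplexPlaces K) *
      Complex.cos (π / 2 * s) ^ (nrRealPlaces K + nrComplexPlaces K) *
      Complex.sin (π / 2 * s) ^ nrComplexPlaces K := by
    rw [hn, hG, dedekindFactor, hd']
    ring
  rw [hA, invGammaFactor, invGammaFactor, inv_Gammaℂ_one_sub hs, Complex.inv_Gammaℝ_one_sub hs, hdd,
    show π * s / 2 = π / 2 * s by ring, pow_add, pow_mul, pow_add]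
  simp only [mul_pow]
  ring

/-- The entire part of the Dedekind zeta function. -/
def dedekindEntire (K : Type*) [Field K] [NumberField K] (s : ℂ) : ℂ :=
  (completedConst K : ℂ)⁻¹ * (invGammaFactor K s * (thetaPair K).Λ₀ (finrank ℚ K * s / 2) -
    thetaConst K * (2 / finrank ℚ K) * dslope (invGammaFactor K) 0 s +
    thetaConst K * (2 / finrank ℚ K) * dslope (invGammaFactor K) 1 s)

theorem differentiable_dslope {f : ℂ → ℂ} (hf : Differentiable ℂ f) (a : ℂ) :
    Differentiable ℂ (dslope f a) := by
  rw [← differentiableOn_univ] at hf ⊢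
  exact (Complex.differentiableOn_dslope univ_mem).2 hf

theorem differentiable_dedekindEntire : Differentiable ℂ (dedekindEntire K) := by
  have h1 := differentiable_invGammaFactor (K := K)
  have h2 := differentiable_dslope h1 0
  have h3 := differentiable_dslope h1 1
  have h4 : Differentiable ℂ fun s : ℂ => (thetaPair K).Λ₀ (finrank ℚ K * s / 2) :=
    (thetaPair K).differentiable_Λ₀.comp (by fun_prop)
  unfold dedekindEntire
  fun_prop

/-- The continued Dedekind zeta function, for an unspecified residue. -/
theorem continuation_eq {s : ℂ} (hs0 : s ≠ 0) (hs1 : s ≠ 1) :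
    (completedConst K : ℂ)⁻¹ * invGammaFactor K s * (thetaPair K).Λ (finrank ℚ K * s / 2) =
      (completedConst K : ℂ)⁻¹ * (thetaConst K * (2 / finrank ℚ K) * invGammaFactor K 1) / (s - 1) +
        dedekindEntire K s := by
  have hn : (finrank ℚ K : ℂ) ≠ 0 := by exact_mod_cast (finrank_pos (R := ℚ) (M := K)).ne'
  have hs1' : s - 1 ≠ 0 := sub_ne_zero.2 hs1
  have hs1'' : 1 - s ≠ 0 := sub_ne_zero.2 hs1.symm
  -- The poles of `Λ` at z = 0 and z = n/2 become s = 0 and s = 1, and the change of variable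
  -- contributes the factor 2/n.
  have hΛ : (thetaPair K).Λ (finrank ℚ K * s / 2) = (thetaPair K).Λ₀ (finrank ℚ K * s / 2) -
      thetaConst K * (2 / finrank ℚ K) / s + thetaConst K * (2 / finrank ℚ K) / (s - 1) := by
    change (thetaPair K).Λ₀ (finrank ℚ K * s / 2) - (1 / (finrank ℚ K * s / 2 : ℂ)) • (thetaConst K : ℂ) -
      (1 / (((finrank ℚ K / 2 : ℝ) : ℂ) - finrank ℚ K * s / 2)) • (thetaConst K : ℂ) = _
    rw [show ((finrank ℚ K / 2 : ℝ) : ℂ) - finrank ℚ K * s / 2 = -(finrank ℚ K * (s - 1) / 2) by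
      push_cast; ring, smul_eq_mul, smul_eq_mul]
    field_simp
    ring
  -- The inverse gamma factor vanishes at 0, so its quotient by s is its slope at 0. Its quotient by
  -- s - 1 is its slope at 1 plus the polar term.
  rw [hΛ, dedekindEntire, dslope_of_ne _ hs0, dslope_of_ne _ hs1, slope_def_field, slope_def_field,
    invGammaFactor_zero]
  field_simp
  ring

/-- As s tends to 1 from the right along the reals, (s - 1)ζ(s) tends to ρ by the continuation and
to the residue of the class number formula. This evaluates ρ without knowing `logCoordConst` or the
volume of the unit domain. -/
theorem dedekindZeta_eq {s : ℂ} (hs : 1 < s.re) :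
    dedekindZeta K s = (dedekindZeta_residue K : ℂ) / (s - 1) + dedekindEntire K s ∧
    (completedConst K : ℂ)⁻¹ * (thetaConst K * (2 / finrank ℚ K) * invGammaFactor K 1) =
      dedekindZeta_residue K := by
  set ρ := (completedConst K : ℂ)⁻¹ * (thetaConst K * (2 / finrank ℚ K) * invGammaFactor K 1) with hρ
  have h1 : ∀ s : ℂ, 1 < s.re → dedekindZeta K s = ρ / (s - 1) + dedekindEntire K s := fun s hs => by
    rw [thetaPair_Λ_eq hs, continuation_eq]
    · rintro rfl
      norm_num at hs
    · rintro rfl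
      norm_num at hs
  have h2 : ρ = dedekindZeta_residue K := by
    have h3 : Tendsto (fun x : ℝ => ((x : ℂ) - 1) * dedekindZeta K x) (𝓝[>] 1)
        (𝓝 (ρ + (((1 : ℝ) : ℂ) - 1) * dedekindEntire K ((1 : ℝ) : ℂ))) := by
      have h4 : Continuous fun x : ℝ => ρ + ((x : ℂ) - 1) * dedekindEntire K (x : ℂ) := by
        have := (differentiable_dedekindEntire (K := K)).continuous
        fun_prop
      refine (h4.tendsto 1).mono_left nhdsWithin_le_nhds |>.congr' ?_
      filter_upwards [self_mem_nhdsWithin] with x hx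
      have hx' : (1 : ℝ) < x := hx
      rw [h1 x (by simpa using hx'), mul_add, mul_div_cancel₀]
      exact sub_ne_zero.2 (by exact_mod_cast hx'.ne')
    have h5 := tendsto_nhds_unique h3 (tendsto_sub_one_mul_dedekindZeta_nhdsGT K)
    simpa using h5
  exact ⟨h2 ▸ h1 s hs, h2⟩

/-- `Λ` is symmetric under s ↦ 1 - s, so only the two inverse gamma factors differ. The excluded
points s = -m are the poles of Γ(s). -/
theorem dedekindContinuation_one_sub {s : ℂ} (hs1 : s ≠ 1) (hs : ∀ m : ℕ, s ≠ -m) :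
    (dedekindZeta_residue K : ℂ) / (1 - s - 1) + dedekindEntire K (1 - s) =
      dedekindFactor K s * ((dedekindZeta_residue K : ℂ) / (s - 1) + dedekindEntire K s) := by
  have hs0 : s ≠ 0 := by simpa using hs 0
  -- The residue identity does not involve s; any point with real part above 1 serves.
  have hρ := (dedekindZeta_eq (K := K) (s := 2) (by norm_num)).2
  rw [← hρ, ← continuation_eq hs0 hs1, ← continuation_eq (sub_ne_zero.2 hs1.symm) (by simpa using hs0),
    invGammaFactor_one_sub hs]
  have h := (thetaPair K).functional_equation (finrank ℚ K * s / 2)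
  have h1 : ((thetaPair K).k : ℂ) - finrank ℚ K * s / 2 = finrank ℚ K * (1 - s) / 2 := by
    change (((finrank ℚ K / 2 : ℝ)) : ℂ) - _ = _
    push_cast
    ring
  have h2 : (thetaPair K).symm.Λ (finrank ℚ K * s / 2) = (thetaPair K).Λ (finrank ℚ K * s / 2) := by
    -- The pair is its own dual, having f = g and ε = 1.
    have h3 : (thetaPair K).symm = thetaPair K := by
      simp [WeakFEPair.symm, thetaPair]
    rw [h3]
  rw [h1, h2] at h
  rw [h, show (thetaPair K).ε = 1 from rfl, one_smul]
  ring

end DedekindContinuation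

/-! ### Transfer to germs along the ultrafilter -/

section Transfer

variable {I : Type*} {F : Ultrafilter I}

theorem HasDerivAt.exists_delta {f : ℂ → ℂ} {c z : ℂ} (h : HasDerivAt f c z) {ε : ℝ} (hε : 0 < ε) :
    ∃ δ : ℝ, 0 < δ ∧ ∀ t : ℂ, t ≠ 0 → ‖t‖ < δ → ‖(f (z + t) - f z) / t - c‖ < ε := by
  rw [hasDerivAt_iff_tendsto_slope_zero, Metric.tendsto_nhdsWithin_nhds] at h
  obtain ⟨δ, hδ, h⟩ := h ε hε
  refine ⟨δ, hδ, fun t ht htδ => ?_⟩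
  have h1 := h (x := t) ht (by rwa [dist_zero_right])
  rwa [dist_eq_norm, smul_eq_mul, inv_mul_eq_div] at h1

/-- The internal δ is the germ of radii chosen separately in each coordinate. -/
theorem hasQDeriv_coe {f : I → ℂ → ℂ} {c z : I → ℂ}
    (h : ∀ᶠ i in (F : Filter I), HasDerivAt (f i) (c i) (z i)) :
    HasQDeriv (f : Hyper F (ℂ → ℂ)) (c : Hyper F ℂ) (z : Hyper F ℂ) := by
  intro ε hε
  induction ε using Germ.inductionOn with | _ ε =>
  have hε' : ∀ᶠ i in (F : Filter I), 0 < ε i := Germ.coe_lt.1 hε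
  have hex : ∀ i, ∃ δ : ℝ, 0 < δ ∧ (HasDerivAt (f i) (c i) (z i) → 0 < ε i →
      ∀ t : ℂ, t ≠ 0 → ‖t‖ < δ → ‖(f i (z i + t) - f i (z i)) / t - c i‖ < ε i) := by
    intro i
    by_cases hi : HasDerivAt (f i) (c i) (z i) ∧ 0 < ε i
    · obtain ⟨δ, hδ, hd⟩ := hi.1.exists_delta hi.2
      exact ⟨δ, hδ, fun _ _ => hd⟩
    -- Outside the large set of good coordinates any positive radius does.
    · exact ⟨1, one_pos, fun h1 h2 => absurd ⟨h1, h2⟩ hi⟩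
  choose δ hδ hd using hex
  refine ⟨(δ : Hyper F ℝ), Germ.coe_lt.2 (Eventually.of_forall hδ), fun t ht htδ => ?_⟩
  induction t using Germ.inductionOn with | _ t =>
  have ht' : ∀ᶠ i in (F : Filter I), t i ≠ 0 :=
    Ultrafilter.eventually_not.2 fun h => ht (Germ.coe_eq.2 h)
  have htδ' : ∀ᶠ i in (F : Filter I), ‖t i‖ < δ i := Germ.coe_lt.1 htδ
  refine Germ.coe_lt.2 ?_
  filter_upwards [h, hε', ht', htδ'] with i h1 h2 h3 h4
  exact hd i h1 h2 (t i) h3 h4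

theorem differentiableOn_iterate_deriv {f : ℂ → ℂ} {U : Set ℂ} (hU : IsOpen U)
    (hf : DifferentiableOn ℂ f U) (k : ℕ) : DifferentiableOn ℂ (deriv^[k] f) U := by
  induction k with
  | zero => exact hf
  | succ k ih =>
    rw [Function.iterate_succ_apply']
    exact ih.deriv hU

/-- The germ of a family of functions analytic on open sets is Q-analytic. -/
theorem qAnalyticOn_coe {f : I → ℂ → ℂ} {U : I → Set ℂ} (hU : ∀ i, IsOpen (U i))
    (hf : ∀ i, DifferentiableOn ℂ (f i) (U i)) {B : Set (Hyper F ℂ)}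
    (hB : ∀ z : I → ℂ, (z : Hyper F ℂ) ∈ B → ∀ᶠ i in (F : Filter I), z i ∈ U i) :
    QAnalyticOn (f : Hyper F (ℂ → ℂ)) B := by
  -- A hypernatural order is a family of orders varying with the coordinate, so the germ of the
  -- whole derivative sequences is needed.
  refine ⟨((fun i k => deriv^[k] (f i) : I → ℕ → ℂ → ℂ) : Hyper F (ℕ → ℂ → ℂ)), rfl,
    fun k z hz => ?_⟩
  induction k using Germ.inductionOn with | _ k =>
  induction z using Germ.inductionOn with | _ z =>
  refine hasQDeriv_coe (f := fun i => deriv^[k i] (f i))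
    (c := fun i => deriv^[k i + 1] (f i) (z i)) ?_
  filter_upwards [hB z hz] with i hi
  rw [Function.iterate_succ_apply']
  exact ((differentiableOn_iterate_deriv (hU i) (hf i) (k i)).differentiableAt ((hU i).mem_nhds hi)).hasDerivAt

/-- The germ of a family of convergent sequences is Q-convergent. -/
theorem hasQLimit_coe {u : I → ℕ → ℂ} {S : I → ℂ}
    (h : ∀ᶠ i in (F : Filter I), Tendsto (u i) atTop (nhds (S i))) :
    HasQLimit (fun M => happ (u : Hyper F (ℕ → ℂ)) M) (S : Hyper F ℂ) := by
  intro ε hε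
  induction ε using Germ.inductionOn with | _ ε =>
  have hε' : ∀ᶠ i in (F : Filter I), 0 < ε i := Germ.coe_lt.1 hε
  have hex : ∀ i, ∃ N : ℕ, Tendsto (u i) atTop (nhds (S i)) → 0 < ε i →
      ∀ m, N ≤ m → ‖u i m - S i‖ < ε i := by
    intro i
    by_cases hi : Tendsto (u i) atTop (nhds (S i)) ∧ 0 < ε i
    · obtain ⟨N, hN⟩ := Metric.tendsto_atTop.1 hi.1 _ hi.2
      exact ⟨N, fun _ _ m hm => dist_eq_norm (u i m) (S i) ▸ hN m hm⟩
    · exact ⟨0, fun h1 h2 => absurd ⟨h1, h2⟩ hi⟩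
  choose N hN using hex
  refine ⟨(N : Hyper F ℕ), fun m hm => ?_⟩
  induction m using Germ.inductionOn with | _ m =>
  have hm' : ∀ᶠ i in (F : Filter I), N i ≤ m i := Germ.coe_le.1 hm
  refine Germ.coe_lt.2 ?_
  filter_upwards [h, hε', hm'] with i h1 h2 h3
  exact hN i h1 h2 (m i) h3

theorem mem_span_image_range_iff (w : ℕ → ℂ) (N : ℕ) (z : ℂ) :
    z ∈ Submodule.span ℚ (Set.range fun j : Fin N => w j) ↔
      ∃ a : ℕ → ℚ, z = ∑ j ∈ Finset.range N, (a j : ℂ) * w j := by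
  rw [Submodule.mem_span_range_iff_exists_fun]
  constructor
  · rintro ⟨a, rfl⟩
    refine ⟨fun j => if hj : j < N then a ⟨j, hj⟩ else 0, ?_⟩
    rw [Finset.sum_range]
    refine Finset.sum_congr rfl fun j _ => ?_
    simp only [j.2, dif_pos, Algebra.smul_def]
    rfl
  · rintro ⟨a, rfl⟩
    refine ⟨fun j => a j, ?_⟩
    rw [Finset.sum_range]
    refine Finset.sum_congr rfl fun j _ => ?_
    rw [Algebra.smul_def]
    rfl

/-- The hyper degree is the germ of the degrees. -/
theorem HasHyperDegree.eventually_eq_finrank {K : Subfield (Hyper F ℂ)} {N : I → ℕ}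
    (hn : HasHyperDegree K (N : Hyper F ℕ)) {k : I → NumberSubfield}
    (hk : ∀ x : I → ℂ, (x : Hyper F ℂ) ∈ K ↔ ∀ᶠ i in (F : Filter I), x i ∈ (k i).1) :
    ∀ᶠ i in (F : Filter I), N i = Module.finrank ℚ (k i).1 := by
  obtain ⟨ω, hω, hind⟩ := hn
  induction ω using Germ.inductionOn with | _ w =>
  have hcomb_coe : ∀ a : I → ℕ → ℚ, hcomb (N : Hyper F ℕ) (a : Hyper F (ℕ → ℚ))
      (w : Hyper F (ℕ → ℂ)) =
        ((fun i => ∑ j ∈ Finset.range (N i), (a i j : ℂ) * w i j : I → ℂ) : Hyper F ℂ) :=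
    fun a => rfl
  let V : I → Submodule ℚ ℂ := fun i => Submodule.span ℚ (Set.range fun j : Fin (N i) => w i j)
  have hV : ∀ x : I → ℂ, (x : Hyper F ℂ) ∈ K ↔ ∀ᶠ i in (F : Filter I), x i ∈ V i := by
    intro x
    rw [hω]
    constructor
    · rintro ⟨a, ha⟩
      induction a using Germ.inductionOn with | _ a =>
      rw [hcomb_coe] at ha
      filter_upwards [Germ.coe_eq.1 ha] with i hi
      exact (mem_span_image_range_iff _ _ _).2 ⟨a i, hi⟩
    · intro h
      have hex : ∀ i, ∃ a : ℕ → ℚ, x i ∈ V i →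
          x i = ∑ j ∈ Finset.range (N i), (a j : ℂ) * w i j := by
        intro i
        by_cases hi : x i ∈ V i
        · obtain ⟨a, ha⟩ := (mem_span_image_range_iff _ _ _).1 hi
          exact ⟨a, fun _ => ha⟩
        · exact ⟨0, fun h => absurd h hi⟩
      choose a ha using hex
      refine ⟨(a : Hyper F (ℕ → ℚ)), ?_⟩
      rw [hcomb_coe]
      refine Germ.coe_eq.2 ?_
      filter_upwards [h] with i hi
      exact ha i hi
  -- Two families of sets defining the same internal set agree on a large set of coordinates: chosen
  -- counterexamples would otherwise form an element of one internal set outside the other.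
  have h1 : ∀ᶠ i in (F : Filter I), ∀ x y : ℂ, x ∈ V i → x ∈ (k i).1 :=
    eventually_forall_of_choice (P := fun i x _ => x ∈ V i) (Q := fun i x _ => x ∈ (k i).1)
      (fun i => (V i).zero_mem) fun x _ hx => (hk x).1 ((hV x).2 (Eventually.of_forall hx))
  have h2 : ∀ᶠ i in (F : Filter I), ∀ x y : ℂ, x ∈ (k i).1 → x ∈ V i :=
    eventually_forall_of_choice (P := fun i x _ => x ∈ (k i).1) (Q := fun i x _ => x ∈ V i)
      (fun i => (k i).1.zero_mem) fun x _ hx => (hV x).1 ((hk x).2 (Eventually.of_forall hx))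
  have h3 : ∀ᶠ i in (F : Filter I), LinearIndependent ℚ fun j : Fin (N i) => w i j := by
    -- A coordinate where independence fails supplies a relation a and an index j with nonzero
    -- coefficient; elsewhere both are 0. If failure occurred on a large set, the germs of a and j
    -- would contradict internal independence.
    have hex : ∀ i, ∃ (a : ℕ → ℚ) (j : ℕ), ∑ l ∈ Finset.range (N i), (a l : ℂ) * w i l = 0 ∧
        ((j < N i → a j = 0) → LinearIndependent ℚ fun j : Fin (N i) => w i j) := by
      intro i
      by_cases hi : LinearIndependent ℚ fun j : Fin (N i) => w i j
      · exact ⟨0, 0, by simp, fun _ => hi⟩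
      · have hi' := hi
        rw [Fintype.linearIndependent_iff] at hi'
        push Not at hi'
        obtain ⟨a, ha, j, hj⟩ := hi'
        refine ⟨fun l => if hl : l < N i then a ⟨l, hl⟩ else 0, j, ?_, fun h => ?_⟩
        · rw [← ha, Finset.sum_range]
          refine Finset.sum_congr rfl fun l _ => ?_
          simp only [l.2, dif_pos, Algebra.smul_def]
          rfl
        · exact absurd (by simpa using h j.2) hj
    choose a j ha hj using hex
    have h4 := hind (a : Hyper F (ℕ → ℚ)) (by
      rw [hcomb_coe]
      exact Germ.coe_eq.2 (Eventually.of_forall ha))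
    by_contra hcon
    have hcon' : ∀ᶠ i in (F : Filter I), ¬ LinearIndependent ℚ fun j : Fin (N i) => w i j :=
      Ultrafilter.eventually_not.2 hcon
    have h5 : ∀ᶠ i in (F : Filter I), j i < N i ∧ a i (j i) ≠ 0 := by
      filter_upwards [hcon'] with i hi
      by_contra h6
      push Not at h6
      exact hi (hj i h6)
    have h7 : ∀ᶠ i in (F : Filter I), a i (j i) = 0 :=
      Germ.coe_eq.1 (h4 (j : Hyper F ℕ) (Germ.coe_lt.2 (h5.mono fun i hi => hi.1)))
    obtain ⟨i, hi5, hi7⟩ := (h5.and h7).exists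
    exact hi5.2 hi7
  filter_upwards [h1, h2, h3] with i a1 a2 a3
  have h4 : Subalgebra.toSubmodule (k i).1.toSubalgebra = V i :=
    Submodule.ext fun x => ⟨a2 x 0, a1 x 0⟩
  have h5 : Module.finrank ℚ (Subalgebra.toSubmodule (k i).1.toSubalgebra) = N i := by
    rw [h4, finrank_span_eq_card a3, Fintype.card_fin]
  exact h5.symm

/-- The continuation of the Dedekind zeta function of a number field. -/
def dedekindContinuation (k : NumberSubfield) (s : ℂ) : ℂ :=
  (NumberField.dedekindZeta_residue k.1 : ℂ) / (s - 1) + dedekindEntire k.1 s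

theorem tendsto_partialDedekindZeta (k : NumberSubfield) {s : ℂ} (hs : 1 < s.re) :
    Tendsto (fun M => partialDedekindZeta k M s) atTop (nhds (dedekindContinuation k s)) := by
  rw [dedekindContinuation, ← (dedekindZeta_eq hs).1]
  exact tendsto_finsum_absNorm_cpow hs

theorem differentiableOn_dedekindContinuation (k : NumberSubfield) :
    DifferentiableOn ℂ (dedekindContinuation k) {1}ᶜ := by
  intro s hs
  have hs' : s - 1 ≠ 0 := sub_ne_zero.2 hs
  have h := (differentiable_dedekindEntire (K := k.1)) s
  refine DifferentiableAt.differentiableWithinAt ?_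
  have h1 : DifferentiableAt ℂ
      (fun z : ℂ => (NumberField.dedekindZeta_residue k.1 : ℂ) / (z - 1)) s :=
    (differentiableAt_const _).div (differentiableAt_id.sub_const 1) hs'
  exact h1.add h

/-- The square root is rewritten as a complex power so that the residue matches `zetaResidue` factor
by factor and the germs agree by definition. -/
theorem dedekindZeta_residue_eq_cpow (k : NumberSubfield) :
    (NumberField.dedekindZeta_residue k.1 : ℂ) =
      2 ^ NumberField.InfinitePlace.nrRealPlaces k.1 *
        (2 * Real.pi) ^ NumberField.InfinitePlace.nrComplexPlaces k.1 *
        NumberField.classNumber k.1 * NumberField.Units.regulator k.1 /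
      (NumberField.Units.torsionOrder k.1 *
        ((|NumberField.discr k.1| : ℤ) : ℂ) ^ (1 / 2 : ℂ)) := by
  have h : ((|NumberField.discr k.1| : ℤ) : ℂ) ^ (1 / 2 : ℂ) =
      (√|(NumberField.discr k.1 : ℝ)| : ℂ) := by
    rw [Real.sqrt_eq_rpow, Complex.ofReal_cpow (abs_nonneg _), ← Int.cast_abs,
      Complex.ofReal_intCast]
    norm_num
  rw [h, NumberField.dedekindZeta_residue_def]
  push_cast
  ring

end Transfer

/-! ### The theorem for hyper number fields -/

theorem mainTheorem3 {I : Type*} (F : Ultrafilter I) (K : Subfield (Hyper F ℂ))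
    (hK : IsHyperNumberField K) (n : Hyper F ℕ) (hn : HasHyperDegree K n) :
    ∃ Z : Hyper F (ℂ → ℂ),
      (∀ s : Hyper F ℂ, 1 < hre s → HasQLimit (fun M => hK.partialZeta M s) (happ Z s)) ∧
      QAnalyticOn Z {s | s ≠ 1} ∧
      HasSimpleQPole Z 1 hK.zetaResidue ∧
      ∀ s : Hyper F ℂ, s ≠ 1 → (∀ m : Hyper F ℕ, s ≠ -hnat m) →
        happ Z (1 - s) = hK.zetaFactor n s * happ Z s := by
  obtain ⟨k, hk⟩ : ∃ k : I → NumberSubfield, (k : Hyper F NumberSubfield) = hK.toStar :=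
    Quotient.exists_rep hK.toStar
  have hmem : ∀ x : I → ℂ, (x : Hyper F ℂ) ∈ K ↔ ∀ᶠ i in (F : Filter I), x i ∈ (k i).1 := by
    intro x
    rw [hK.mem_iff, ← hk, Germ.liftRel_coe]
  have hres : hK.zetaResidue =
      ((fun i => (NumberField.dedekindZeta_residue (k i).1 : ℂ) : I → ℂ) : Hyper F ℂ) := by
    simp only [dedekindZeta_residue_eq_cpow]
    rw [IsHyperNumberField.zetaResidue, IsHyperNumberField.absDiscr, IsHyperNumberField.r₁,
      IsHyperNumberField.r₂, IsHyperNumberField.classNumber, IsHyperNumberField.regulator,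
      IsHyperNumberField.rootsOfUnityCount, IsHyperNumberField.discr, ← hk]
    rfl
  have hne : ∀ s : I → ℂ, (s : Hyper F ℂ) ≠ 1 → ∀ᶠ i in (F : Filter I), s i ≠ 1 := fun s hs =>
    Ultrafilter.eventually_not.2 fun h => hs (Germ.coe_eq.2 h)
  -- The regular part at the pole is a germ of entire functions, so the radius 1 is arbitrary.
  refine ⟨((fun i => dedekindContinuation (k i) : I → ℂ → ℂ) : Hyper F (ℂ → ℂ)),
    fun s hs => ?_, ?_, ⟨?_, 1, one_pos, ((fun i => dedekindEntire (k i).1 : I → ℂ → ℂ) :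
      Hyper F (ℂ → ℂ)), ?_, fun z _ hz => ?_⟩, fun s hs1 hs => ?_⟩
  · induction s using Germ.inductionOn with | _ s =>
    have hs' : ∀ᶠ i in (F : Filter I), 1 < (s i).re := Germ.coe_lt.1 hs
    have h := hasQLimit_coe (F := F) (u := fun i M => partialDedekindZeta (k i) M (s i))
      (hs'.mono fun i hi => tendsto_partialDedekindZeta (k i) hi)
    have h1 : (fun M => hK.partialZeta M (s : Hyper F ℂ)) = fun M => happ
        ((fun i M => partialDedekindZeta (k i) M (s i) : I → ℕ → ℂ) : Hyper F (ℕ → ℂ)) M := by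
      funext M
      induction M using Germ.inductionOn with | _ M =>
      rw [IsHyperNumberField.partialZeta, ← hk]
      rfl
    rw [h1]
    exact h
  · exact qAnalyticOn_coe (U := fun _ => {1}ᶜ) (fun _ => isOpen_compl_singleton)
      (fun i => differentiableOn_dedekindContinuation (k i)) fun z hz => hne z hz
  · rw [hres]
    intro h
    have h' : ∀ᶠ i in (F : Filter I),
      (NumberField.dedekindZeta_residue (k i).1 : ℂ) = 0 := Germ.coe_eq.1 h
    obtain ⟨i, hi⟩ := h'.exists
    exact NumberField.dedekindZeta_residue_ne_zero (k i).1 (Complex.ofReal_eq_zero.1 hi)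
  · exact qAnalyticOn_coe (U := fun _ => Set.univ) (fun _ => isOpen_univ)
      (fun i => differentiable_dedekindEntire.differentiableOn) fun z _ => by simp
  · rw [hres]
    induction z using Germ.inductionOn with | _ z => rfl
  · induction s using Germ.inductionOn with | _ s =>
    induction n using Germ.inductionOn with | _ N =>
    have hN := hn.eventually_eq_finrank hmem
    -- If s i were a nonpositive integer on a large set, those integers would define a hypernatural
    -- m with s = -m, which is excluded.
    have hs' : ∀ᶠ i in (F : Filter I), ∀ m : ℕ, s i ≠ -m := by
      by_contra hcon
      have hcon' : ∀ᶠ i in (F : Filter I), ∃ m : ℕ, s i = -m := by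
        refine (Ultrafilter.eventually_not.2 hcon).mono fun i hi => ?_
        push Not at hi
        exact hi
      obtain ⟨m, hm⟩ := hcon'.choice
      exact hs (m : Hyper F ℕ) (Germ.coe_eq.2 hm)
    have hfac : hK.zetaFactor (N : Hyper F ℕ) (s : Hyper F ℂ) =
        ((fun i => 2 ^ N i * (2 * Real.pi : ℂ) ^ (-(N i * s i)) *
          ((|NumberField.discr (k i).1| : ℤ) : ℂ) ^ (s i - 1 / 2) *
          Complex.cos (Real.pi / 2 * s i) ^ (NumberField.InfinitePlace.nrRealPlaces (k i).1 +
            NumberField.InfinitePlace.nrComplexPlaces (k i).1) *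
          Complex.sin (Real.pi / 2 * s i) ^ NumberField.InfinitePlace.nrComplexPlaces (k i).1 *
          Complex.Gamma (s i) ^ N i : I → ℂ) : Hyper F ℂ) := by
      rw [IsHyperNumberField.zetaFactor, IsHyperNumberField.absDiscr, IsHyperNumberField.r₁,
        IsHyperNumberField.r₂, IsHyperNumberField.discr, ← hk]
      rfl
    rw [hfac]
    refine Germ.coe_eq.2 ?_
    filter_upwards [hN, hs', hne s hs1] with i h1 h2 h3
    rw [h1]
    exact dedekindContinuation_one_sub h3 h2
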